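/- Let $n,d\ge 1$ and let $X_1,\dots,X_n$ be (possibly dependent) $\mathbb{R}^d$-valued random vectors on a probability space, with $\mathbb{E}\|X_i\|^2<\infty$, such that $X=(X_1,\dots,X_n)$ has a joint density on $(\mathbb{R}^d)^n$. For a random vector $V$ with Lebesgue density $f$ let $h(V)=-\int f\log f$ be its differential entropy, and let $h(U|V)=h(U,V)-h(V)$. Assume that $f\log f$ is integrable for the density $f$ of each of the vectors $X$, $X_1+\dots+X_n$ and $(X_j)_{j\neq i}$, $1\le i\le n$ (for $n=1$ the empty vector $(X_j)_{j\ne 1}$ takes values in a one-point space and has entropy $0$). For a random vector $Y=(Y_1,\dots,Y_m)$ in $(\mathbb{R}^d)^m$ with a $C^1$ density $p$, let $\rho_i=-\nabla_i p/p\in\mathbb{R}^d$ (where $\nabla_i$ is the gradient in the $i$-th block of variables), let $I_{ij}(Y)=\mathbb{E}\langle\rho_i(Y),\rho_j(Y)\rangle$ be the entries of its Fisher information matrix, and let $I(Y)=\int |\nabla p|^2/p$ be its Fisher information. Let $\lambda_i>0$ be given by $$\lambda_i^2=\frac{e^{\frac2d h(X_i|X_j,\,j\ne i)}}{\sum_{k=1}^n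 e^{\frac2d h(X_k|X_j,\,j\ne k)}},\qquad 1\le i\le n,$$ and set $\bar X_i=X_i/\lambda_i$ and $\bar Y_i(s)=e^{-s}\bar X_i+\sqrt{1-e^{-2s}}\,Z_i$ for $s\ge 0$, where $Z_1,\dots,Z_n\sim N(0,\mathrm{Id}_{\mathbb{R}^d})$ are independent standard Gaussian vectors, and $(Z_1,\dots,Z_n)$ is independent of $X$. Write $\bar I_{ij}(s)=I_{ij}(\bar Y_1(s),\dots,\bar Y_n(s))$. Then for every $s>0$ the vector $(\bar Y_1(s),\dots,\bar Y_n(s))$ and its subvectors $(\bar Y_j(s))_{j\neq i}$, $1\le i\le n$, have $C^1$ densities and finite Fisher information; the integral $$\bar S=\frac2d\int_0^\infty\Big[\sum_{i,j=1}^n\lambda_i\lambda_j\bar I_{ij}(s)-\sum_{i=1}^n\bar I_{ii}(s)+\sum_{i=1}^n\lambda_i^2\,I(\bar Y_j(s),\,j\ne i)\Big]ds$$ converges absolutely; and $$e^{\frac2d h(X_1+\dots+X_n)}\ \ge\ \Big(\sum_{i=1}^n e^{\frac2d h(X_i|X_j,\,j\ne i)}\Big)e^{-\bar S}.$$ In particular,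 if $\bar I_{ij}(s)\le 0$ for all $i\ne j$ and all $s>0$, then $$e^{\frac2d h(X_1+\dots+X_n)}\ \ge\ \sum_{i=1}^n e^{\frac2d h(X_i|X_j,\,j\ne i)}.$$ -/

import Mathlib

open MeasureTheory ProbabilityTheory

noncomputable section

namespace DepEPI

/-- `ℝ^d` with its Euclidean structure. -/
abbrev E (d : ℕ) : Type := EuclideanSpace ℝ (Fin d)

section Entropy

variable {Ω : Type*} [MeasurableSpace Ω] {A B : Type*} [MeasureSpace A] [MeasureSpace B]

/-- The density `f` of `X` with respect to Lebesgue measure is such that `f log f` is integrable,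
so that the differential entropy is well defined and finite. -/
def HasFiniteEntropy (P : Measure Ω) (X : Ω → A) : Prop :=
  Integrable (fun x => Real.negMulLog (pdf X P volume x).toReal) volume

/-- Differential entropy `h(X) = - ∫ f log f`, where `f` is the density of `X`. -/
def entropy (P : Measure Ω) (X : Ω → A) : ℝ :=
  ∫ x, Real.negMulLog (pdf X P volume x).toReal

/-- Conditional entropy `h(X | Y) = h(X, Y) - h(Y)`. -/
def condEntropy (P : Measure Ω) (X : Ω → A) (Y : Ω → B) : ℝ :=
  entropy P (fun ω => (X ω, Y ω)) - entropy P Y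

end Entropy

section Vectors

variable {Ω ι : Type*} {d : ℕ}

/-- The random vector `(X_i)_{i ∈ ι}` with values in `(ℝ^d)^ι`. -/
def vec (X : ι → Ω → E d) : Ω → ι → E d := fun ω i => X i ω

/-- The family `(X_j)_{j ≠ i}`. -/
def others (X : ι → Ω → E d) (i : ι) : {j : ι // j ≠ i} → Ω → E d := fun j => X j

/-- Ornstein-Uhlenbeck flow `Y_i(s) = e^{-s} X_i + √(1 - e^{-2s}) Z_i`. -/
def ouFlow (X Z : ι → Ω → E d) (s : ℝ) : ι → Ω → E d := fun i ω =>
  Real.exp (-s) • X i ω + Real.sqrt (1 - Real.exp (-2 * s)) • Z i ω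

end Vectors

section Fisher

variable {Ω : Type*} [MeasurableSpace Ω] {ι : Type*} [Fintype ι] {d : ℕ}

/-- `p` is a continuously differentiable density of the random vector `(X_i)_i`. -/
def IsC1Density (P : Measure Ω) (X : ι → Ω → E d) (p : (ι → E d) → ℝ) : Prop :=
  ContDiff ℝ 1 p ∧ (∀ x, 0 ≤ p x) ∧
    P.map (vec X) = volume.withDensity (fun x => ENNReal.ofReal (p x))

/-- A continuously differentiable density is unique, hence the choice made in `c1Density`
is immaterial. -/
theorem isC1Density_unique {P : Measure Ω} [IsProbabilityMeasure P] {X : ι → Ω → E d}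
    {p q : (ι → E d) → ℝ} (hp : IsC1Density P X p) (hq : IsC1Density P X q) : p = q := by
  have hpm : Measurable (fun x => ENNReal.ofReal (p x)) := hp.1.continuous.measurable.ennreal_ofReal
  have hqm : Measurable (fun x => ENNReal.ofReal (q x)) := hq.1.continuous.measurable.ennreal_ofReal
  have h := hp.2.2.symm.trans hq.2.2
  have hae := (withDensity_eq_iff_of_sigmaFinite hpm.aemeasurable hqm.aemeasurable).1 h
  refine (Continuous.ae_eq_iff_eq volume hp.1.continuous hq.1.continuous).1 ?_
  filter_upwards [hae] with x hx
  exact (ENNReal.ofReal_eq_ofReal_iff (hp.2.1 x) (hq.2.1 x)).1 hx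

open Classical in
/-- The continuously differentiable density of the random vector `(X_i)_i`
(the zero function if there is none). -/
def c1Density (P : Measure Ω) (X : ι → Ω → E d) : (ι → E d) → ℝ :=
  if h : ∃ p, IsC1Density P X p then h.choose else 0

variable [DecidableEq ι]

/-- The partial gradient `∇_i p (x) ∈ ℝ^d` with respect to the `i`-th block of variables. -/
def partialGrad (p : (ι → E d) → ℝ) (i : ι) (x : ι → E d) : E d :=
  gradient (fun v : E d => p (Function.update x i v)) (x i)

/-- The `i`-th component `ρ_i = - ∇_i p / p` of the score function of `(X_i)_i`. -/
def score (P : Measure Ω) (X : ι → Ω → E d) (i : ι) (x : ι → E d) : E d :=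
  -((c1Density P X x)⁻¹ • partialGrad (c1Density P X) i x)

/-- The entry `I_ij(X) = 𝔼 ⟨ρ_i(X), ρ_j(X)⟩` of the Fisher information matrix. -/
def fisherEntry (P : Measure Ω) (X : ι → Ω → E d) (i j : ι) : ℝ :=
  ∫ ω, inner ℝ (score P X i (vec X ω)) (score P X j (vec X ω)) ∂P

/-- The integrand `|∇p|² / p` of the Fisher information of the random vector `(X_i)_i`. -/
def fisherDensity (P : Measure Ω) (X : ι → Ω → E d) (x : ι → E d) : ℝ :=
  (∑ i, ‖partialGrad (c1Density P X) i x‖ ^ 2) / c1Density P X x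

/-- The Fisher information `I(X) = ∫ |∇p|² / p` of the random vector `(X_i)_i`. -/
def fisherInfo (P : Measure Ω) (X : ι → Ω → E d) : ℝ :=
  ∫ x, fisherDensity P X x

/-- The random vector `(X_i)_i` has a continuously differentiable density and a finite Fisher
information. -/
def HasFiniteFisherInfo (P : Measure Ω) (X : ι → Ω → E d) : Prop :=
  (∃ p, IsC1Density P X p) ∧ Integrable (fisherDensity P X) volume

end Fisher

section EPI

variable {Ω : Type*} [MeasurableSpace Ω] {n d : ℕ}

/-- The conditional entropy power `e^{(2/d) h(X_i | X_j, j ≠ i)}`. -/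
def condEntropyPower (P : Measure Ω) (X : Fin n → Ω → E d) (i : Fin n) : ℝ :=
  Real.exp (2 / d * condEntropy P (X i) (vec (others X i)))

/-- The positive weights `λ_i`, where `λ_i²` is the normalized conditional entropy power. -/
def weight (P : Measure Ω) (X : Fin n → Ω → E d) (i : Fin n) : ℝ :=
  Real.sqrt (condEntropyPower P X i / ∑ k, condEntropyPower P X k)

/-- The rescaled vectors `X_i / λ_i`. -/
def rescaled (P : Measure Ω) (X : Fin n → Ω → E d) : Fin n → Ω → E d := fun i ω =>
  (weight P X i)⁻¹ • X i ω

/-- `∑_{i,j} λ_i λ_j I_ij(Y) - ∑_i I_ii(Y) + ∑_i λ_i² I(Y_j, j ≠ i)`. -/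
def fisherDefect (P : Measure Ω) (lam : Fin n → ℝ) (Y : Fin n → Ω → E d) : ℝ :=
  ∑ i, ∑ j, lam i * lam j * fisherEntry P Y i j - ∑ i, fisherEntry P Y i i
    + ∑ i, lam i ^ 2 * fisherInfo P (others Y i)

/-- The integrand, at time `s`, of the error term `S̄`. -/
def errorIntegrand (P : Measure Ω) (X Z : Fin n → Ω → E d) (s : ℝ) : ℝ :=
  fisherDefect P (weight P X) (ouFlow (rescaled P X) Z s)

/-- The error term `S̄`. -/
def errorTerm (P : Measure Ω) (X Z : Fin n → Ω → E d) : ℝ :=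
  2 / d * ∫ s in Set.Ioi (0 : ℝ), errorIntegrand P X Z s

end EPI

end DepEPI

end

open DepEPI

/-!
The inequality is obtained by integrating the Fisher information defect along the
Ornstein-Uhlenbeck flow.

Let `V = (X_1 / λ_1, …, X_n / λ_n)`, let `ρ` be the score of the flow at time `s` and let
`r = ρ - Y` be the score relative to the standard Gaussian measure. By de Bruijn's identity the
integral of `𝔼 ‖r‖²` over `(0, ∞)` is the relative entropy of `V` with respect to the Gaussian
measure (`integral_relScore_eq_relEntropy`), which is the opposite of the differential entropy up to
the second moment and a constant. The same holds for each subvector `(X_j / λ_j)_{j ≠ i}` and for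
`S = ∑ X_i = ∑ λ_i V_i`. The last one is the image of `V` under a linear map `T` which sends a
standard Gaussian vector to a standard Gaussian vector, because `∑ λ_i² = 1`. So the relative score
of the flow of `S` is the conditional expectation of `T r` given the flow of `S`, and is therefore
smaller in mean square (`IsGaussianPair.integral_norm_relScore_comp_le`); both facts come from the
representation of the score of a Gaussian perturbation as a conditional expectation of the Gaussian
vector (`integral_inner_heatScore`).

Passing from `ρ` to `r` changes the quadratic quantities by explicit second-order moments, and in
the defect all the constant contributions cancel (`fisherDefect_ouFlow`). Its integral is therefore
at least `-h(S) + ∑ λ_i² (h(X_i | X_j, j ≠ i) - d log λ_i)` (`le_integral_fisherDefect`). The choice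
of the weights makes every bracket equal to `d / 2` times the logarithm of the sum of the conditional
entropy powers (`condEntropy_sub_log_weight`), which gives the main inequality. When the off-diagonal
entries of the Fisher information matrix are nonpositive, the first sum of the defect is at most
`∑ λ_i² I_ii`, and the Fisher information of `(Y_j)_{j ≠ i}` is at most `∑_{j ≠ i} I_jj`, so the
defect is nonpositive (`fisherDefect_ouFlow_nonpos`).

Integrating de Bruijn's identity requires the behaviour of the entropy of `V + √t G` at both ends.
For large `t` it is compared to a Gaussian entropy, from below by concavity and from above by Gibbs'
inequality (`tendsto_heatEntropy_atTop`). As `t` tends to zero it converges to the entropy of `V`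
(`tendsto_heatEntropy_zero`): it is larger by concavity, and upper semicontinuity follows from
Fatou's lemma applied to the relative entropy with respect to a Gaussian measure.
-/

noncomputable section

namespace DepEPI

open Filter Topology Module Set
open scoped RealInnerProductSpace

section

variable {F : Type*} [NormedAddCommGroup F] [InnerProductSpace ℝ F]

/-! ### The Gaussian kernel -/

/-- The density of the centred Gaussian vector of covariance `t • Id`. -/
def gaussKernel (t : ℝ) (x : F) : ℝ :=
  (2 * Real.pi * t) ^ (-(finrank ℝ F / 2 : ℝ)) * Real.exp (-‖x‖ ^ 2 / (2 * t))

lemma gaussKernel_pos {t : ℝ} (ht : 0 < t) (x : F) : 0 < gaussKernel t x := by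
  unfold gaussKernel; positivity

lemma gaussKernel_nonneg {t : ℝ} (ht : 0 < t) (x : F) : 0 ≤ gaussKernel t x :=
  (gaussKernel_pos ht x).le

lemma gaussKernel_neg (t : ℝ) (x : F) : gaussKernel t (-x) = gaussKernel t x := by
  simp [gaussKernel]

lemma log_gaussKernel {t : ℝ} (ht : 0 < t) (x : F) :
    Real.log (gaussKernel t x)
      = -(finrank ℝ F / 2 : ℝ) * Real.log (2 * Real.pi * t) - ‖x‖ ^ 2 / (2 * t) := by
  have h : 0 < 2 * Real.pi * t := by positivity
  rw [gaussKernel, Real.log_mul (by positivity) (by positivity), Real.log_rpow h, Real.log_exp]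
  ring

lemma gaussKernel_le {t : ℝ} (ht : 0 < t) (x : F) :
    gaussKernel t x ≤ (2 * Real.pi * t) ^ (-(finrank ℝ F / 2 : ℝ)) := by
  unfold gaussKernel
  refine mul_le_of_le_one_right (by positivity) (Real.exp_le_one_iff.2 ?_)
  rw [neg_div]
  have : 0 ≤ ‖x‖ ^ 2 / (2 * t) := by positivity
  linarith

lemma continuous_gaussKernel (t : ℝ) : Continuous (gaussKernel (F := F) t) := by
  unfold gaussKernel; fun_prop

lemma measurable_gaussKernel_uncurry [MeasurableSpace F] [BorelSpace F] :
    Measurable (fun p : ℝ × F => gaussKernel p.1 p.2) := by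
  unfold gaussKernel; fun_prop

/-- On compact time intervals, a Gaussian kernel times a quadratic polynomial is dominated by a
multiple of a wider Gaussian kernel. -/
lemma exists_gaussKernel_bound {a b : ℝ} (ha : 0 < a) (hab : a ≤ b) :
    ∃ C > 0, ∀ t ∈ Icc a b, ∀ x : F,
      (1 + ‖x‖ ^ 2) * gaussKernel t x ≤ C * gaussKernel (2 * b) x := by
  have hb : 0 < b := ha.trans_le hab
  set p : ℝ := -(finrank ℝ F / 2 : ℝ) with hp
  have hp0 : p ≤ 0 := by rw [hp]; simp; positivity
  have hA : 0 < (2 * Real.pi * (2 * b)) ^ p := by positivity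
  have hB : 0 < (2 * Real.pi * a) ^ p := by positivity
  refine ⟨(1 + 4 * b) * (2 * Real.pi * a) ^ p / (2 * Real.pi * (2 * b)) ^ p, by positivity, ?_⟩
  rintro t ⟨hat, htb⟩ x
  have ht : 0 < t := ha.trans_le hat
  have h1 : (2 * Real.pi * t) ^ p ≤ (2 * Real.pi * a) ^ p :=
    Real.rpow_le_rpow_of_nonpos (by positivity) (by gcongr) hp0
  -- half of the exponent absorbs the quadratic factor, since `r * exp (-r) ≤ 1`
  have h2 : Real.exp (-‖x‖ ^ 2 / (2 * t)) = Real.exp (-(‖x‖ ^ 2 / (4 * t))) *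
      Real.exp (-‖x‖ ^ 2 / (4 * t)) := by
    rw [← Real.exp_add]; congr 1; field_simp; ring
  have h3 : Real.exp (-‖x‖ ^ 2 / (4 * t)) ≤ Real.exp (-‖x‖ ^ 2 / (2 * (2 * b))) := by
    rw [Real.exp_le_exp, neg_div, neg_div, neg_le_neg_iff]
    exact div_le_div_of_nonneg_left (by positivity) (by positivity) (by linarith)
  have h4 : (1 + ‖x‖ ^ 2) * Real.exp (-(‖x‖ ^ 2 / (4 * t))) ≤ 1 + 4 * b := by
    set r := ‖x‖ ^ 2 / (4 * t) with hr
    have hr0 : 0 ≤ r := by positivity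
    have hx : ‖x‖ ^ 2 = 4 * t * r := by rw [hr]; field_simp
    have e1 : Real.exp (-r) ≤ 1 := Real.exp_le_one_iff.2 (by linarith)
    have e2 : r * Real.exp (-r) ≤ 1 := by
      have := Real.add_one_le_exp r
      rw [Real.exp_neg, ← div_eq_mul_inv, div_le_one (Real.exp_pos r)]; linarith
    rw [hx]
    have : 4 * t * (r * Real.exp (-r)) ≤ 4 * b * 1 := by gcongr
    linarith
  have h5 : (1 + 4 * b) * (2 * Real.pi * a) ^ p / (2 * Real.pi * (2 * b)) ^ p *
      gaussKernel (2 * b) x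
      = (2 * Real.pi * a) ^ p * ((1 + 4 * b) * Real.exp (-‖x‖ ^ 2 / (2 * (2 * b)))) := by
    rw [gaussKernel, ← hp]; field_simp
  rw [h5]
  calc (1 + ‖x‖ ^ 2) * gaussKernel t x
      = (2 * Real.pi * t) ^ p * (((1 + ‖x‖ ^ 2) * Real.exp (-(‖x‖ ^ 2 / (4 * t)))) *
        Real.exp (-‖x‖ ^ 2 / (4 * t))) := by
          rw [gaussKernel, ← hp, h2]; ring
    _ ≤ _ := by gcongr

/-- The derivative in time of the Gaussian kernel. -/
def gaussKernelDeriv (t : ℝ) (x : F) : ℝ :=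
  (‖x‖ ^ 2 / (2 * t ^ 2) - finrank ℝ F / (2 * t)) * gaussKernel t x

lemma hasDerivAt_gaussKernel {t : ℝ} (ht : 0 < t) (x : F) :
    HasDerivAt (fun t => gaussKernel t x) (gaussKernelDeriv t x) t := by
  have hpos : 0 < 2 * Real.pi * t := by positivity
  have h1 : HasDerivAt (fun t : ℝ => (2 * Real.pi * t) ^ (-(finrank ℝ F / 2 : ℝ)))
      (2 * Real.pi * (-(finrank ℝ F / 2 : ℝ)) *
        (2 * Real.pi * t) ^ (-(finrank ℝ F / 2 : ℝ) - 1)) t := by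
    have := ((hasDerivAt_id t).const_mul (2 * Real.pi)).rpow_const
      (p := -(finrank ℝ F / 2 : ℝ)) (Or.inl (by simpa using hpos.ne'))
    simpa using this
  have h2 : HasDerivAt (fun t : ℝ => Real.exp (-‖x‖ ^ 2 / (2 * t)))
      (Real.exp (-‖x‖ ^ 2 / (2 * t)) * (‖x‖ ^ 2 / (2 * t ^ 2))) t := by
    have h : HasDerivAt (fun t : ℝ => -‖x‖ ^ 2 / (2 * t)) (‖x‖ ^ 2 / (2 * t ^ 2)) t := by
      have := (hasDerivAt_inv ht.ne').const_mul (-‖x‖ ^ 2 / 2)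
      refine (this.congr_of_eventuallyEq (Eventually.of_forall fun y => ?_)).congr_deriv ?_
      · simp only; ring
      · ring
    exact h.exp
  refine (h1.mul h2).congr_deriv ?_
  rw [Real.rpow_sub_one hpos.ne', gaussKernelDeriv, gaussKernel]
  field_simp
  ring

/-- The gradient in space of the Gaussian kernel. -/
def gaussKernelGrad (t : ℝ) (x : F) : F := -((gaussKernel t x / t) • x)

lemma continuous_gaussKernelGrad (t : ℝ) : Continuous (gaussKernelGrad (F := F) t) := by
  have := continuous_gaussKernel (F := F) t
  unfold gaussKernelGrad; fun_prop

lemma hasFDerivAt_gaussKernel {t : ℝ} (ht : 0 < t) (x : F) :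
    HasFDerivAt (gaussKernel (F := F) t) (innerSL ℝ (gaussKernelGrad t x)) x := by
  have h1 : HasFDerivAt (fun x : F => -‖x‖ ^ 2 / (2 * t))
      ((-(1 / (2 * t))) • (2 • innerSL ℝ x)) x := by
    have := (hasStrictFDerivAt_norm_sq x).hasFDerivAt.const_mul (-(1 / (2 * t)))
    refine this.congr_of_eventuallyEq (Eventually.of_forall fun y => ?_)
    simp only; ring
  have h2 := (h1.exp).const_mul ((2 * Real.pi * t) ^ (-(finrank ℝ F / 2 : ℝ)))
  refine h2.congr_fderiv ?_
  ext v
  simp [gaussKernelGrad, gaussKernel]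
  field_simp

lemma hasFDerivAt_gaussKernelGrad_inner {t : ℝ} (ht : 0 < t) (x e : F) :
    HasFDerivAt (fun x : F => ⟪gaussKernelGrad t x, e⟫)
      (-((gaussKernel t x / t) • innerSL ℝ e + (⟪x, e⟫ / t) • innerSL ℝ (gaussKernelGrad t x))) x := by
  have h1 : HasFDerivAt (fun x : F => ⟪x, e⟫ / t) ((1 / t) • innerSL ℝ e) x := by
    have := ((innerSL ℝ e).hasFDerivAt (x := x)).const_mul (1 / t)
    refine this.congr_of_eventuallyEq (Eventually.of_forall fun y => ?_)
    simp only [innerSL_apply_apply, real_inner_comm e]; ring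
  have h2 := ((hasFDerivAt_gaussKernel ht x).mul h1).neg
  refine (h2.congr_of_eventuallyEq (Eventually.of_forall fun y => ?_)).congr_fderiv ?_
  · simp [gaussKernelGrad, inner_smul_left]; ring
  · rw [smul_smul, mul_one_div]

/-- The second derivative of the Gaussian kernel in the direction `e`. -/
def gaussKernelHess (t : ℝ) (e x : F) : ℝ :=
  (⟪x, e⟫ ^ 2 / t ^ 2 - ‖e‖ ^ 2 / t) * gaussKernel t x

lemma hasLineDerivAt_gaussKernelGrad_inner {t : ℝ} (ht : 0 < t) (x e : F) :
    HasLineDerivAt ℝ (fun x : F => ⟪gaussKernelGrad t x, e⟫) (gaussKernelHess t e x) x e := by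
  have := (hasFDerivAt_gaussKernelGrad_inner ht x e).hasLineDerivAt e
  convert this using 1
  simp [gaussKernelHess, gaussKernelGrad]
  field_simp
  ring

lemma norm_gaussKernelGrad_le {t : ℝ} (ht : 0 < t) (x : F) :
    ‖gaussKernelGrad t x‖ ≤ (1 / t) * ((1 + ‖x‖ ^ 2) * gaussKernel t x) := by
  have hK := gaussKernel_nonneg ht x
  rw [gaussKernelGrad, norm_neg, norm_smul, Real.norm_of_nonneg (by positivity)]
  have : ‖x‖ ≤ 1 + ‖x‖ ^ 2 := by nlinarith [sq_nonneg (‖x‖ - 1), norm_nonneg x]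
  calc gaussKernel t x / t * ‖x‖ ≤ gaussKernel t x / t * (1 + ‖x‖ ^ 2) := by gcongr
    _ = _ := by ring

lemma abs_gaussKernelDeriv_le {t : ℝ} (ht : 0 < t) (x : F) :
    |gaussKernelDeriv t x| ≤ (1 / (2 * t ^ 2) + finrank ℝ F / (2 * t)) *
      ((1 + ‖x‖ ^ 2) * gaussKernel t x) := by
  have hK := gaussKernel_nonneg ht x
  rw [gaussKernelDeriv, abs_mul, abs_of_nonneg hK, ← mul_assoc]
  refine mul_le_mul_of_nonneg_right ?_ hK
  refine (abs_sub _ _).trans ?_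
  rw [abs_of_nonneg (by positivity), abs_of_nonneg (by positivity)]
  have h1 : 0 ≤ 1 / (2 * t ^ 2) := by positivity
  have h2 : 0 ≤ finrank ℝ F / (2 * t) * ‖x‖ ^ 2 := by positivity
  have h3 : ‖x‖ ^ 2 / (2 * t ^ 2) = 1 / (2 * t ^ 2) * ‖x‖ ^ 2 := by ring
  rw [h3]
  linarith

lemma abs_gaussKernelHess_le {t : ℝ} (ht : 0 < t) (e x : F) :
    |gaussKernelHess t e x| ≤ ‖e‖ ^ 2 * (1 / t ^ 2 + 1 / t) *
      ((1 + ‖x‖ ^ 2) * gaussKernel t x) := by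
  have hK := gaussKernel_nonneg ht x
  rw [gaussKernelHess, abs_mul, abs_of_nonneg hK, ← mul_assoc]
  refine mul_le_mul_of_nonneg_right ?_ hK
  refine (abs_sub _ _).trans ?_
  rw [abs_of_nonneg (by positivity), abs_of_nonneg (by positivity)]
  have h1 : ⟪x, e⟫ ^ 2 ≤ ‖x‖ ^ 2 * ‖e‖ ^ 2 := by
    rw [← mul_pow, ← sq_abs]
    gcongr
    exact abs_real_inner_le_norm x e
  have h4 : ⟪x, e⟫ ^ 2 / t ^ 2 ≤ (‖x‖ ^ 2 * ‖e‖ ^ 2) / t ^ 2 := by gcongr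
  have h2 : 0 ≤ ‖e‖ ^ 2 * (1 / t) * ‖x‖ ^ 2 := by positivity
  have h3 : 0 ≤ ‖e‖ ^ 2 * (1 / t ^ 2) := by positivity
  calc _ ≤ (‖x‖ ^ 2 * ‖e‖ ^ 2) / t ^ 2 + ‖e‖ ^ 2 / t := by gcongr
    _ ≤ _ := by
      have : ‖e‖ ^ 2 * (1 / t ^ 2 + 1 / t) * (1 + ‖x‖ ^ 2) - ((‖x‖ ^ 2 * ‖e‖ ^ 2) / t ^ 2 + ‖e‖ ^ 2 / t)
         = ‖e‖ ^ 2 * (1 / t) * ‖x‖ ^ 2 + ‖e‖ ^ 2 * (1 / t ^ 2) := by ring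
      linarith

lemma sum_gaussKernelHess {ι : Type*} [Fintype ι] (b : OrthonormalBasis ι ℝ F) {t : ℝ}
    (ht : 0 < t) (x : F) :
    ∑ i, gaussKernelHess t (b i) x = 2 * gaussKernelDeriv t x := by
  simp only [gaussKernelHess, gaussKernelDeriv, ← Finset.sum_mul, Finset.sum_sub_distrib,
    ← Finset.sum_div, b.sum_sq_inner_left, b.norm_eq_one]
  rw [finrank_eq_card_basis b.toBasis]
  simp
  field_simp

section Integration

variable [FiniteDimensional ℝ F] [MeasurableSpace F] [BorelSpace F]

lemma integral_gaussKernel {t : ℝ} (ht : 0 < t) : ∫ x : F, gaussKernel t x = 1 := by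
  have h := GaussianFourier.integral_rexp_neg_mul_sq_norm (V := F) (b := 1 / (2 * t))
    (by positivity)
  have h2 : ∀ x : F, Real.exp (-‖x‖ ^ 2 / (2 * t)) = Real.exp (-(1 / (2 * t)) * ‖x‖ ^ 2) := by
    intro x; congr 1; ring
  simp only [gaussKernel, h2]
  rw [integral_const_mul, h, show Real.pi / (1 / (2 * t)) = 2 * Real.pi * t by field_simp,
    ← Real.rpow_add (by positivity)]
  simp

lemma integrable_gaussKernel {t : ℝ} (ht : 0 < t) : Integrable (gaussKernel (F := F) t) :=
  Integrable.of_integral_ne_zero (by rw [integral_gaussKernel ht]; exact one_ne_zero)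

lemma integrable_one_add_sq_mul_gaussKernel {t : ℝ} (ht : 0 < t) :
    Integrable (fun x : F => (1 + ‖x‖ ^ 2) * gaussKernel t x) := by
  obtain ⟨C, hC, h⟩ := exists_gaussKernel_bound (F := F) ht le_rfl
  refine ((integrable_gaussKernel (F := F) (t := 2 * t) (by positivity)).const_mul C).mono'
    (by have := continuous_gaussKernel (F := F) t; fun_prop) (Eventually.of_forall fun x => ?_)
  have := gaussKernel_nonneg ht x
  rw [Real.norm_of_nonneg (by positivity)]
  exact h t ⟨le_rfl, le_rfl⟩ x

/-- The standard Gaussian measure has the Gaussian kernel of time `1` as a density. -/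
lemma stdGaussian_eq_withDensity :
    stdGaussian F = volume.withDensity (fun x => ENNReal.ofReal (gaussKernel 1 x)) := by
  have hm : Measurable (fun x : F => ENNReal.ofReal (gaussKernel 1 x)) :=
    (continuous_gaussKernel 1).measurable.ennreal_ofReal
  have : IsFiniteMeasure (volume.withDensity
      (fun x : F => ENNReal.ofReal (gaussKernel 1 x))) := by
    refine isFiniteMeasure_withDensity_ofReal (integrable_gaussKernel one_pos).2
  apply Measure.ext_of_charFun
  ext ξ
  rw [charFun_stdGaussian, charFun_apply,
    integral_withDensity_eq_integral_toReal_smul hm (by simp)]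
  have h := GaussianFourier.integral_cexp_neg_mul_sq_norm_add (V := F) (b := 1 / 2) (by norm_num)
    Complex.I ξ
  have hpi : (0 : ℝ) < 2 * Real.pi := by positivity
  have h2 : ∀ x : F, (ENNReal.ofReal (gaussKernel 1 x)).toReal • Complex.exp (⟪x, ξ⟫ * Complex.I)
      = (((2 * Real.pi) ^ (-(finrank ℝ F / 2 : ℝ)) : ℝ) : ℂ) *
        Complex.exp (-(1 / 2) * ‖x‖ ^ 2 + Complex.I * ⟪ξ, x⟫) := by
    intro x
    rw [ENNReal.toReal_ofReal (gaussKernel_nonneg one_pos x), gaussKernel, Complex.real_smul,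
      Complex.exp_add, real_inner_comm ξ x]
    push_cast
    rw [mul_one, mul_one, mul_assoc]
    congr 3
    · ring_nf
    · ring_nf
  simp only [h2]
  rw [integral_const_mul, h]
  have h3 : ((Real.pi : ℂ) / (1 / 2)) ^ (finrank ℝ F / 2 : ℂ)
      = (((2 * Real.pi) ^ (finrank ℝ F / 2 : ℝ) : ℝ) : ℂ) := by
    rw [Complex.ofReal_cpow hpi.le]
    push_cast
    congr 1
    ring
  rw [h3, ← mul_assoc, ← Complex.ofReal_mul, ← Real.rpow_add hpi]
  simp
  ring_nf

end Integration

end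

section

variable {F : Type*} [NormedAddCommGroup F] [InnerProductSpace ℝ F]

/-! ### Evolution of a probability measure under the heat flow -/

lemma exists_gaussKernel_bound_const {a b : ℝ} (ha : 0 < a) (hab : a ≤ b) :
    ∃ C > 0, ∀ t ∈ Icc a b, ∀ x : F, (1 + ‖x‖ ^ 2) * gaussKernel t x ≤ C := by
  obtain ⟨C, hC, h⟩ := exists_gaussKernel_bound (F := F) ha hab
  have hb : 0 < b := ha.trans_le hab
  refine ⟨C * (2 * Real.pi * (2 * b)) ^ (-(finrank ℝ F / 2 : ℝ)), by positivity, ?_⟩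
  intro t ht x
  refine (h t ht x).trans ?_
  gcongr
  exact gaussKernel_le (by positivity) x

section Heat

variable [FiniteDimensional ℝ F] [MeasurableSpace F] [BorelSpace F]

/-- The density at time `t` of the heat flow started at `ν`, i.e. the density of `U + √t G` for
`U` of law `ν` and `G` an independent standard Gaussian vector. -/
def heat (ν : Measure F) (t : ℝ) (y : F) : ℝ := ∫ x, gaussKernel t (y - x) ∂ν

/-- The gradient in space of `heat ν t`. -/
def heatGrad (ν : Measure F) (t : ℝ) (y : F) : F := ∫ x, gaussKernelGrad t (y - x) ∂ν

/-- The derivative in time of `heat ν t`. -/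
def heatDeriv (ν : Measure F) (t : ℝ) (y : F) : ℝ := ∫ x, gaussKernelDeriv t (y - x) ∂ν

/-- The second derivative in the direction `e` of `heat ν t`. -/
def heatHess (ν : Measure F) (t : ℝ) (e y : F) : ℝ := ∫ x, gaussKernelHess t e (y - x) ∂ν

variable (ν : Measure F) [IsProbabilityMeasure ν]

lemma integrable_comp_sub_of_le {G : Type*} [NormedAddCommGroup G] [MeasurableSpace G]
    {g : F → G} {c t : ℝ} (ht : 0 < t) (hc : 0 ≤ c) (hg : Continuous g)
    (hle : ∀ x, ‖g x‖ ≤ c * ((1 + ‖x‖ ^ 2) * gaussKernel t x)) (y : F) :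
    Integrable (fun x => g (y - x)) ν := by
  obtain ⟨C, hC, h⟩ := exists_gaussKernel_bound_const (F := F) ht le_rfl
  refine (integrable_const (c * C)).mono'
    (hg.comp (continuous_const.sub continuous_id)).aestronglyMeasurable
    (Eventually.of_forall fun x => (hle _).trans ?_)
  gcongr
  exact h t ⟨le_rfl, le_rfl⟩ _

omit [FiniteDimensional ℝ F] [MeasurableSpace F] [BorelSpace F] in
lemma gaussKernel_le_one_add_sq {t : ℝ} (ht : 0 < t) (x : F) :
    gaussKernel t x ≤ (1 + ‖x‖ ^ 2) * gaussKernel t x :=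
  le_mul_of_one_le_left (gaussKernel_nonneg ht x) (by nlinarith [sq_nonneg ‖x‖])

lemma integrable_gaussKernel_sub {t : ℝ} (ht : 0 < t) (y : F) :
    Integrable (fun x => gaussKernel t (y - x)) ν :=
  integrable_comp_sub_of_le ν ht zero_le_one (continuous_gaussKernel t) (fun x => by
    rw [Real.norm_of_nonneg (gaussKernel_nonneg ht x), one_mul]
    exact gaussKernel_le_one_add_sq ht x) y

lemma integrable_sq_mul_gaussKernel_sub {t : ℝ} (ht : 0 < t) (y : F) :
    Integrable (fun x => (1 + ‖y - x‖ ^ 2) * gaussKernel t (y - x)) ν :=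
  integrable_comp_sub_of_le ν (g := fun x => (1 + ‖x‖ ^ 2) * gaussKernel t x) ht zero_le_one
    (by have := continuous_gaussKernel (F := F) t; fun_prop) (fun x => by
      have := gaussKernel_nonneg ht x
      rw [Real.norm_of_nonneg (by positivity), one_mul]) y

lemma integrable_gaussKernelGrad_sub {t : ℝ} (ht : 0 < t) (y : F) :
    Integrable (fun x => gaussKernelGrad t (y - x)) ν :=
  integrable_comp_sub_of_le ν ht (by positivity) (continuous_gaussKernelGrad t)
    (norm_gaussKernelGrad_le ht) y

omit [FiniteDimensional ℝ F] [MeasurableSpace F] [BorelSpace F] in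
lemma continuous_gaussKernelDeriv (t : ℝ) : Continuous (gaussKernelDeriv (F := F) t) := by
  have := continuous_gaussKernel (F := F) t
  unfold gaussKernelDeriv; fun_prop

omit [FiniteDimensional ℝ F] [MeasurableSpace F] [BorelSpace F] in
lemma continuous_gaussKernelHess (t : ℝ) (e : F) : Continuous (gaussKernelHess t e) := by
  have := continuous_gaussKernel (F := F) t
  unfold gaussKernelHess; fun_prop

lemma integrable_gaussKernelDeriv_sub {t : ℝ} (ht : 0 < t) (y : F) :
    Integrable (fun x => gaussKernelDeriv t (y - x)) ν :=
  integrable_comp_sub_of_le ν ht (by positivity) (continuous_gaussKernelDeriv t)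
    (abs_gaussKernelDeriv_le ht) y

lemma integrable_gaussKernelHess_sub {t : ℝ} (ht : 0 < t) (e y : F) :
    Integrable (fun x => gaussKernelHess t e (y - x)) ν :=
  integrable_comp_sub_of_le ν ht (by positivity) (continuous_gaussKernelHess t e)
    (abs_gaussKernelHess_le ht e) y

lemma heat_pos {t : ℝ} (ht : 0 < t) (y : F) : 0 < heat ν t y := by
  rw [heat, integral_pos_iff_support_of_nonneg (fun x => gaussKernel_nonneg ht _)
    (integrable_gaussKernel_sub ν ht y)]
  have : Function.support (fun x => gaussKernel t (y - x)) = univ := by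
    ext x; simp [(gaussKernel_pos ht (y - x)).ne']
  simp [this]

lemma heat_le {t : ℝ} (ht : 0 < t) (y : F) :
    heat ν t y ≤ (2 * Real.pi * t) ^ (-(finrank ℝ F / 2 : ℝ)) := by
  have := integral_mono (integrable_gaussKernel_sub ν ht y)
    (integrable_const ((2 * Real.pi * t) ^ (-(finrank ℝ F / 2 : ℝ))))
    (fun x => gaussKernel_le ht (y - x))
  simpa [heat] using this

omit [IsProbabilityMeasure ν] in
lemma norm_integral_sub_le_heat {G : Type*} [NormedAddCommGroup G] [NormedSpace ℝ G]
    [IsProbabilityMeasure ν] {g : F → G} {c t T : ℝ} (hT : 0 < T)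
    (hle : ∀ x, ‖g x‖ ≤ c * ((1 + ‖x‖ ^ 2) * gaussKernel t x)) (hc : 0 ≤ c) {C : ℝ}
    (hC : ∀ x : F, (1 + ‖x‖ ^ 2) * gaussKernel t x ≤ C * gaussKernel T x) (y : F) :
    ‖∫ x, g (y - x) ∂ν‖ ≤ c * C * heat ν T y := by
  rw [heat, ← integral_const_mul]
  refine norm_integral_le_of_norm_le ((integrable_gaussKernel_sub ν hT y).const_mul _)
    (Eventually.of_forall fun x => (hle _).trans ?_)
  rw [mul_assoc]
  exact mul_le_mul_of_nonneg_left (hC _) hc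

/-- All the derivatives of the heat flow which appear below are dominated, locally uniformly in
time, by the heat flow at a later time. -/
lemma exists_heat_bounds {a b : ℝ} (ha : 0 < a) (hab : a ≤ b) :
    ∃ C > 0, ∀ t ∈ Icc a b, ∀ y : F, heat ν t y ≤ C * heat ν (2 * b) y ∧
      ‖heatGrad ν t y‖ ≤ C * heat ν (2 * b) y ∧ |heatDeriv ν t y| ≤ C * heat ν (2 * b) y ∧
      ∀ e, ‖e‖ = 1 → |heatHess ν t e y| ≤ C * heat ν (2 * b) y := by
  obtain ⟨C, hC, h⟩ := exists_gaussKernel_bound (F := F) ha hab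
  have hb : 0 < b := ha.trans_le hab
  have hT : 0 < 2 * b := by positivity
  set c1 := 1 / a
  set c2 : ℝ := 1 / (2 * a ^ 2) + finrank ℝ F / (2 * a) with hc2
  set c3 : ℝ := 1 / a ^ 2 + 1 / a with hc3
  have p1 : 0 ≤ c1 := by positivity
  have p2 : 0 ≤ c2 := by positivity
  have p3 : 0 ≤ c3 := by positivity
  refine ⟨(1 + c1 + c2 + c3) * C, by positivity, fun t ht y => ?_⟩
  have htp : 0 < t := ha.trans_le ht.1
  have hH := (heat_pos ν hT y).le
  have hpoly : ∀ x : F, 0 ≤ (1 + ‖x‖ ^ 2) * gaussKernel t x := fun x => by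
    have := gaussKernel_nonneg htp x; positivity
  have key : ∀ c, 0 ≤ c → c ≤ 1 + c1 + c2 + c3 →
      c * C * heat ν (2 * b) y ≤ (1 + c1 + c2 + c3) * C * heat ν (2 * b) y := by
    intro c _ hc; gcongr
  refine ⟨?_, ?_, ?_, fun e he => ?_⟩
  · have := norm_integral_sub_le_heat ν (g := gaussKernel t) (c := 1) hT (fun x => by
      rw [Real.norm_of_nonneg (gaussKernel_nonneg htp x), one_mul]
      exact gaussKernel_le_one_add_sq htp x) zero_le_one (h t ht) y
    exact (le_abs_self _).trans (this.trans (key 1 zero_le_one (by linarith)))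
  · refine (norm_integral_sub_le_heat ν (c := c1) hT (fun x =>
      (norm_gaussKernelGrad_le htp x).trans ?_) p1 (h t ht) y).trans (key c1 p1 (by linarith))
    exact mul_le_mul_of_nonneg_right (one_div_le_one_div_of_le ha ht.1) (hpoly x)
  · refine (norm_integral_sub_le_heat ν (g := gaussKernelDeriv t) (c := c2) hT (fun x =>
      (abs_gaussKernelDeriv_le htp x).trans ?_) p2 (h t ht) y).trans (key c2 p2 (by linarith))
    refine mul_le_mul_of_nonneg_right ?_ (hpoly x)
    have := ht.1
    rw [hc2]; gcongr
  · refine (norm_integral_sub_le_heat ν (g := gaussKernelHess t e) (c := c3) hT (fun x =>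
      (abs_gaussKernelHess_le htp e x).trans ?_) p3 (h t ht) y).trans (key c3 p3 (by linarith))
    refine mul_le_mul_of_nonneg_right ?_ (hpoly x)
    have := ht.1
    rw [hc3, he, one_pow, one_mul]; gcongr

lemma hasFDerivAt_heat {t : ℝ} (ht : 0 < t) (y : F) :
    HasFDerivAt (heat ν t) (innerSL ℝ (heatGrad ν t y)) y := by
  obtain ⟨C, hC, h⟩ := exists_gaussKernel_bound_const (F := F) ht le_rfl
  have key := hasFDerivAt_integral_of_dominated_of_fderiv_le (𝕜 := ℝ) (μ := ν)
    (F := fun y x => gaussKernel t (y - x))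
    (F' := fun y x => innerSL ℝ (gaussKernelGrad t (y - x))) (x₀ := y) (s := univ)
    (bound := fun _ => 1 / t * C) univ_mem
    (Eventually.of_forall fun z => (integrable_gaussKernel_sub ν ht z).aestronglyMeasurable)
    (integrable_gaussKernel_sub ν ht y)
    ((innerSL ℝ).continuous.comp_aestronglyMeasurable
      (integrable_gaussKernelGrad_sub ν ht y).aestronglyMeasurable)
    (Eventually.of_forall fun x z _ => by
      rw [innerSL_apply_norm]
      refine (norm_gaussKernelGrad_le ht _).trans ?_
      gcongr
      exact h t ⟨le_rfl, le_rfl⟩ _)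
    (integrable_const _)
    (Eventually.of_forall fun x z _ => by
      have := (hasFDerivAt_gaussKernel ht (z - x)).comp z ((hasFDerivAt_id z).sub_const x)
      simpa [Function.comp_def] using this)
  refine key.congr_fderiv ?_
  exact (innerSL ℝ).integral_comp_comm (integrable_gaussKernelGrad_sub ν ht y)

lemma continuous_heat {t : ℝ} (ht : 0 < t) : Continuous (heat ν t) :=
  continuous_iff_continuousAt.2 fun y => (hasFDerivAt_heat ν ht y).continuousAt

lemma continuous_heatGrad {t : ℝ} (ht : 0 < t) : Continuous (heatGrad ν t) := by
  obtain ⟨C, hC, h⟩ := exists_gaussKernel_bound_const (F := F) ht le_rfl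
  refine continuous_of_dominated (bound := fun _ => 1 / t * C)
    (fun y => (integrable_gaussKernelGrad_sub ν ht y).aestronglyMeasurable)
    (fun y => Eventually.of_forall fun x => ?_) (integrable_const _)
    (Eventually.of_forall fun x =>
      (continuous_gaussKernelGrad t).comp (continuous_id.sub continuous_const))
  refine (norm_gaussKernelGrad_le ht _).trans ?_
  gcongr
  exact h t ⟨le_rfl, le_rfl⟩ _

lemma contDiff_heat {t : ℝ} (ht : 0 < t) : ContDiff ℝ 1 (heat ν t) := by
  rw [contDiff_one_iff_hasFDerivAt]
  exact ⟨_, (innerSL ℝ).continuous.comp (continuous_heatGrad ν ht), hasFDerivAt_heat ν ht⟩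

lemma inner_heatGrad {t : ℝ} (ht : 0 < t) (y e : F) :
    ⟪heatGrad ν t y, e⟫ = ∫ x, ⟪gaussKernelGrad t (y - x), e⟫ ∂ν := by
  rw [heatGrad, real_inner_comm, ← integral_inner (integrable_gaussKernelGrad_sub ν ht y)]
  simp only [real_inner_comm]

lemma hasLineDerivAt_heatGrad_inner {t : ℝ} (ht : 0 < t) (y e : F) :
    HasLineDerivAt ℝ (fun y => ⟪heatGrad ν t y, e⟫) (heatHess ν t e y) y e := by
  obtain ⟨C, hC, h⟩ := exists_gaussKernel_bound_const (F := F) ht le_rfl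
  simp only [inner_heatGrad ν ht, HasLineDerivAt]
  have key := hasDerivAt_integral_of_dominated_loc_of_deriv_le (𝕜 := ℝ) (μ := ν)
    (F := fun (r : ℝ) x => ⟪gaussKernelGrad t (y + r • e - x), e⟫)
    (F' := fun r x => gaussKernelHess t e (y + r • e - x)) (x₀ := 0) (s := univ)
    (bound := fun _ => ‖e‖ ^ 2 * (1 / t ^ 2 + 1 / t) * C) univ_mem
    (Eventually.of_forall fun r =>
      (integrable_gaussKernelGrad_sub ν ht _).aestronglyMeasurable.inner_const)
    ((integrable_gaussKernelGrad_sub ν ht _).inner_const _)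
    (integrable_gaussKernelHess_sub ν ht e _).aestronglyMeasurable
    (Eventually.of_forall fun x r _ => (abs_gaussKernelHess_le ht _ _).trans (by
      gcongr
      exact h t ⟨le_rfl, le_rfl⟩ _))
    (integrable_const _)
    (Eventually.of_forall fun x r _ => by
      have h1 := hasLineDerivAt_gaussKernelGrad_inner ht (y + r • e - x) e
      unfold HasLineDerivAt at h1
      have h2 := (h1.scomp_of_eq r ((hasDerivAt_id r).sub_const r) (by simp))
      simp only [one_smul] at h2
      refine h2.congr_of_eventuallyEq (Eventually.of_forall fun s => ?_)
      simp only [Function.comp_apply, id]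
      congr 2
      module)
  simpa [heatHess] using key.2

lemma hasDerivAt_heat {t : ℝ} (ht : 0 < t) (y : F) :
    HasDerivAt (fun t => heat ν t y) (heatDeriv ν t y) t := by
  obtain ⟨C, hC, h⟩ := exists_gaussKernel_bound_const (F := F) (a := t / 2) (b := 2 * t)
    (by positivity) (by linarith)
  have hs : Icc (t / 2) (2 * t) ∈ 𝓝 t := Icc_mem_nhds (by linarith) (by linarith)
  exact (hasDerivAt_integral_of_dominated_loc_of_deriv_le (𝕜 := ℝ) (μ := ν)
    (F := fun t x => gaussKernel t (y - x))
    (F' := fun t x => gaussKernelDeriv t (y - x)) (x₀ := t)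
    (bound := fun _ => (1 / (2 * (t / 2) ^ 2) + finrank ℝ F / (2 * (t / 2))) * C) hs
    (Eventually.of_forall fun r =>
      ((continuous_gaussKernel r).comp (continuous_const.sub continuous_id)).aestronglyMeasurable)
    (integrable_gaussKernel_sub ν ht _)
    (integrable_gaussKernelDeriv_sub ν ht _).aestronglyMeasurable
    (Eventually.of_forall fun x r hr => by
      have hr0 : 0 < r := (half_pos ht).trans_le hr.1
      refine (abs_gaussKernelDeriv_le hr0 _).trans ?_
      have := hr.1
      have hK := gaussKernel_nonneg hr0 (y - x)
      gcongr
      exact h r hr _)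
    (integrable_const _)
    (Eventually.of_forall fun x r hr =>
      hasDerivAt_gaussKernel ((half_pos ht).trans_le hr.1) _)).2

lemma sum_heatHess {ι : Type*} [Fintype ι] (b : OrthonormalBasis ι ℝ F) {t : ℝ}
    (ht : 0 < t) (y : F) : ∑ i, heatHess ν t (b i) y = 2 * heatDeriv ν t y := by
  simp only [heatHess, heatDeriv]
  rw [← integral_finsetSum _ fun i _ => integrable_gaussKernelHess_sub ν ht (b i) y,
    ← integral_const_mul]
  simp only [sum_gaussKernelHess b ht]

lemma measurable_heat {t : ℝ} (ht : 0 < t) : Measurable (heat ν t) :=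
  (continuous_heat ν ht).measurable

/-! ### Integrability along the heat flow -/

lemma integrable_prod_gaussKernel {ν : Measure F} [IsProbabilityMeasure ν]
    (hν : MemLp id 2 ν) {t : ℝ} (ht : 0 < t) :
    Integrable (fun p : F × F => (1 + ‖p.1‖ ^ 2) * gaussKernel t (p.1 - p.2))
      (volume.prod ν) := by
  have h1 : Integrable (fun x : F => 1 + ‖x‖ ^ 2) ν :=
    (integrable_const _).add (by simpa using hν.integrable_norm_pow (by norm_num))
  have h2 := (h1.convolution_integrand (ContinuousLinearMap.mul ℝ ℝ)
    (integrable_one_add_sq_mul_gaussKernel (F := F) ht)).const_mul 2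
  refine h2.mono' ?_ (Eventually.of_forall fun p => ?_)
  · have := continuous_gaussKernel (F := F) t
    exact Continuous.aestronglyMeasurable (by fun_prop)
  · have hK := gaussKernel_nonneg ht (p.1 - p.2)
    rw [Real.norm_of_nonneg (by positivity)]
    simp only [ContinuousLinearMap.mul_apply', ← mul_assoc]
    refine mul_le_mul_of_nonneg_right ?_ hK
    -- `1 + ‖y‖² ≤ 2 (1 + ‖x‖²) (1 + ‖y - x‖²)`
    have h3 : ‖p.1‖ ≤ ‖p.2‖ + ‖p.1 - p.2‖ := by
      simpa [add_comm] using norm_add_le p.2 (p.1 - p.2)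
    nlinarith [sq_nonneg (‖p.2‖ - ‖p.1 - p.2‖), norm_nonneg p.1,
      mul_nonneg (sq_nonneg ‖p.2‖) (sq_nonneg ‖p.1 - p.2‖), norm_nonneg p.2,
      norm_nonneg (p.1 - p.2)]

lemma integrable_one_add_sq_mul_heat (hν : MemLp id 2 ν) {t : ℝ} (ht : 0 < t) :
    Integrable (fun y : F => (1 + ‖y‖ ^ 2) * heat ν t y) := by
  have := (integrable_prod_gaussKernel hν ht).integral_prod_left
  simpa only [integral_const_mul, heat] using this

omit [IsProbabilityMeasure ν] in
lemma integral_gaussKernel_sub {t : ℝ} (ht : 0 < t) (x : F) :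
    ∫ y, gaussKernel t (y - x) = 1 := by
  rw [integral_sub_right_eq_self (gaussKernel t) x, integral_gaussKernel ht]

lemma integrable_prod_gaussKernel_one {t : ℝ} (ht : 0 < t) :
    Integrable (fun p : F × F => gaussKernel t (p.1 - p.2)) (volume.prod ν) := by
  have := (integrable_const (1 : ℝ) (μ := ν)).convolution_integrand (ContinuousLinearMap.mul ℝ ℝ)
    (integrable_gaussKernel (F := F) ht)
  simpa using this

lemma integrable_heat {t : ℝ} (ht : 0 < t) : Integrable (heat ν t) :=
  (integrable_prod_gaussKernel_one ν ht).integral_prod_left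

lemma integral_heat {t : ℝ} (ht : 0 < t) : ∫ y, heat ν t y = 1 := by
  have := integral_integral_swap (f := fun y x : F => gaussKernel t (y - x))
    (integrable_prod_gaussKernel_one ν ht)
  simp only [heat, this, integral_gaussKernel_sub ht]
  simp

/-- A lower bound for the logarithm of the heat flow, by Jensen's inequality for `exp`. -/
lemma log_heat_ge (hν : MemLp id 2 ν) {t : ℝ} (ht : 0 < t) (y : F) :
    -(finrank ℝ F / 2 : ℝ) * Real.log (2 * Real.pi * t) -
      (‖y‖ ^ 2 + ∫ x, ‖x‖ ^ 2 ∂ν) / t ≤ Real.log (heat ν t y) := by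
  rw [Real.le_log_iff_exp_le (heat_pos ν ht y)]
  have hsq : Integrable (fun x : F => ‖x‖ ^ 2) ν := by
    simpa using hν.integrable_norm_pow (by norm_num)
  have h2 : Integrable (fun x => ‖y - x‖ ^ 2) ν := by
    have : MemLp (fun x => y - x) 2 ν := (memLp_const y).sub hν
    simpa using this.integrable_norm_pow (by norm_num)
  have hlog : Integrable (fun x => Real.log (gaussKernel t (y - x))) ν := by
    simp only [log_gaussKernel ht]
    exact (integrable_const _).sub (h2.div_const _)
  have hJ := convexOn_exp.map_integral_le (μ := ν) (f := fun x => Real.log (gaussKernel t (y - x)))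
    Real.continuous_exp.continuousOn isClosed_univ (by simp) hlog (by
      simpa [Function.comp_def, Real.exp_log (gaussKernel_pos ht _)] using
        integrable_gaussKernel_sub ν ht y)
  simp only [Real.exp_log (gaussKernel_pos ht _)] at hJ
  refine le_trans (Real.exp_le_exp.2 ?_) hJ
  simp only [log_gaussKernel ht]
  rw [integral_sub (integrable_const _) (h2.div_const _), integral_const, integral_div]
  simp only [probReal_univ, one_smul]
  have h3 : ∫ x, ‖y - x‖ ^ 2 ∂ν ≤ 2 * (‖y‖ ^ 2 + ∫ x, ‖x‖ ^ 2 ∂ν) := by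
    have : ∫ x, ‖y - x‖ ^ 2 ∂ν ≤ ∫ x, 2 * (‖y‖ ^ 2 + ‖x‖ ^ 2) ∂ν := by
      refine integral_mono h2 (((integrable_const _).add hsq).const_mul 2) fun x => ?_
      have := norm_sub_le y x
      nlinarith [norm_nonneg (y - x), sq_nonneg (‖y‖ - ‖x‖)]
    rw [integral_const_mul, integral_add (integrable_const _) hsq] at this
    simpa using this
  have h4 : (∫ x, ‖y - x‖ ^ 2 ∂ν) / (2 * t) ≤ (‖y‖ ^ 2 + ∫ x, ‖x‖ ^ 2 ∂ν) / t := by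
    rw [div_le_div_iff₀ (by positivity) ht]
    nlinarith
  linarith

/-- At positive times the logarithm of the heat flow grows at most quadratically in space, so that
second moments control all the entropy integrals. -/
lemma exists_abs_log_heat_le (hν : MemLp id 2 ν) {a b : ℝ} (ha : 0 < a) (hab : a ≤ b) :
    ∃ A > 0, ∀ t ∈ Icc a b, ∀ y : F, |Real.log (heat ν t y)| ≤ A * (1 + ‖y‖ ^ 2) := by
  have hb : 0 < b := ha.trans_le hab
  set M := ∫ x, ‖x‖ ^ 2 ∂ν
  have hM : 0 ≤ M := integral_nonneg fun x => by positivity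
  set l := |Real.log (2 * Real.pi * a)| + |Real.log (2 * Real.pi * b)|
  have hl : 0 ≤ l := by positivity
  refine ⟨(finrank ℝ F / 2 : ℝ) * l + (1 + M) / a, by positivity, fun t ht y => ?_⟩
  have htp : 0 < t := ha.trans_le ht.1
  have hlog : |Real.log (2 * Real.pi * t)| ≤ l := by
    have h1 : Real.log (2 * Real.pi * a) ≤ Real.log (2 * Real.pi * t) :=
      Real.log_le_log (by positivity) (by have := ht.1; gcongr)
    have h2 : Real.log (2 * Real.pi * t) ≤ Real.log (2 * Real.pi * b) :=
      Real.log_le_log (by positivity) (by have := ht.2; gcongr)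
    have h3 := neg_abs_le (Real.log (2 * Real.pi * a))
    have h4 := le_abs_self (Real.log (2 * Real.pi * b))
    have h5 := abs_nonneg (Real.log (2 * Real.pi * a))
    have h6 := abs_nonneg (Real.log (2 * Real.pi * b))
    rw [abs_le]; constructor <;> linarith
  obtain ⟨hl1, hl2⟩ := abs_le.1 hlog
  have hN : (0 : ℝ) ≤ finrank ℝ F / 2 := by positivity
  have e1 := mul_le_mul_of_nonneg_left hl1 hN
  have e2 := mul_le_mul_of_nonneg_left hl2 hN
  have hy : 0 ≤ ‖y‖ ^ 2 := by positivity
  have e3 : 0 ≤ (finrank ℝ F / 2 : ℝ) * l * ‖y‖ ^ 2 := by positivity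
  have e4 : (‖y‖ ^ 2 + M) / t ≤ (1 + M) / a * (1 + ‖y‖ ^ 2) := by
    have : (‖y‖ ^ 2 + M) / t ≤ (‖y‖ ^ 2 + M) / a :=
      div_le_div_of_nonneg_left (by positivity) ha ht.1
    refine this.trans ?_
    rw [div_mul_eq_mul_div]
    gcongr
    nlinarith [mul_nonneg hM hy]
  have e5 : 0 ≤ (1 + M) / a * (1 + ‖y‖ ^ 2) := by positivity
  rw [abs_le]
  constructor
  · have := log_heat_ge ν hν htp y
    nlinarith
  · have h1 := Real.log_le_log (heat_pos ν htp y) (heat_le ν htp y)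
    rw [Real.log_rpow (by positivity)] at h1
    nlinarith

omit [FiniteDimensional ℝ F] [MeasurableSpace F] [BorelSpace F] in
/-- The Cauchy-Schwarz inequality for vector-valued weighted averages. -/
lemma norm_integral_smul_sq_le {α : Type*} [MeasurableSpace α] {μ : Measure α} {k : α → ℝ}
    {v : α → F} (hk : ∀ x, 0 ≤ k x) (hk1 : Integrable k μ)
    (hk2 : Integrable (fun x => k x * ‖v x‖ ^ 2) μ) (hv : AEStronglyMeasurable v μ)
    (hkpos : 0 < ∫ x, k x ∂μ) :
    ‖∫ x, k x • v x ∂μ‖ ^ 2 ≤ (∫ x, k x ∂μ) * ∫ x, k x * ‖v x‖ ^ 2 ∂μ := by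
  have hB : Integrable (fun x => k x * ‖v x‖) μ := by
    refine (hk1.add hk2).mono' (hk1.aestronglyMeasurable.mul hv.norm)
      (Eventually.of_forall fun x => ?_)
    rw [Real.norm_of_nonneg (mul_nonneg (hk x) (norm_nonneg _))]
    have := hk x
    have h : ‖v x‖ ≤ 1 + ‖v x‖ ^ 2 := by nlinarith [sq_nonneg (‖v x‖ - 1), norm_nonneg (v x)]
    calc k x * ‖v x‖ ≤ k x * (1 + ‖v x‖ ^ 2) := by gcongr
      _ = _ := by simp only [Pi.add_apply]; ring
  set A := ∫ x, k x * ‖v x‖ ^ 2 ∂μ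
  set B := ∫ x, k x * ‖v x‖ ∂μ
  set K := ∫ x, k x ∂μ
  have h1 : ‖∫ x, k x • v x ∂μ‖ ≤ B := by
    refine norm_integral_le_of_norm_le hB (Eventually.of_forall fun x => ?_)
    rw [norm_smul, Real.norm_of_nonneg (hk x)]
  have h2 : 0 ≤ A - 2 * (B / K) * B + (B / K) ^ 2 * K := by
    have : ∫ x, k x * (‖v x‖ - B / K) ^ 2 ∂μ = A - 2 * (B / K) * B + (B / K) ^ 2 * K := by
      have e : ∀ x, k x * (‖v x‖ - B / K) ^ 2 = k x * ‖v x‖ ^ 2 - 2 * (B / K) * (k x * ‖v x‖)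
          + (B / K) ^ 2 * k x := fun x => by ring
      have hs : Integrable (fun x => k x * ‖v x‖ ^ 2 - 2 * (B / K) * (k x * ‖v x‖)) μ :=
        hk2.sub (hB.const_mul _)
      simp only [e]
      rw [integral_add hs (hk1.const_mul _),
        integral_sub hk2 (hB.const_mul _), integral_const_mul, integral_const_mul]
    rw [← this]
    exact integral_nonneg fun x => mul_nonneg (hk x) (sq_nonneg _)
  have h3 : A - 2 * (B / K) * B + (B / K) ^ 2 * K = (K * A - B ^ 2) / K := by
    field_simp; ring
  rw [h3, le_div_iff₀ hkpos] at h2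
  have h4 : ‖∫ x, k x • v x ∂μ‖ ^ 2 ≤ B ^ 2 := by gcongr
  linarith

/-- The Cauchy-Schwarz inequality for the average defining `heatGrad` bounds the Fisher information
density by an average of translates of a single integrable function. -/
lemma heatGrad_sq_div_heat_le {t : ℝ} (ht : 0 < t) (y : F) :
    ‖heatGrad ν t y‖ ^ 2 / heat ν t y ≤
      ∫ x, 1 / t ^ 2 * ((1 + ‖y - x‖ ^ 2) * gaussKernel t (y - x)) ∂ν := by
  have h2 := (integrable_sq_mul_gaussKernel_sub ν ht y).const_mul (1 / t ^ 2)
  have hK : ∀ x : F, 0 ≤ gaussKernel t (y - x) := fun x => gaussKernel_nonneg ht _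
  have e : ∀ x : F, ‖-((1 / t) • (y - x))‖ ^ 2 = 1 / t ^ 2 * ‖y - x‖ ^ 2 := by
    intro x
    rw [norm_neg, norm_smul, mul_pow, Real.norm_of_nonneg (by positivity)]; ring
  have hle : ∀ x : F, gaussKernel t (y - x) * ‖-((1 / t) • (y - x))‖ ^ 2 ≤
      1 / t ^ 2 * ((1 + ‖y - x‖ ^ 2) * gaussKernel t (y - x)) := by
    intro x
    rw [e]
    have h := hK x
    have : 0 ≤ 1 / t ^ 2 * gaussKernel t (y - x) := by positivity
    nlinarith
  have h3 : Integrable (fun x => gaussKernel t (y - x) * ‖-((1 / t) • (y - x))‖ ^ 2) ν := by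
    refine h2.mono' ?_ (Eventually.of_forall fun x => ?_)
    · have := continuous_gaussKernel (F := F) t
      exact Continuous.aestronglyMeasurable (by fun_prop)
    · rw [Real.norm_of_nonneg (mul_nonneg (hK x) (by positivity))]
      exact hle x
  have key := norm_integral_smul_sq_le (k := fun x => gaussKernel t (y - x))
    (v := fun x => -((1 / t) • (y - x))) hK (integrable_gaussKernel_sub ν ht y)
    h3 (Continuous.aestronglyMeasurable (by fun_prop)) (heat_pos ν ht y)
  have e2 : ∀ x, gaussKernel t (y - x) • -((1 / t) • (y - x)) = gaussKernelGrad t (y - x) := by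
    intro x; rw [gaussKernelGrad, smul_neg, smul_smul, mul_one_div]
  simp only [e2] at key
  rw [div_le_iff₀ (heat_pos ν ht y), mul_comm]
  refine key.trans ?_
  change heat ν t y * _ ≤ _
  exact mul_le_mul_of_nonneg_left (integral_mono h3 h2 hle) (heat_pos ν ht y).le

/-- The heat flow has finite Fisher information at positive times. -/
lemma integrable_heatGrad_sq_div_heat {t : ℝ} (ht : 0 < t) :
    Integrable (fun y => ‖heatGrad ν t y‖ ^ 2 / heat ν t y) := by
  have h1 := ((integrable_const (1 : ℝ) (μ := ν)).convolution_integrand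
    (ContinuousLinearMap.mul ℝ ℝ)
    ((integrable_one_add_sq_mul_gaussKernel (F := F) ht).const_mul (1 / t ^ 2))).integral_prod_left
  simp only [ContinuousLinearMap.mul_apply', one_mul] at h1
  refine h1.mono' ?_ (Eventually.of_forall fun y => ?_)
  · have h1 := continuous_heat ν ht
    have h2 := continuous_heatGrad ν ht
    exact ((h2.norm.pow 2).div h1 fun y => (heat_pos ν ht y).ne').aestronglyMeasurable
  · have := heat_pos ν ht y
    rw [Real.norm_of_nonneg (by positivity)]
    exact heatGrad_sq_div_heat_le ν ht y

end Heat

end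

section

variable {F : Type*} [NormedAddCommGroup F] [InnerProductSpace ℝ F] [FiniteDimensional ℝ F]
  [MeasurableSpace F] [BorelSpace F]

/-! ### De Bruijn's identity -/

/-- The differential entropy of the heat flow at time `t`. -/
def heatEntropy (ν : Measure F) (t : ℝ) : ℝ := ∫ y, Real.negMulLog (heat ν t y)

/-- The Fisher information of the heat flow at time `t`. -/
def heatFisher (ν : Measure F) (t : ℝ) : ℝ := ∫ y, ‖heatGrad ν t y‖ ^ 2 / heat ν t y

variable {ν : Measure F} [IsProbabilityMeasure ν]

/-- A function dominated by `(1 + ‖y‖²)` times the heat flow at some time is integrable. -/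
lemma integrable_of_norm_le_heat (hν : MemLp id 2 ν) {G : Type*} [NormedAddCommGroup G]
    {g : F → G} {c T : ℝ} (hT : 0 < T) (hg : AEStronglyMeasurable g volume)
    (hle : ∀ y, ‖g y‖ ≤ c * ((1 + ‖y‖ ^ 2) * heat ν T y)) : Integrable g :=
  ((integrable_one_add_sq_mul_heat ν hν hT).const_mul c).mono' hg (Eventually.of_forall hle)

lemma integrable_negMulLog_heat (hν : MemLp id 2 ν) {t : ℝ} (ht : 0 < t) :
    Integrable (fun y => Real.negMulLog (heat ν t y)) := by
  obtain ⟨A, hA, hlog⟩ := exists_abs_log_heat_le ν hν ht le_rfl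
  refine integrable_of_norm_le_heat (c := A) hν ht
    (Real.continuous_negMulLog.comp (continuous_heat ν ht)).aestronglyMeasurable fun y => ?_
  have hp := heat_pos ν ht y
  rw [Real.negMulLog, norm_mul, norm_neg, Real.norm_of_nonneg hp.le, Real.norm_eq_abs]
  have := hlog t ⟨le_rfl, le_rfl⟩ y
  calc heat ν t y * |Real.log (heat ν t y)| ≤ heat ν t y * (A * (1 + ‖y‖ ^ 2)) := by gcongr
    _ = _ := by ring

lemma continuous_heatHess {t : ℝ} (ht : 0 < t) (e : F) : Continuous (heatHess ν t e) := by
  obtain ⟨C, hC, h⟩ := exists_gaussKernel_bound_const (F := F) ht le_rfl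
  refine continuous_of_dominated (bound := fun _ => ‖e‖ ^ 2 * (1 / t ^ 2 + 1 / t) * C)
    (fun y => (integrable_gaussKernelHess_sub ν ht e y).aestronglyMeasurable)
    (fun y => Eventually.of_forall fun x => ?_) (integrable_const _)
    (Eventually.of_forall fun x =>
      (continuous_gaussKernelHess t e).comp (continuous_id.sub continuous_const))
  refine (abs_gaussKernelHess_le ht _ _).trans ?_
  gcongr
  exact h t ⟨le_rfl, le_rfl⟩ _

lemma continuous_log_heat {t : ℝ} (ht : 0 < t) : Continuous (fun y => Real.log (heat ν t y)) :=
  (continuous_heat ν ht).log fun y => (heat_pos ν ht y).ne'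

/-- Integration by parts in the direction of the unit vector `e`. -/
lemma integral_log_heat_mul_heatHess (hν : MemLp id 2 ν) {t : ℝ} (ht : 0 < t) {e : F}
    (he : ‖e‖ = 1) :
    Integrable (fun y => (-Real.log (heat ν t y) - 1) * heatHess ν t e y) ∧
    Integrable (fun y => ⟪heatGrad ν t y, e⟫ ^ 2 / heat ν t y) ∧
    ∫ y, (-Real.log (heat ν t y) - 1) * heatHess ν t e y =
      ∫ y, ⟪heatGrad ν t y, e⟫ ^ 2 / heat ν t y := by
  obtain ⟨A, hA, hlog⟩ := exists_abs_log_heat_le ν hν ht le_rfl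
  obtain ⟨C, hC, hb⟩ := exists_heat_bounds ν ht le_rfl
  have hl : ∀ y, |-Real.log (heat ν t y) - 1| ≤ (A + 1) * (1 + ‖y‖ ^ 2) := by
    intro y
    have h1 := hlog t ⟨le_rfl, le_rfl⟩ y
    have h2 : |-Real.log (heat ν t y) - 1| ≤ |Real.log (heat ν t y)| + 1 := by
      simpa using abs_sub (-Real.log (heat ν t y)) 1
    nlinarith [sq_nonneg ‖y‖]
  have hcl : Continuous (fun y => -Real.log (heat ν t y) - 1) :=
    (continuous_log_heat ht).neg.sub continuous_const
  have hT : 0 < 2 * t := by positivity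
  have hdom : ∀ (k : F → ℝ), Continuous k → (∀ y, |k y| ≤ C * heat ν (2 * t) y) →
      Integrable (fun y => (-Real.log (heat ν t y) - 1) * k y) := by
    intro k hk hkb
    refine integrable_of_norm_le_heat (c := (A + 1) * C) hν hT
      (hcl.mul hk).aestronglyMeasurable fun y => ?_
    rw [norm_mul, Real.norm_eq_abs, Real.norm_eq_abs]
    calc _ ≤ ((A + 1) * (1 + ‖y‖ ^ 2)) * (C * heat ν (2 * t) y) :=
          mul_le_mul (hl y) (hkb y) (abs_nonneg _) (by positivity)
      _ = _ := by ring
  have hinner : ∀ y, |⟪heatGrad ν t y, e⟫| ≤ ‖heatGrad ν t y‖ := by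
    intro y; simpa [he] using abs_real_inner_le_norm (heatGrad ν t y) e
  have hcg : Continuous (fun y => ⟪heatGrad ν t y, e⟫) :=
    (continuous_heatGrad ν ht).inner continuous_const
  have i1 := hdom _ (continuous_heatHess ht e)
    (fun y => (hb t ⟨le_rfl, le_rfl⟩ y).2.2.2 e he)
  have i2 := hdom _ hcg (fun y => (hinner y).trans (hb t ⟨le_rfl, le_rfl⟩ y).2.1)
  have i3 : Integrable (fun y => ⟪heatGrad ν t y, e⟫ ^ 2 / heat ν t y) := by
    refine (integrable_heatGrad_sq_div_heat ν ht).mono'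
      ((hcg.pow 2).div (continuous_heat ν ht) fun y => (heat_pos ν ht y).ne').aestronglyMeasurable
      (Eventually.of_forall fun y => ?_)
    have hp := heat_pos ν ht y
    rw [Real.norm_of_nonneg (by positivity)]
    refine div_le_div_of_nonneg_right ?_ hp.le
    exact sq_le_sq.2 (by rw [abs_of_nonneg (norm_nonneg _)]; exact hinner y)
  refine ⟨i1, i3, ?_⟩
  have hderiv : ∀ y, HasLineDerivAt ℝ (fun y => -Real.log (heat ν t y) - 1)
      (-(⟪heatGrad ν t y, e⟫ / heat ν t y)) y e := by
    intro y
    have h := (((hasFDerivAt_heat ν ht y).log (heat_pos ν ht y).ne').neg.sub_const 1).hasLineDerivAt e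
    have e1 : (-((heat ν t y)⁻¹ • innerSL ℝ (heatGrad ν t y))) e =
        -(⟪heatGrad ν t y, e⟫ / heat ν t y) := by
      change -((heat ν t y)⁻¹ * ⟪heatGrad ν t y, e⟫) = _
      ring
    rw [e1] at h
    exact h
  have key := integral_bilinear_hasLineDerivAt_right_eq_neg_left_of_integrable
    (μ := (volume : Measure F)) (B := ContinuousLinearMap.mul ℝ ℝ) (v := e)
    (f := fun y => -Real.log (heat ν t y) - 1) (f' := fun y => -(⟪heatGrad ν t y, e⟫ / heat ν t y))
    (g := fun y => ⟪heatGrad ν t y, e⟫) (g' := heatHess ν t e)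
    (by
      refine i3.neg.congr (Eventually.of_forall fun y => ?_)
      simp; ring)
    i1 i2 (fun y _ => hderiv y) (fun y _ => hasLineDerivAt_heatGrad_inner ν ht y e)
  simp only [ContinuousLinearMap.mul_apply'] at key
  rw [key, ← integral_neg]
  congr 1; ext y; ring

/-- **De Bruijn's identity**: the derivative of the entropy along the heat flow is half the Fisher
information. -/
theorem hasDerivAt_heatEntropy (hν : MemLp id 2 ν) {t : ℝ} (ht : 0 < t) :
    HasDerivAt (heatEntropy ν) (heatFisher ν t / 2) t := by
  have ha : 0 < t / 2 := by positivity
  have hab : t / 2 ≤ 2 * t := by linarith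
  obtain ⟨A, hA, hlog⟩ := exists_abs_log_heat_le ν hν ha hab
  obtain ⟨C, hC, hb⟩ := exists_heat_bounds ν ha hab
  have hT : 0 < 2 * (2 * t) := by positivity
  have hmeas : ∀ r, 0 < r → AEStronglyMeasurable (fun y => Real.negMulLog (heat ν r y)) volume :=
    fun r hr => (Real.continuous_negMulLog.comp (continuous_heat ν hr)).aestronglyMeasurable
  -- by the heat equation the time derivative is a sum of second derivatives, which are integrated
  -- by parts one direction at a time
  set b := stdOrthonormalBasis ℝ F
  have hsum : ∀ y, heatDeriv ν t y = (1 / 2) * ∑ i, heatHess ν t (b i) y := by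
    intro y; rw [sum_heatHess ν b ht y]; ring
  have hibp := fun i => integral_log_heat_mul_heatHess hν ht (b.norm_eq_one i)
  have hint : ∀ y, (-Real.log (heat ν t y) - 1) * heatDeriv ν t y =
      (1 / 2) * ∑ i, (-Real.log (heat ν t y) - 1) * heatHess ν t (b i) y := by
    intro y; rw [hsum, ← Finset.mul_sum]; ring
  have key := (hasDerivAt_integral_of_dominated_loc_of_deriv_le (𝕜 := ℝ)
    (μ := (volume : Measure F))
    (F := fun r y => Real.negMulLog (heat ν r y))
    (F' := fun r y => (-Real.log (heat ν r y) - 1) * heatDeriv ν r y) (x₀ := t)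
    (bound := fun y => (A + 1) * C * ((1 + ‖y‖ ^ 2) * heat ν (2 * (2 * t)) y))
    (Icc_mem_nhds (a := t / 2) (b := 2 * t) (by linarith) (by linarith))
    ((eventually_gt_nhds ht).mono hmeas)
    (integrable_negMulLog_heat hν ht)
    (by
      simp only [hint]
      exact ((integrable_finsetSum _ fun i _ => (hibp i).1).const_mul _).aestronglyMeasurable)
    (Eventually.of_forall fun y r hr => by
      have h1 := hlog r hr y
      have h2 : |-Real.log (heat ν r y) - 1| ≤ |Real.log (heat ν r y)| + 1 := by
        simpa using abs_sub (-Real.log (heat ν r y)) 1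
      have h3 : |-Real.log (heat ν r y) - 1| ≤ (A + 1) * (1 + ‖y‖ ^ 2) := by
        nlinarith [sq_nonneg ‖y‖]
      rw [norm_mul, Real.norm_eq_abs, Real.norm_eq_abs]
      calc _ ≤ ((A + 1) * (1 + ‖y‖ ^ 2)) * (C * heat ν (2 * (2 * t)) y) :=
            mul_le_mul h3 (hb r hr y).2.2.1 (abs_nonneg _) (by positivity)
        _ = _ := by ring)
    ((integrable_one_add_sq_mul_heat ν hν hT).const_mul _)
    (Eventually.of_forall fun y r hr => by
      have hr0 : 0 < r := ha.trans_le hr.1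
      exact (Real.hasDerivAt_negMulLog (heat_pos ν hr0 y).ne').comp r (hasDerivAt_heat ν hr0 y))).2
  refine key.congr_deriv ?_
  simp only [hint]
  rw [integral_const_mul, integral_finsetSum _ fun i _ => (hibp i).1]
  simp only [(hibp _).2.2]
  rw [← integral_finsetSum _ fun i _ => (hibp i).2.1, heatFisher, div_eq_inv_mul]
  simp only [← Finset.sum_div, b.sum_sq_inner_left]
  ring

/-! ### Second moments of the heat flow -/

omit [IsProbabilityMeasure ν] in
lemma integrable_sq_mul_gaussKernel {t : ℝ} (ht : 0 < t) :
    Integrable (fun x : F => ‖x‖ ^ 2 * gaussKernel t x) := by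
  have := (integrable_one_add_sq_mul_gaussKernel (F := F) ht).sub (integrable_gaussKernel ht)
  refine this.congr (Eventually.of_forall fun x => ?_)
  simp only [Pi.sub_apply]; ring

lemma integral_gaussKernelHess {t : ℝ} (ht : 0 < t) {e : F} :
    Integrable (gaussKernelHess t e) ∧ ∫ x, gaussKernelHess t e x = 0 := by
  have i1 : Integrable (gaussKernelHess t e) :=
    ((integrable_one_add_sq_mul_gaussKernel (F := F) ht).const_mul _).mono'
      (continuous_gaussKernelHess t e).aestronglyMeasurable
      (Eventually.of_forall (abs_gaussKernelHess_le ht e))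
  have i2 : Integrable (fun x => ⟪gaussKernelGrad t x, e⟫) := by
    have : Integrable (gaussKernelGrad (F := F) t) :=
      ((integrable_one_add_sq_mul_gaussKernel (F := F) ht).const_mul _).mono'
        (continuous_gaussKernelGrad t).aestronglyMeasurable
        (Eventually.of_forall (norm_gaussKernelGrad_le ht))
    exact this.inner_const e
  have key := integral_bilinear_hasLineDerivAt_right_eq_neg_left_of_integrable
    (μ := (volume : Measure F)) (B := ContinuousLinearMap.mul ℝ ℝ) (v := e)
    (f := fun _ => (1 : ℝ)) (f' := fun _ => 0)
    (g := fun x => ⟪gaussKernelGrad t x, e⟫) (g' := gaussKernelHess t e)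
    (by simp) (by simpa using i1) (by simpa using i2)
    (fun x _ => (hasFDerivAt_const (1 : ℝ) x).hasLineDerivAt e)
    (fun x _ => hasLineDerivAt_gaussKernelGrad_inner ht x e)
  exact ⟨i1, by simpa using key⟩

omit [IsProbabilityMeasure ν] in
/-- The second moment of the Gaussian kernel: the time derivative of its total mass vanishes. -/
lemma integral_sq_mul_gaussKernel {t : ℝ} (ht : 0 < t) :
    ∫ x : F, ‖x‖ ^ 2 * gaussKernel t x = finrank ℝ F * t := by
  set b := stdOrthonormalBasis ℝ F
  -- by the heat equation the time derivative is a sum of line derivatives, which integrate to zero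
  have h0 : ∫ x : F, gaussKernelDeriv t x = 0 := by
    have : ∀ x : F, gaussKernelDeriv t x = (1 / 2) * ∑ i, gaussKernelHess t (b i) x := by
      intro x; rw [sum_gaussKernelHess b ht x]; ring
    simp only [this]
    rw [integral_const_mul, integral_finsetSum _ fun i _ => (integral_gaussKernelHess ht).1]
    simp [(integral_gaussKernelHess ht).2]
  have h1 : ∀ x : F, gaussKernelDeriv t x = (1 / (2 * t ^ 2)) * (‖x‖ ^ 2 * gaussKernel t x) -
      (finrank ℝ F / (2 * t)) * gaussKernel t x := by
    intro x; rw [gaussKernelDeriv]; ring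
  simp only [h1] at h0
  rw [integral_sub ((integrable_sq_mul_gaussKernel ht).const_mul _)
    ((integrable_gaussKernel ht).const_mul _), integral_const_mul, integral_const_mul,
    integral_gaussKernel ht, sub_eq_zero] at h0
  field_simp at h0
  linarith

omit [IsProbabilityMeasure ν] in
lemma integral_sq_mul_gaussKernel_sub {t : ℝ} (ht : 0 < t) (x : F) :
    ∫ y : F, ‖y‖ ^ 2 * gaussKernel t (y - x) = ‖x‖ ^ 2 + finrank ℝ F * t := by
  have hsq : Integrable (fun y : F => ‖y‖ ^ 2 * gaussKernel t y) :=
    integrable_sq_mul_gaussKernel ht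
  have hg := integrable_gaussKernel (F := F) ht
  have hcross : Integrable (fun y : F => 2 * ⟪y, x⟫ * gaussKernel t y) := by
    refine (((hsq.const_mul 1).add (hg.const_mul (‖x‖ ^ 2)))).mono' ?_
      (Eventually.of_forall fun y => ?_)
    · have := continuous_gaussKernel (F := F) t
      exact Continuous.aestronglyMeasurable (by fun_prop)
    · have hK := gaussKernel_nonneg ht y
      rw [norm_mul, Real.norm_of_nonneg hK, norm_mul, Real.norm_of_nonneg zero_le_two]
      have h1 : ‖⟪y, x⟫‖ ≤ ‖y‖ * ‖x‖ := norm_inner_le_norm y x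
      have h2 : 2 * ‖⟪y, x⟫‖ ≤ ‖y‖ ^ 2 + ‖x‖ ^ 2 := by nlinarith [sq_nonneg (‖y‖ - ‖x‖)]
      calc _ ≤ (‖y‖ ^ 2 + ‖x‖ ^ 2) * gaussKernel t y := by gcongr
        _ = _ := by simp only [Pi.add_apply]; ring
  have hodd : ∫ y : F, 2 * ⟪y, x⟫ * gaussKernel t y = 0 := by
    have := integral_neg_eq_self (fun y : F => 2 * ⟪y, x⟫ * gaussKernel t y) volume
    simp only [inner_neg_left, gaussKernel_neg, mul_neg, neg_mul] at this
    rw [integral_neg] at this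
    linarith
  have h := integral_sub_right_eq_self (fun y : F => ‖y + x‖ ^ 2 * gaussKernel t y)
    (μ := volume) x
  simp only [sub_add_cancel] at h
  rw [h]
  have e : ∀ y : F, ‖y + x‖ ^ 2 * gaussKernel t y = ‖y‖ ^ 2 * gaussKernel t y +
      2 * ⟪y, x⟫ * gaussKernel t y + ‖x‖ ^ 2 * gaussKernel t y := by
    intro y; rw [norm_add_sq_real]; ring
  simp only [e]
  have hs : Integrable (fun y : F => ‖y‖ ^ 2 * gaussKernel t y + 2 * ⟪y, x⟫ * gaussKernel t y) :=
    hsq.add hcross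
  rw [integral_add hs (hg.const_mul _), integral_add hsq hcross, hodd,
    integral_sq_mul_gaussKernel ht, integral_const_mul, integral_gaussKernel ht]
  ring

omit [InnerProductSpace ℝ F] [FiniteDimensional ℝ F] [BorelSpace F] [IsProbabilityMeasure ν] in
lemma integrable_sq_of_memLp (hν : MemLp id 2 ν) : Integrable (fun x : F => ‖x‖ ^ 2) ν := by
  simpa using hν.integrable_norm_pow (by norm_num)

lemma integrable_sq_mul_heat (hν : MemLp id 2 ν) {t : ℝ} (ht : 0 < t) :
    Integrable (fun y : F => ‖y‖ ^ 2 * heat ν t y) := by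
  refine ((integrable_one_add_sq_mul_heat ν hν ht).sub (integrable_heat ν ht)).congr
    (Eventually.of_forall fun y => ?_)
  simp only [Pi.sub_apply]; ring

lemma integral_sq_mul_heat (hν : MemLp id 2 ν) {t : ℝ} (ht : 0 < t) :
    ∫ y : F, ‖y‖ ^ 2 * heat ν t y = ∫ x, ‖x‖ ^ 2 ∂ν + finrank ℝ F * t := by
  have hp : Integrable (fun p : F × F => ‖p.1‖ ^ 2 * gaussKernel t (p.1 - p.2))
      (volume.prod ν) := by
    refine ((integrable_prod_gaussKernel hν ht).sub (integrable_prod_gaussKernel_one ν ht)).congr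
      (Eventually.of_forall fun p => ?_)
    simp only [Pi.sub_apply]; ring
  have := integral_integral_swap (f := fun y x : F => ‖y‖ ^ 2 * gaussKernel t (y - x)) hp
  simp only [heat, ← integral_const_mul, this, integral_sq_mul_gaussKernel_sub ht]
  rw [integral_add (integrable_sq_of_memLp hν) (integrable_const _)]
  simp

/-! ### Entropy inequalities for the heat flow -/

/-- Averaging the translates of a density increases the entropy. -/
lemma integral_negMulLog_le_of_average {q : F → ℝ} (hq0 : ∀ x, 0 ≤ q x) (hq : Integrable q)
    (hql : Integrable (fun x => Real.negMulLog (q x)))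
    (hp : Integrable (fun y => Real.negMulLog (∫ x, q (y - x) ∂ν))) :
    ∫ x, Real.negMulLog (q x) ≤ ∫ y, Real.negMulLog (∫ x, q (y - x) ∂ν) := by
  have h1 := (integrable_const (1 : ℝ) (μ := ν)).convolution_integrand
    (ContinuousLinearMap.mul ℝ ℝ) hq
  have h2 := (integrable_const (1 : ℝ) (μ := ν)).convolution_integrand
    (ContinuousLinearMap.mul ℝ ℝ) hql
  simp only [ContinuousLinearMap.mul_apply', one_mul] at h1 h2
  have hswap := integral_integral_swap (f := fun y x : F => Real.negMulLog (q (y - x))) h2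
  have hx : ∀ x : F, ∫ y, Real.negMulLog (q (y - x)) = ∫ y, Real.negMulLog (q y) := fun x =>
    integral_sub_right_eq_self (fun y => Real.negMulLog (q y)) x
  have he : ∫ x, Real.negMulLog (q x) = ∫ y, ∫ x, Real.negMulLog (q (y - x)) ∂ν := by
    rw [hswap]; simp [hx]
  rw [he]
  refine integral_mono_ae h2.integral_prod_left hp ?_
  filter_upwards [h1.prod_right_ae, h2.prod_right_ae] with y hy1 hy2
  exact Real.concaveOn_negMulLog.le_map_integral Real.continuous_negMulLog.continuousOn isClosed_Ici
    (Eventually.of_forall fun x => hq0 _) hy1 hy2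

omit [IsProbabilityMeasure ν] in
omit [FiniteDimensional ℝ F] [MeasurableSpace F] [BorelSpace F] in
lemma negMulLog_gaussKernel {t : ℝ} (ht : 0 < t) (x : F) :
    Real.negMulLog (gaussKernel t x) = (finrank ℝ F / 2 * Real.log (2 * Real.pi * t)) *
      gaussKernel t x + 1 / (2 * t) * (‖x‖ ^ 2 * gaussKernel t x) := by
  rw [Real.negMulLog, log_gaussKernel ht]; ring

omit [IsProbabilityMeasure ν] in
lemma integral_negMulLog_gaussKernel {t : ℝ} (ht : 0 < t) :
    Integrable (fun x : F => Real.negMulLog (gaussKernel t x)) ∧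
    ∫ x : F, Real.negMulLog (gaussKernel t x) =
      finrank ℝ F / 2 * Real.log (2 * Real.pi * t) + finrank ℝ F / 2 := by
  simp only [negMulLog_gaussKernel ht]
  have h1 := (integrable_gaussKernel (F := F) ht).const_mul
    (finrank ℝ F / 2 * Real.log (2 * Real.pi * t))
  have h2 := (integrable_sq_mul_gaussKernel (F := F) ht).const_mul (1 / (2 * t))
  refine ⟨h1.add h2, ?_⟩
  rw [integral_add h1 h2, integral_const_mul, integral_const_mul, integral_gaussKernel ht,
    integral_sq_mul_gaussKernel ht]
  field_simp

/-- The entropy of the heat flow is at least that of the Gaussian kernel, of whose translates it is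
an average. -/
lemma le_heatEntropy (hν : MemLp id 2 ν) {t : ℝ} (ht : 0 < t) :
    finrank ℝ F / 2 * Real.log (2 * Real.pi * t) + finrank ℝ F / 2 ≤ heatEntropy ν t := by
  rw [← (integral_negMulLog_gaussKernel (F := F) ht).2]
  exact integral_negMulLog_le_of_average (fun x => gaussKernel_nonneg ht x)
    (integrable_gaussKernel ht) (integral_negMulLog_gaussKernel ht).1
    (integrable_negMulLog_heat hν ht)

omit [NormedAddCommGroup F] [InnerProductSpace ℝ F] [FiniteDimensional ℝ F] [MeasurableSpace F]
  [BorelSpace F] in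
/-- The pointwise inequality behind Gibbs' inequality. -/
lemma negMulLog_le_of_pos {u g : ℝ} (hu : 0 ≤ u) (hg : 0 < g) :
    Real.negMulLog u ≤ -(u * Real.log g) - u + g := by
  rcases hu.eq_or_lt with rfl | hu
  · simpa using hg.le
  · have h := Real.log_le_sub_one_of_pos (div_pos hg hu)
    rw [Real.log_div hg.ne' hu.ne'] at h
    have h2 := mul_le_mul_of_nonneg_left h hu.le
    have h3 : u * (g / u - 1) = g - u := by field_simp
    rw [Real.negMulLog]
    nlinarith

/-- Gibbs' inequality for the heat flow, relative to the Gaussian kernel of the same time. -/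
lemma heatEntropy_le (hν : MemLp id 2 ν) {t : ℝ} (ht : 0 < t) :
    heatEntropy ν t ≤ finrank ℝ F / 2 * Real.log (2 * Real.pi * t) + finrank ℝ F / 2 +
      (∫ x, ‖x‖ ^ 2 ∂ν) / (2 * t) := by
  have hle : ∀ y : F, Real.negMulLog (heat ν t y) ≤
      (finrank ℝ F / 2 * Real.log (2 * Real.pi * t) - 1) * heat ν t y +
        1 / (2 * t) * (‖y‖ ^ 2 * heat ν t y) + gaussKernel t y := by
    intro y
    have := negMulLog_le_of_pos (heat_pos ν ht y).le (gaussKernel_pos ht y)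
    rw [log_gaussKernel ht] at this
    refine this.trans (le_of_eq ?_)
    ring
  have h1 := (integrable_heat ν ht).const_mul (finrank ℝ F / 2 * Real.log (2 * Real.pi * t) - 1)
  have h2 := (integrable_sq_mul_heat hν ht).const_mul (1 / (2 * t))
  have h12 : Integrable (fun y => (finrank ℝ F / 2 * Real.log (2 * Real.pi * t) - 1) * heat ν t y +
        1 / (2 * t) * (‖y‖ ^ 2 * heat ν t y)) := h1.add h2
  have h3 := integrable_gaussKernel (F := F) ht
  have := integral_mono (integrable_negMulLog_heat hν ht) (h12.add h3) hle
  simp only [Pi.add_apply] at this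
  rw [integral_add h12 h3, integral_add h1 h2, integral_const_mul, integral_const_mul,
    integral_heat ν ht, integral_gaussKernel ht, integral_sq_mul_heat hν ht] at this
  refine this.trans (le_of_eq ?_)
  field_simp
  ring

/-- As the time grows, the entropy of the heat flow approaches that of a Gaussian vector. -/
lemma tendsto_heatEntropy_atTop (hν : MemLp id 2 ν) :
    Tendsto (fun t => heatEntropy ν t - finrank ℝ F / 2 * Real.log (2 * Real.pi * t)) atTop
      (𝓝 (finrank ℝ F / 2)) := by
  have h : Tendsto (fun t : ℝ => (finrank ℝ F / 2 : ℝ) + (∫ x, ‖x‖ ^ 2 ∂ν) / (2 * t)) atTop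
      (𝓝 (finrank ℝ F / 2 + 0)) :=
    tendsto_const_nhds.add (tendsto_const_nhds.div_atTop
      (tendsto_id.const_mul_atTop zero_lt_two))
  rw [add_zero] at h
  refine tendsto_of_tendsto_of_tendsto_of_le_of_le' tendsto_const_nhds h ?_ ?_
  · filter_upwards [eventually_gt_atTop 0] with t ht
    linarith [le_heatEntropy hν ht]
  · filter_upwards [eventually_gt_atTop 0] with t ht
    linarith [heatEntropy_le hν ht]

end

section

variable {F : Type*} [NormedAddCommGroup F] [InnerProductSpace ℝ F] [FiniteDimensional ℝ F]
  [MeasurableSpace F] [BorelSpace F]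

/-! ### Continuity of the entropy of the heat flow at time zero -/

omit [FiniteDimensional ℝ F] [MeasurableSpace F] [BorelSpace F] in
lemma gaussKernel_smul {c t : ℝ} (hc : 0 < c) (ht : 0 < t) (z : F) :
    gaussKernel (c ^ 2 * t) (c • z) = (c ^ finrank ℝ F)⁻¹ * gaussKernel t z := by
  have h1 : (2 * Real.pi * (c ^ 2 * t)) ^ (-(finrank ℝ F / 2 : ℝ)) =
      (c ^ finrank ℝ F)⁻¹ * (2 * Real.pi * t) ^ (-(finrank ℝ F / 2 : ℝ)) := by
    rw [show 2 * Real.pi * (c ^ 2 * t) = c ^ 2 * (2 * Real.pi * t) by ring,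
      Real.mul_rpow (by positivity) (by positivity)]
    congr 1
    rw [← Real.rpow_natCast c 2, ← Real.rpow_mul hc.le, ← Real.rpow_natCast c (finrank ℝ F),
      ← Real.rpow_neg hc.le]
    congr 1; push_cast; ring
  have h2 : -‖c • z‖ ^ 2 / (2 * (c ^ 2 * t)) = -‖z‖ ^ 2 / (2 * t) := by
    rw [norm_smul, Real.norm_of_nonneg hc.le]; field_simp
  rw [gaussKernel, gaussKernel, h1, h2, mul_assoc]

lemma isProbabilityMeasure_withDensity {α : Type*} [MeasurableSpace α] {μ : Measure α} {f : α → ℝ}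
    (hf0 : ∀ x, 0 ≤ f x) (hf : Integrable f μ) (hf1 : ∫ x, f x ∂μ = 1) :
    IsProbabilityMeasure (μ.withDensity (fun x => ENNReal.ofReal (f x))) := by
  refine ⟨?_⟩
  rw [withDensity_apply _ MeasurableSet.univ, setLIntegral_univ,
    ← ofReal_integral_eq_lintegral_ofReal hf (Eventually.of_forall hf0), hf1, ENNReal.ofReal_one]

lemma integral_withDensity_ofReal {α : Type*} [MeasurableSpace α] {μ : Measure α} {f : α → ℝ}
    (hf : Measurable f) (hf0 : ∀ x, 0 ≤ f x) {G : Type*} [NormedAddCommGroup G] [NormedSpace ℝ G]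
    (g : α → G) :
    ∫ x, g x ∂(μ.withDensity (fun x => ENNReal.ofReal (f x))) = ∫ x, f x • g x ∂μ := by
  rw [integral_withDensity_eq_integral_toReal_smul hf.ennreal_ofReal (by simp)]
  simp only [ENNReal.toReal_ofReal (hf0 _)]

variable {f : F → ℝ}

lemma heat_withDensity (hf : Measurable f) (hf0 : ∀ x, 0 ≤ f x) (t : ℝ) (y : F) :
    heat (volume.withDensity (fun x => ENNReal.ofReal (f x))) t y =
      ∫ x, gaussKernel t x * f (y - x) := by
  rw [heat, integral_withDensity_ofReal hf hf0,
    ← integral_sub_left_eq_self (fun x => f x • gaussKernel t (y - x)) volume y]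
  simp only [sub_sub_cancel, smul_eq_mul, mul_comm]

/-- The heat flow as an average with respect to a fixed Gaussian measure, the time only entering the
translations of the initial density. -/
lemma heat_withDensity_eq_scaled (hf : Measurable f) (hf0 : ∀ x, 0 ≤ f x) {t : ℝ} (ht : 0 < t)
    (y : F) :
    heat (volume.withDensity (fun x => ENNReal.ofReal (f x))) t y =
      ∫ z, gaussKernel 1 z * f (y - Real.sqrt t • z) := by
  have hs : 0 < Real.sqrt t := Real.sqrt_pos.2 ht
  have h := Measure.integral_comp_smul volume (fun x : F => gaussKernel t x * f (y - x)) (Real.sqrt t)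
  have e : ∀ z : F, gaussKernel t (Real.sqrt t • z) =
      (Real.sqrt t ^ finrank ℝ F)⁻¹ * gaussKernel 1 z := by
    intro z
    have := gaussKernel_smul hs one_pos z
    rwa [mul_one, Real.sq_sqrt ht.le] at this
  rw [heat_withDensity hf hf0]
  simp only [e, mul_assoc] at h
  rw [integral_const_mul, abs_of_pos (by positivity), smul_eq_mul] at h
  exact (mul_left_cancel₀ (by positivity) h).symm

/-- The heat flow averages the translates of its initial density with Gaussian weights, hence
increases the entropy. -/
lemma integral_negMulLog_le_heatEntropy (hf : Measurable f) (hf0 : ∀ x, 0 ≤ f x)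
    (hfi : Integrable f) (hf1 : ∫ x, f x = 1) (hfl : Integrable (fun x => Real.negMulLog (f x)))
    (hν : MemLp id 2 (volume.withDensity (fun x => ENNReal.ofReal (f x)))) {t : ℝ} (ht : 0 < t) :
    ∫ x, Real.negMulLog (f x) ≤
      heatEntropy (volume.withDensity (fun x => ENNReal.ofReal (f x))) t := by
  have := isProbabilityMeasure_withDensity hf0 hfi hf1
  have := isProbabilityMeasure_withDensity (gaussKernel_nonneg (F := F) ht)
    (integrable_gaussKernel ht) (integral_gaussKernel ht)
  have e : ∀ y, ∫ x, f (y - x) ∂(volume.withDensity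
      (fun x : F => ENNReal.ofReal (gaussKernel t x))) =
      heat (volume.withDensity (fun x => ENNReal.ofReal (f x))) t y := by
    intro y
    rw [integral_withDensity_ofReal (continuous_gaussKernel t).measurable
      (gaussKernel_nonneg ht), heat_withDensity hf hf0]
    simp only [smul_eq_mul]
  have key := integral_negMulLog_le_of_average (ν := volume.withDensity
      (fun x : F => ENNReal.ofReal (gaussKernel t x))) hf0 hfi hfl
  simp only [e] at key
  exact key (integrable_negMulLog_heat hν ht)

/-- Continuity of translations in `L¹`. -/
lemma tendsto_integral_translate (hfi : Integrable f) :
    Tendsto (fun v : F => ∫ y, |f (y - v) - f y|) (𝓝 0) (𝓝 0) := by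
  have hm : MemLp f 1 volume := memLp_one_iff_integrable.2 hfi
  let g : F → Lp ℝ 1 (volume : Measure F) := fun v => DomAddAct.mk (-v) +ᵥ hm.toLp f
  have hg : Continuous g := by
    have h : Continuous (fun v : F => DomAddAct.mk (-v)) :=
      DomAddAct.mkHomeomorph.continuous.comp continuous_neg
    have : Fact ((1 : ENNReal) ≠ ⊤) := ⟨ENNReal.one_ne_top⟩
    exact h.vadd continuous_const
  have hd : Continuous (fun v => dist (g v) (g 0)) := hg.dist continuous_const
  have h0 := hd.tendsto 0
  rw [dist_self] at h0
  refine h0.congr fun v => ?_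
  have e1 : g v = Integrable.toL1 (fun y => f (y - v)) (hfi.comp_sub_right v) := by
    simp only [g, DomAddAct.mk_vadd_toLp, Integrable.toL1]
    congr 1; ext y; simp [sub_eq_neg_add]
  have e2 : g 0 = Integrable.toL1 f hfi := by
    simp only [g, DomAddAct.mk_vadd_toLp, Integrable.toL1]
    congr 1; ext y; simp
  rw [e1, e2, dist_eq_norm, ← Integrable.toL1_sub, L1.norm_of_fun_eq_integral_norm]
  rfl

/-- The heat flow started at an integrable density converges to it in `L¹`. -/
lemma tendsto_integral_abs_heat_sub (hf : Measurable f) (hf0 : ∀ x, 0 ≤ f x) (hfi : Integrable f)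
    (hf1 : ∫ x, f x = 1) :
    Tendsto (fun t => ∫ y, |heat (volume.withDensity (fun x => ENNReal.ofReal (f x))) t y - f y|)
      (𝓝[>] 0) (𝓝 0) := by
  have := isProbabilityMeasure_withDensity hf0 hfi hf1
  set ν := volume.withDensity (fun x => ENNReal.ofReal (f x))
  -- the distance in `L¹` between `f` and its translate by `v`
  set Φ : F → ℝ := fun v => ∫ y, |f (y - v) - f y|
  have hΦ0 : ∀ v, 0 ≤ Φ v := fun v => integral_nonneg fun y => abs_nonneg _
  have hΦ2 : ∀ v, Φ v ≤ 2 := by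
    intro v
    have h1 := hfi.comp_sub_right v
    have : Φ v ≤ ∫ y, (f (y - v) + f y) := by
      refine integral_mono (h1.sub hfi).abs (h1.add hfi) fun y => ?_
      have := abs_sub (f (y - v)) (f y)
      simpa [abs_of_nonneg (hf0 _)] using this
    rw [integral_add h1 hfi, integral_sub_right_eq_self f v, hf1] at this
    linarith
  have hmeas : Measurable (fun p : F × F => |f (p.1 - p.2) - f p.1|) := by fun_prop
  have hΦm : StronglyMeasurable Φ :=
    (hmeas.comp (measurable_swap (α := F) (β := F))).stronglyMeasurable.integral_prod_right'
  -- the bound of the `L¹` distance by a Gaussian average of the moduli of continuity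
  have hbound : ∀ t, 0 < t → ∫ y, |heat ν t y - f y| ≤
      ∫ z : F, gaussKernel 1 z * Φ (Real.sqrt t • z) := by
    intro t ht
    have hK0 := gaussKernel_nonneg (F := F) one_pos
    have hmeas2 : Measurable (fun p : F × F =>
        gaussKernel 1 p.2 * |f (p.1 - Real.sqrt t • p.2) - f p.1|) :=
      ((continuous_gaussKernel (F := F) 1).measurable.comp measurable_snd).mul (by fun_prop)
    have hprod : Integrable (fun p : F × F =>
        gaussKernel 1 p.2 * |f (p.1 - Real.sqrt t • p.2) - f p.1|) (volume.prod volume) := by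
      rw [integrable_prod_iff' hmeas2.aestronglyMeasurable]
      refine ⟨Eventually.of_forall fun z =>
        ((hfi.comp_sub_right (Real.sqrt t • z)).sub hfi).abs.const_mul (gaussKernel 1 z), ?_⟩
      refine ((integrable_gaussKernel (F := F) one_pos).const_mul 2).mono'
        hmeas2.aestronglyMeasurable.norm.prod_swap.integral_prod_right'
        (Eventually.of_forall fun z => ?_)
      have : ∀ y, ‖gaussKernel 1 z * |f (y - Real.sqrt t • z) - f y|‖ =
          gaussKernel 1 z * |f (y - Real.sqrt t • z) - f y| := fun y =>
        Real.norm_of_nonneg (mul_nonneg (hK0 z) (abs_nonneg _))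
      simp only [this]
      rw [integral_const_mul, Real.norm_of_nonneg (mul_nonneg (hK0 z) (hΦ0 _)), mul_comm]
      exact mul_le_mul_of_nonneg_right (hΦ2 _) (hK0 z)
    have hswap := integral_integral_swap
      (f := fun y z : F => gaussKernel 1 z * |f (y - Real.sqrt t • z) - f y|) hprod
    have hz : ∀ z, ∫ y, gaussKernel 1 z * |f (y - Real.sqrt t • z) - f y| =
        gaussKernel 1 z * Φ (Real.sqrt t • z) := fun z => integral_const_mul _ _
    simp only [hz] at hswap
    rw [← hswap]
    refine integral_mono_ae ((integrable_heat ν ht).sub hfi).abs hprod.integral_prod_left ?_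
    have hprod2 : Integrable (fun p : F × F =>
        gaussKernel 1 p.2 * f (p.1 - Real.sqrt t • p.2)) (volume.prod volume) := by
      have hm3 : Measurable (fun p : F × F => gaussKernel 1 p.2 * f (p.1 - Real.sqrt t • p.2)) :=
        ((continuous_gaussKernel (F := F) 1).measurable.comp measurable_snd).mul (by fun_prop)
      have hfst : Integrable (fun p : F × F => f p.1 * gaussKernel 1 p.2)
          (volume.prod volume) := hfi.mul_prod (integrable_gaussKernel one_pos)
      refine (hprod.add hfst).mono' hm3.aestronglyMeasurable (Eventually.of_forall fun p => ?_)
      rw [Real.norm_of_nonneg (mul_nonneg (hK0 _) (hf0 _))]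
      have := le_abs_self (f (p.1 - Real.sqrt t • p.2) - f p.1)
      have h2 := mul_le_mul_of_nonneg_left this (hK0 p.2)
      simp only [Pi.add_apply]
      linarith
    filter_upwards [hprod.prod_right_ae, hprod2.prod_right_ae] with y hy hy2
    have h1 : heat ν t y - f y = ∫ z, gaussKernel 1 z * (f (y - Real.sqrt t • z) - f y) := by
      simp only [mul_sub]
      rw [integral_sub hy2 ((integrable_gaussKernel one_pos).mul_const _), integral_mul_const,
        integral_gaussKernel one_pos, one_mul, heat_withDensity_eq_scaled hf hf0 ht]
    change |heat ν t y - f y| ≤ _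
    rw [h1]
    refine (abs_integral_le_integral_abs).trans (le_of_eq ?_)
    congr 1; ext z
    rw [abs_mul, abs_of_nonneg (hK0 z)]
  have hlim : Tendsto (fun t => ∫ z : F, gaussKernel 1 z * Φ (Real.sqrt t • z)) (𝓝[>] 0)
      (𝓝 (∫ z : F, gaussKernel 1 z * 0)) := by
    refine tendsto_integral_filter_of_dominated_convergence (fun z => gaussKernel 1 z * 2)
      (Eventually.of_forall fun t => ?_) (Eventually.of_forall fun t => Eventually.of_forall
        fun z => ?_) ((integrable_gaussKernel one_pos).mul_const _) (Eventually.of_forall fun z => ?_)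
    · exact ((continuous_gaussKernel (F := F) 1).measurable.mul
        (hΦm.measurable.comp (measurable_const_smul _))).aestronglyMeasurable
    · rw [Real.norm_of_nonneg (mul_nonneg (gaussKernel_nonneg one_pos z) (hΦ0 _))]
      exact mul_le_mul_of_nonneg_left (hΦ2 _) (gaussKernel_nonneg one_pos z)
    · refine Tendsto.const_mul _ ?_
      have hc : Tendsto (fun t : ℝ => Real.sqrt t • z) (𝓝[>] 0) (𝓝 0) := by
        have : Continuous (fun t : ℝ => Real.sqrt t • z) := by fun_prop
        have h := this.tendsto 0
        simp only [Real.sqrt_zero, zero_smul] at h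
        exact h.mono_left nhdsWithin_le_nhds
      exact (tendsto_integral_translate hfi).comp hc
  simp only [mul_zero, integral_zero] at hlim
  refine tendsto_of_tendsto_of_tendsto_of_le_of_le' tendsto_const_nhds hlim
    (Eventually.of_forall fun t => integral_nonneg fun y => abs_nonneg _) ?_
  filter_upwards [self_mem_nhdsWithin] with t ht using hbound t ht

/-- Upper semicontinuity of the entropy at time zero: the entropy relative to a Gaussian measure has
a nonnegative integrand, so Fatou's lemma applies. -/
lemma le_integral_negMulLog_of_forall_le (hf : Measurable f) (hf0 : ∀ x, 0 ≤ f x)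
    (hfi : Integrable f) (hf1 : ∫ x, f x = 1) (hfl : Integrable (fun x => Real.negMulLog (f x)))
    (hν : MemLp id 2 (volume.withDensity (fun x => ENNReal.ofReal (f x)))) {c : ℝ}
    (hc : ∀ t > 0, c ≤ heatEntropy (volume.withDensity (fun x => ENNReal.ofReal (f x))) t) :
    c ≤ ∫ x, Real.negMulLog (f x) := by
  have := isProbabilityMeasure_withDensity hf0 hfi hf1
  set ν := volume.withDensity (fun x => ENNReal.ofReal (f x)) with hνdef
  set τ : ℕ → ℝ := fun k => 1 / ((k : ℝ) + 1) with hτ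
  have hτ0 : ∀ k, 0 < τ k := fun k => by rw [hτ]; positivity
  have hτlim : Tendsto τ atTop (𝓝 0) := tendsto_one_div_add_atTop_nhds_zero_nat
  have hτlim' : Tendsto τ atTop (𝓝[>] 0) :=
    tendsto_nhdsWithin_iff.2 ⟨hτlim, Eventually.of_forall hτ0⟩
  have hL1 := (tendsto_integral_abs_heat_sub hf hf0 hfi hf1).comp hτlim'
  -- convergence in `L¹` implies convergence almost everywhere along a subsequence
  have hmeasure : TendstoInMeasure volume (fun k => heat ν (τ k)) atTop f := by
    refine tendstoInMeasure_of_tendsto_eLpNorm (p := 1) one_ne_zero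
      (fun k => (measurable_heat ν (hτ0 k)).aestronglyMeasurable) hf.aestronglyMeasurable ?_
    have : ∀ k, eLpNorm (heat ν (τ k) - f) 1 volume =
        ENNReal.ofReal (∫ y, |heat ν (τ k) y - f y|) := by
      intro k
      rw [eLpNorm_one_eq_lintegral_enorm,
        ← ofReal_integral_norm_eq_lintegral_enorm ((integrable_heat ν (hτ0 k)).sub hfi)]
      rfl
    simp only [this]
    simpa using ENNReal.tendsto_ofReal hL1
  obtain ⟨ns, hns, hae⟩ := hmeasure.exists_seq_tendsto_ae
  set M := ∫ x, ‖x‖ ^ 2 ∂ν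
  set N : ℝ := (finrank ℝ F : ℝ)
  -- the nonnegative integrand of the entropy relative to the Gaussian kernel of time `1`
  set H : F → ℝ → ℝ := fun y u =>
    -(u * Real.log (gaussKernel 1 y)) - u + gaussKernel 1 y - Real.negMulLog u with hH
  have hH0 : ∀ y u, 0 ≤ u → 0 ≤ H y u := fun y u hu => by
    have := negMulLog_le_of_pos hu (gaussKernel_pos one_pos y)
    simp only [hH]; linarith
  have hHe : ∀ y u, H y u = (N / 2 * Real.log (2 * Real.pi * 1) - 1) * u +
      1 / 2 * (‖y‖ ^ 2 * u) + gaussKernel 1 y - Real.negMulLog u := by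
    intro y u
    simp only [hH, log_gaussKernel one_pos]; ring
  have hHint : ∀ (q : F → ℝ) (m : ℝ), Integrable q → ∫ x, q x = 1 →
      Integrable (fun x => ‖x‖ ^ 2 * q x) → ∫ x, ‖x‖ ^ 2 * q x = m →
      Integrable (fun x => Real.negMulLog (q x)) →
      Integrable (fun y => H y (q y)) ∧ ∫ y, H y (q y) =
        N / 2 * Real.log (2 * Real.pi * 1) + 1 / 2 * m - ∫ x, Real.negMulLog (q x) := by
    intro q m hq hq1 hq2 hm hql
    simp only [hHe]
    have h1 := hq.const_mul (N / 2 * Real.log (2 * Real.pi * 1) - 1)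
    have h2 := hq2.const_mul (1 / 2)
    have h12 : Integrable (fun y => (N / 2 * Real.log (2 * Real.pi * 1) - 1) * q y +
      1 / 2 * (‖y‖ ^ 2 * q y)) := h1.add h2
    have h123 : Integrable (fun y => (N / 2 * Real.log (2 * Real.pi * 1) - 1) * q y +
      1 / 2 * (‖y‖ ^ 2 * q y) + gaussKernel 1 y) := h12.add (integrable_gaussKernel one_pos)
    refine ⟨h123.sub hql, ?_⟩
    rw [integral_sub h123 hql, integral_add h12 (integrable_gaussKernel one_pos),
      integral_add h1 h2, integral_const_mul, integral_const_mul, hq1, hm,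
      integral_gaussKernel one_pos]
    ring
  have hf2 : Integrable (fun x => ‖x‖ ^ 2 * f x) ∧ ∫ x, ‖x‖ ^ 2 * f x = M := by
    have h := integrable_sq_of_memLp hν
    rw [hνdef, integrable_withDensity_iff hf.ennreal_ofReal (by simp)] at h
    simp only [ENNReal.toReal_ofReal (hf0 _)] at h
    refine ⟨h, ?_⟩
    simp only [M, hνdef]
    rw [integral_withDensity_ofReal hf hf0]
    simp only [smul_eq_mul, mul_comm]
  obtain ⟨hfH, hfHe⟩ := hHint f M hfi hf1 hf2.1 hf2.2 hfl
  have hpH := fun k => hHint (heat ν (τ k)) _ (integrable_heat ν (hτ0 k)) (integral_heat ν (hτ0 k))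
    (integrable_sq_mul_heat hν (hτ0 k)) (integral_sq_mul_heat hν (hτ0 k))
    (integrable_negMulLog_heat hν (hτ0 k))
  have hHmeas : ∀ q : F → ℝ, Measurable q → Measurable (fun y => ENNReal.ofReal (H y (q y))) := by
    intro q hq
    have h1 := (continuous_gaussKernel (F := F) 1).measurable
    have h2 : Measurable (fun y : F => Real.log (gaussKernel 1 y)) := Real.measurable_log.comp h1
    have h3 := Real.continuous_negMulLog.measurable.comp hq
    exact ((((hq.mul h2).neg.sub hq).add h1).sub h3).ennreal_ofReal
  have hfatou := lintegral_liminf_le (u := atTop) (μ := (volume : Measure F))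
    (f := fun k y => ENNReal.ofReal (H y (heat ν (τ (ns k)) y)))
    (fun k => hHmeas _ (measurable_heat ν (hτ0 _)))
  have hleft : ∫⁻ y, ENNReal.ofReal (H y (f y)) =
      ∫⁻ y, liminf (fun k => ENNReal.ofReal (H y (heat ν (τ (ns k)) y))) atTop := by
    refine lintegral_congr_ae ?_
    filter_upwards [hae] with y hy
    have hcont : Continuous (H y) := by
      have := Real.continuous_negMulLog
      simp only [hH]; fun_prop
    exact (ENNReal.tendsto_ofReal ((hcont.tendsto (f y)).comp hy)).liminf_eq.symm
  rw [← hleft, ← ofReal_integral_eq_lintegral_ofReal hfH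
    (Eventually.of_forall fun y => hH0 y _ (hf0 y))] at hfatou
  have hright : ∀ k, ∫⁻ y, ENNReal.ofReal (H y (heat ν (τ (ns k)) y)) ≤
      ENNReal.ofReal (N / 2 * Real.log (2 * Real.pi * 1) + 1 / 2 * (M + N * τ (ns k)) - c) := by
    intro k
    rw [← ofReal_integral_eq_lintegral_ofReal (hpH (ns k)).1
      (Eventually.of_forall fun y => hH0 y _ (heat_pos ν (hτ0 _) y).le), (hpH (ns k)).2]
    refine ENNReal.ofReal_le_ofReal ?_
    have := hc _ (hτ0 (ns k))
    unfold heatEntropy at this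
    linarith
  have hlim : Tendsto (fun k => ENNReal.ofReal
      (N / 2 * Real.log (2 * Real.pi * 1) + 1 / 2 * (M + N * τ (ns k)) - c)) atTop
      (𝓝 (ENNReal.ofReal (N / 2 * Real.log (2 * Real.pi * 1) + 1 / 2 * (M + N * 0) - c))) := by
    refine ENNReal.tendsto_ofReal ?_
    have := hτlim.comp hns.tendsto_atTop
    exact (tendsto_const_nhds.add ((tendsto_const_nhds.add
      (this.const_mul N)).const_mul (1 / 2))).sub tendsto_const_nhds
  have hfin := hfatou.trans ((liminf_le_liminf (Eventually.of_forall hright)).trans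
    hlim.liminf_eq.le)
  have hnn : 0 ≤ N / 2 * Real.log (2 * Real.pi * 1) + 1 / 2 * (M + N * 0) - c := by
    refine ge_of_tendsto' (((tendsto_const_nhds.add ((tendsto_const_nhds.add
      ((hτlim.comp hns.tendsto_atTop).const_mul N)).const_mul (1 / 2))).sub tendsto_const_nhds))
      fun k => ?_
    have h1 : 0 ≤ ∫ y, H y (heat ν (τ (ns k)) y) :=
      integral_nonneg fun y => hH0 y _ (heat_pos ν (hτ0 _) y).le
    rw [(hpH (ns k)).2] at h1
    have := hc _ (hτ0 (ns k))
    unfold heatEntropy at this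
    simp only [Function.comp_apply]
    linarith
  rw [ENNReal.ofReal_le_ofReal_iff hnn, hfHe] at hfin
  linarith

/-- The entropy of the heat flow is continuous at time zero. -/
theorem tendsto_heatEntropy_zero (hf : Measurable f) (hf0 : ∀ x, 0 ≤ f x)
    (hfi : Integrable f) (hf1 : ∫ x, f x = 1) (hfl : Integrable (fun x => Real.negMulLog (f x)))
    (hν : MemLp id 2 (volume.withDensity (fun x => ENNReal.ofReal (f x)))) :
    Tendsto (heatEntropy (volume.withDensity (fun x => ENNReal.ofReal (f x)))) (𝓝[>] 0)
      (𝓝 (∫ x, Real.negMulLog (f x))) := by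
  have := isProbabilityMeasure_withDensity hf0 hfi hf1
  set ν := volume.withDensity (fun x => ENNReal.ofReal (f x))
  -- by de Bruijn's identity the entropy is nondecreasing in time, so it suffices to compare its
  -- infimum with the entropy at time zero
  have hmono : MonotoneOn (heatEntropy ν) (Ioi 0) := by
    refine monotoneOn_of_deriv_nonneg (convex_Ioi 0)
      (fun t ht => (hasDerivAt_heatEntropy hν ht).continuousAt.continuousWithinAt) ?_ ?_
    · rw [interior_Ioi]
      exact fun t ht => (hasDerivAt_heatEntropy hν ht).differentiableAt.differentiableWithinAt
    · rw [interior_Ioi]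
      intro t ht
      rw [(hasDerivAt_heatEntropy hν ht).deriv]
      have : 0 ≤ heatFisher ν t := integral_nonneg fun y => by
        have := heat_pos ν ht y; positivity
      linarith
  have hge : ∀ t > 0, ∫ x, Real.negMulLog (f x) ≤ heatEntropy ν t := fun t ht =>
    integral_negMulLog_le_heatEntropy hf hf0 hfi hf1 hfl hν ht
  rw [tendsto_order]
  constructor
  · intro a ha
    filter_upwards [self_mem_nhdsWithin] with t ht using ha.trans_le (hge t ht)
  · intro a ha
    obtain ⟨t0, ht0, hlt⟩ : ∃ t0 > 0, heatEntropy ν t0 < a := by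
      by_contra! h
      exact absurd (le_integral_negMulLog_of_forall_le hf hf0 hfi hf1 hfl hν h) (not_le.2 ha)
    filter_upwards [Ioo_mem_nhdsGT ht0] with t ht
    exact (hmono ht.1 ht0 ht.2.le).trans_lt hlt

end

section

variable {F : Type*} [NormedAddCommGroup F] [InnerProductSpace ℝ F] [FiniteDimensional ℝ F]
  [MeasurableSpace F] [BorelSpace F]

/-! ### The score of a Gaussian perturbation -/

lemma lintegral_stdGaussian_smul {t : ℝ} (ht : 0 < t) {h : F → ENNReal} (hh : Measurable h) :
    ∫⁻ g, h (Real.sqrt t • g) ∂(stdGaussian F) =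
      ∫⁻ z, ENNReal.ofReal (gaussKernel t z) * h z := by
  have hs : 0 < Real.sqrt t := Real.sqrt_pos.2 ht
  have hK : ∀ r : ℝ, Measurable (fun x : F => ENNReal.ofReal (gaussKernel r x)) := fun r =>
    (continuous_gaussKernel r).measurable.ennreal_ofReal
  set c : ℝ := Real.sqrt t ^ finrank ℝ F with hc
  have hc0 : 0 < c := by positivity
  have e : ∀ z : F, ENNReal.ofReal (gaussKernel 1 z) =
      ENNReal.ofReal c * ENNReal.ofReal (gaussKernel t (Real.sqrt t • z)) := by
    intro z
    have := gaussKernel_smul hs one_pos z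
    rw [mul_one, Real.sq_sqrt ht.le] at this
    rw [this, ← ENNReal.ofReal_mul hc0.le, ← mul_assoc, mul_inv_cancel₀ hc0.ne', one_mul]
  have hhs : Measurable (fun g : F => h (Real.sqrt t • g)) := hh.comp (measurable_const_smul _)
  rw [stdGaussian_eq_withDensity, lintegral_withDensity_eq_lintegral_mul _ (hK 1) hhs]
  have h1 : ∀ z : F, ((fun x : F => ENNReal.ofReal (gaussKernel 1 x)) *
      (fun g => h (Real.sqrt t • g))) z = (fun y => ENNReal.ofReal c *
        (ENNReal.ofReal (gaussKernel t y) * h y)) (Real.sqrt t • z) := by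
    intro z; simp only [Pi.mul_apply, e, mul_assoc]
  have hmeas : Measurable (fun y => ENNReal.ofReal c * (ENNReal.ofReal (gaussKernel t y) * h y)) :=
    ((hK t).mul hh).const_mul _
  have h2 := lintegral_map (μ := (volume : Measure F)) hmeas (measurable_const_smul (Real.sqrt t))
  rw [Measure.map_addHaar_smul volume hs.ne', lintegral_smul_measure,
    lintegral_const_mul' _ _ ENNReal.ofReal_ne_top] at h2
  rw [lintegral_congr h1, ← h2, smul_eq_mul, ← mul_assoc, ← ENNReal.ofReal_mul (abs_nonneg _),
    abs_of_pos (by positivity), inv_mul_cancel₀ hc0.ne', ENNReal.ofReal_one, one_mul]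

variable {Ω : Type*} [MeasurableSpace Ω] {P : Measure Ω} [IsProbabilityMeasure P] {U G : Ω → F}

/-- The joint law of a random vector and of its Gaussian perturbation. -/
lemma map_prod_gaussian_perturbation (hU : Measurable U) (hG : Measurable G)
    (hGlaw : P.map G = stdGaussian F) (hUG : IndepFun U G P) {t : ℝ} (ht : 0 < t) :
    P.map (fun ω => (U ω + Real.sqrt t • G ω, U ω)) =
      (volume.prod (P.map U)).withDensity
        (fun p => ENNReal.ofReal (gaussKernel t (p.1 - p.2))) := by
  have : IsProbabilityMeasure (P.map U) := Measure.isProbabilityMeasure_map hU.aemeasurable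
  have hjoint := (indepFun_iff_map_prod_eq_prod_map_map hU.aemeasurable hG.aemeasurable).1 hUG
  rw [hGlaw] at hjoint
  have hK : Measurable (fun p : F × F => ENNReal.ofReal (gaussKernel t (p.1 - p.2))) :=
    ((continuous_gaussKernel t).measurable.comp (measurable_fst.sub measurable_snd)).ennreal_ofReal
  refine Measure.ext_of_lintegral _ fun h hh => ?_
  have hm : Measurable (fun q : F × F => (q.1 + Real.sqrt t • q.2, q.1)) := by fun_prop
  have hhm : Measurable (fun q : F × F => h (q.1 + Real.sqrt t • q.2, q.1)) := hh.comp hm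
  have hcomp : (fun ω => (U ω + Real.sqrt t • G ω, U ω)) =
      (fun q : F × F => (q.1 + Real.sqrt t • q.2, q.1)) ∘ (fun ω => (U ω, G ω)) := rfl
  rw [hcomp, ← Measure.map_map hm (hU.prodMk hG), hjoint, lintegral_map hh hm,
    lintegral_prod _ hhm.aemeasurable,
    lintegral_withDensity_eq_lintegral_mul _ hK hh,
    lintegral_prod_symm _ (hK.mul hh).aemeasurable]
  refine lintegral_congr fun u => ?_
  have := lintegral_stdGaussian_smul (F := F) ht (h := fun z => h (u + z, u))
    (hh.comp (by fun_prop))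
  simp only [Pi.mul_apply]
  rw [this, ← lintegral_sub_right_eq_self _ u]
  simp

lemma map_gaussian_perturbation (hU : Measurable U) (hG : Measurable G)
    (hGlaw : P.map G = stdGaussian F) (hUG : IndepFun U G P) {t : ℝ} (ht : 0 < t) :
    P.map (fun ω => U ω + Real.sqrt t • G ω) =
      volume.withDensity (fun y => ENNReal.ofReal (heat (P.map U) t y)) := by
  have : IsProbabilityMeasure (P.map U) := Measure.isProbabilityMeasure_map hU.aemeasurable
  have hK : Measurable (fun p : F × F => ENNReal.ofReal (gaussKernel t (p.1 - p.2))) :=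
    ((continuous_gaussKernel t).measurable.comp (measurable_fst.sub measurable_snd)).ennreal_ofReal
  refine Measure.ext_of_lintegral _ fun h hh => ?_
  have key : ∀ y, ∫⁻ x, ENNReal.ofReal (gaussKernel t (y - x)) * h y ∂(P.map U) =
      ENNReal.ofReal (heat (P.map U) t y) * h y := by
    intro y
    have hKy : Measurable (fun x : F => ENNReal.ofReal (gaussKernel t (y - x))) :=
      ((continuous_gaussKernel t).measurable.comp
        (measurable_const.sub measurable_id)).ennreal_ofReal
    have hi : Integrable (fun x => gaussKernel t (y - x)) (P.map U) :=
      integrable_gaussKernel_sub _ ht y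
    have hn : ∀ x : F, 0 ≤ gaussKernel t (y - x) := fun x => gaussKernel_nonneg ht _
    rw [lintegral_mul_const _ hKy, heat,
      ofReal_integral_eq_lintegral_ofReal hi (Eventually.of_forall hn)]
  have hm : Measurable (fun ω => (U ω + Real.sqrt t • G ω, U ω)) :=
    (hU.add (hG.const_smul _)).prodMk hU
  have hh1 : Measurable (fun p : F × F => h p.1) := hh.comp measurable_fst
  have hcomp : (fun ω => U ω + Real.sqrt t • G ω) =
      Prod.fst ∘ (fun ω => (U ω + Real.sqrt t • G ω, U ω)) := rfl
  rw [hcomp, ← Measure.map_map measurable_fst hm,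
    map_prod_gaussian_perturbation hU hG hGlaw hUG ht, lintegral_map hh measurable_fst,
    lintegral_withDensity_eq_lintegral_mul _ hK hh1,
    lintegral_prod _ (hK.mul hh1).aemeasurable,
    lintegral_withDensity_eq_lintegral_mul _ (measurable_heat _ ht).ennreal_ofReal hh]
  simp only [Pi.mul_apply, key]

/-- The score `-∇p / p` of the heat flow at time `t`, with `p = heat ν t`. -/
def heatScore (ν : Measure F) (t : ℝ) (y : F) : F := -((heat ν t y)⁻¹ • heatGrad ν t y)

lemma continuous_heatScore (ν : Measure F) [IsProbabilityMeasure ν] {t : ℝ} (ht : 0 < t) :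
    Continuous (heatScore ν t) :=
  (((continuous_heat ν ht).inv₀ fun y => (heat_pos ν ht y).ne').smul
    (continuous_heatGrad ν ht)).neg

lemma integral_comp_gaussian_perturbation (hU : Measurable U) (hG : Measurable G)
    (hGlaw : P.map G = stdGaussian F) (hUG : IndepFun U G P) {t : ℝ} (ht : 0 < t)
    {H : Type*} [NormedAddCommGroup H] [NormedSpace ℝ H] {g : F → H} (hg : StronglyMeasurable g) :
    ∫ ω, g (U ω + Real.sqrt t • G ω) ∂P = ∫ y, heat (P.map U) t y • g y := by
  have : IsProbabilityMeasure (P.map U) := Measure.isProbabilityMeasure_map hU.aemeasurable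
  have hW : Measurable (fun ω => U ω + Real.sqrt t • G ω) := hU.add (hG.const_smul _)
  rw [← integral_withDensity_ofReal (measurable_heat _ ht) (fun y => (heat_pos _ ht y).le),
    ← map_gaussian_perturbation hU hG hGlaw hUG ht,
    integral_map hW.aemeasurable hg.aestronglyMeasurable]

lemma integrable_comp_gaussian_perturbation (hU : Measurable U) (hG : Measurable G)
    (hGlaw : P.map G = stdGaussian F) (hUG : IndepFun U G P) {t : ℝ} (ht : 0 < t)
    {H : Type*} [NormedAddCommGroup H] [NormedSpace ℝ H] {g : F → H} (hg : StronglyMeasurable g) :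
    Integrable (fun ω => g (U ω + Real.sqrt t • G ω)) P ↔
      Integrable (fun y => heat (P.map U) t y • g y) := by
  have : IsProbabilityMeasure (P.map U) := Measure.isProbabilityMeasure_map hU.aemeasurable
  have hW : Measurable (fun ω => U ω + Real.sqrt t • G ω) := hU.add (hG.const_smul _)
  have h := integrable_withDensity_iff_integrable_smul' (μ := volume) (g := g)
    (measurable_heat (P.map U) ht).ennreal_ofReal (by simp)
  simp only [ENNReal.toReal_ofReal (heat_pos _ ht _).le] at h
  rw [← h, ← map_gaussian_perturbation hU hG hGlaw hUG ht,
    integrable_map_measure hg.aestronglyMeasurable hW.aemeasurable]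
  rfl

lemma heat_smul_norm_heatScore_sq (ν : Measure F) [IsProbabilityMeasure ν] {t : ℝ} (ht : 0 < t)
    (y : F) : heat ν t y • ‖heatScore ν t y‖ ^ 2 = ‖heatGrad ν t y‖ ^ 2 / heat ν t y := by
  have := heat_pos ν ht y
  rw [heatScore, norm_neg, norm_smul, norm_inv, Real.norm_of_nonneg this.le, smul_eq_mul]
  field_simp

lemma memLp_heatScore (hU : Measurable U) (hG : Measurable G)
    (hGlaw : P.map G = stdGaussian F) (hUG : IndepFun U G P) {t : ℝ} (ht : 0 < t) :
    MemLp (fun ω => heatScore (P.map U) t (U ω + Real.sqrt t • G ω)) 2 P := by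
  have : IsProbabilityMeasure (P.map U) := Measure.isProbabilityMeasure_map hU.aemeasurable
  have hm : Measurable (fun ω => heatScore (P.map U) t (U ω + Real.sqrt t • G ω)) :=
    (continuous_heatScore _ ht).measurable.comp (hU.add (hG.const_smul _))
  rw [memLp_two_iff_integrable_sq_norm hm.aestronglyMeasurable,
    integrable_comp_gaussian_perturbation hU hG hGlaw hUG ht
      (g := fun y => ‖heatScore (P.map U) t y‖ ^ 2)
      ((continuous_heatScore _ ht).norm.pow 2).stronglyMeasurable]
  simp only [heat_smul_norm_heatScore_sq _ ht]
  exact integrable_heatGrad_sq_div_heat _ ht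

lemma integral_norm_heatScore_sq (hU : Measurable U) (hG : Measurable G)
    (hGlaw : P.map G = stdGaussian F) (hUG : IndepFun U G P) {t : ℝ} (ht : 0 < t) :
    ∫ ω, ‖heatScore (P.map U) t (U ω + Real.sqrt t • G ω)‖ ^ 2 ∂P = heatFisher (P.map U) t := by
  have : IsProbabilityMeasure (P.map U) := Measure.isProbabilityMeasure_map hU.aemeasurable
  rw [integral_comp_gaussian_perturbation hU hG hGlaw hUG ht
      (g := fun y => ‖heatScore (P.map U) t y‖ ^ 2)
      ((continuous_heatScore _ ht).norm.pow 2).stronglyMeasurable]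
  simp only [heat_smul_norm_heatScore_sq _ ht, heatFisher]

omit [IsProbabilityMeasure P] in
lemma memLp_of_map_stdGaussian (hG : Measurable G) (hGlaw : P.map G = stdGaussian F) :
    MemLp G 2 P := by
  have h : MemLp id 2 (P.map G) := by rw [hGlaw]; exact IsGaussian.memLp_two_id
  exact h.comp_of_map hG.aemeasurable

omit [FiniteDimensional ℝ F] [MeasurableSpace F] [BorelSpace F] [IsProbabilityMeasure P] in
lemma integrable_inner_of_memLp {f g : Ω → F} (hf : MemLp f 2 P) (hg : MemLp g 2 P) :
    Integrable (fun ω => ⟪f ω, g ω⟫) P := by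
  refine (hf.norm.integrable_mul hg.norm).mono' (hf.1.inner hg.1)
    (Eventually.of_forall fun ω => ?_)
  exact norm_inner_le_norm _ _

/-- The score of `W = U + √t G` is the conditional expectation of `G / √t` given `W`. -/
theorem integral_inner_heatScore (hU : Measurable U) (hG : Measurable G)
    (hGlaw : P.map G = stdGaussian F) (hUG : IndepFun U G P) {t : ℝ} (ht : 0 < t)
    {ψ : F → F} (hψ : Measurable ψ)
    (hψ2 : MemLp (fun ω => ψ (U ω + Real.sqrt t • G ω)) 2 P) :
    Real.sqrt t * ∫ ω, ⟪ψ (U ω + Real.sqrt t • G ω),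
        heatScore (P.map U) t (U ω + Real.sqrt t • G ω)⟫ ∂P =
      ∫ ω, ⟪ψ (U ω + Real.sqrt t • G ω), G ω⟫ ∂P := by
  have : IsProbabilityMeasure (P.map U) := Measure.isProbabilityMeasure_map hU.aemeasurable
  set ν := P.map U
  have hs : 0 < Real.sqrt t := Real.sqrt_pos.2 ht
  have hG2 := memLp_of_map_stdGaussian hG hGlaw
  have hW : Measurable (fun ω => U ω + Real.sqrt t • G ω) := hU.add (hG.const_smul _)
  have hm : Measurable (fun ω => (U ω + Real.sqrt t • G ω, U ω)) := hW.prodMk hU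
  have hK : Measurable (fun p : F × F => ENNReal.ofReal (gaussKernel t (p.1 - p.2))) :=
    ((continuous_gaussKernel t).measurable.comp (measurable_fst.sub measurable_snd)).ennreal_ofReal
  have hKr : Measurable (fun p : F × F => gaussKernel t (p.1 - p.2)) :=
    (continuous_gaussKernel t).measurable.comp (measurable_fst.sub measurable_snd)
  have hlaw := map_prod_gaussian_perturbation hU hG hGlaw hUG ht
  set B : F × F → ℝ := fun p => ⟪ψ p.1, (Real.sqrt t)⁻¹ • (p.1 - p.2)⟫ with hB
  have hBm : Measurable B := (hψ.comp measurable_fst).inner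
    ((measurable_fst.sub measurable_snd).const_smul _)
  have hBω : ∀ ω, B (U ω + Real.sqrt t • G ω, U ω) = ⟪ψ (U ω + Real.sqrt t • G ω), G ω⟫ := by
    intro ω
    simp only [hB, add_sub_cancel_left, smul_smul, inv_mul_cancel₀ hs.ne', one_smul]
  have hBi : Integrable B (P.map (fun ω => (U ω + Real.sqrt t • G ω, U ω))) := by
    rw [integrable_map_measure hBm.aestronglyMeasurable hm.aemeasurable]
    refine (integrable_inner_of_memLp hψ2 hG2).congr (Eventually.of_forall fun ω => ?_)
    exact (hBω ω).symm
  have h1 : ∫ ω, ⟪ψ (U ω + Real.sqrt t • G ω), G ω⟫ ∂P =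
      ∫ p, gaussKernel t (p.1 - p.2) • B p ∂(volume.prod ν) := by
    simp only [← hBω]
    rw [← integral_map (f := B) hm.aemeasurable hBm.aestronglyMeasurable, hlaw,
      integral_withDensity_ofReal hKr (fun p => gaussKernel_nonneg ht _)]
  rw [hlaw, integrable_withDensity_iff_integrable_smul' hK (by simp)] at hBi
  simp only [ENNReal.toReal_ofReal (gaussKernel_nonneg ht _)] at hBi
  rw [h1, integral_prod _ hBi,
    integral_comp_gaussian_perturbation hU hG hGlaw hUG ht
      (g := fun y => ⟪ψ y, heatScore ν t y⟫)
      (hψ.inner (continuous_heatScore ν ht).measurable).stronglyMeasurable,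
    ← integral_const_mul]
  congr 1; ext y
  -- the gradient of the Gaussian kernel at `z` is the kernel times `-z / t`
  have h2 : ∀ x, gaussKernel t (y - x) • B (y, x) =
      -Real.sqrt t * ⟪ψ y, gaussKernelGrad t (y - x)⟫ := by
    intro x
    simp only [hB, gaussKernelGrad, inner_smul_right, inner_neg_right, smul_eq_mul]
    have e : Real.sqrt t * (gaussKernel t (y - x) / t) =
        gaussKernel t (y - x) * (Real.sqrt t)⁻¹ := by
      field_simp
      rw [Real.sq_sqrt ht.le]
      ring
    linear_combination (-⟪ψ y, y - x⟫) * e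
  simp only [h2]
  rw [integral_const_mul, integral_inner (integrable_gaussKernelGrad_sub ν ht y)]
  change Real.sqrt t * (heat ν t y • ⟪ψ y, heatScore ν t y⟫) = -Real.sqrt t * ⟪ψ y, heatGrad ν t y⟫
  have hp := heat_pos ν ht y
  rw [heatScore, inner_neg_right, inner_smul_right, smul_eq_mul]
  field_simp

end

section

variable {F : Type*} [NormedAddCommGroup F] [InnerProductSpace ℝ F] [FiniteDimensional ℝ F]
  [MeasurableSpace F] [BorelSpace F]

/-! ### Relative scores along the Ornstein-Uhlenbeck flow -/

variable {Ω : Type*} [MeasurableSpace Ω]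

/-- A square-integrable random vector `V` and an independent standard Gaussian vector `G`. -/
structure IsGaussianPair (P : Measure Ω) (V G : Ω → F) : Prop where
  measurable_left : Measurable V
  measurable_right : Measurable G
  memLp_left : MemLp V 2 P
  law_right : P.map G = stdGaussian F
  indep : IndepFun V G P

/-- The Ornstein-Uhlenbeck flow `e^{-s} V + √(1 - e^{-2s}) G`. -/
def ouVec (V G : Ω → F) (s : ℝ) (ω : Ω) : F :=
  Real.exp (-s) • V ω + Real.sqrt (1 - Real.exp (-2 * s)) • G ω

/-- The score of the Ornstein-Uhlenbeck flow at time `s`. -/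
def ouScore (P : Measure Ω) (V : Ω → F) (s : ℝ) : F → F :=
  heatScore (P.map (fun ω => Real.exp (-s) • V ω)) (1 - Real.exp (-2 * s))

/-- The score of the Ornstein-Uhlenbeck flow relative to the standard Gaussian measure, whose own
score is the identity, evaluated along the flow. -/
def relScore (P : Measure Ω) (V G : Ω → F) (s : ℝ) (ω : Ω) : F :=
  ouScore P V s (ouVec V G s ω) - ouVec V G s ω

/-- The relative entropy of the density `f` of `V` with respect to the standard Gaussian measure,
written in terms of the differential entropy and the second moment. -/
def relEntropy (P : Measure Ω) (V : Ω → F) (f : F → ℝ) : ℝ :=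
  -(∫ x, Real.negMulLog (f x)) + 1 / 2 * ∫ ω, ‖V ω‖ ^ 2 ∂P +
    finrank ℝ F / 2 * Real.log (2 * Real.pi)

lemma one_sub_exp_pos {s : ℝ} (hs : 0 < s) : 0 < 1 - Real.exp (-2 * s) := by
  have : Real.exp (-2 * s) < 1 := Real.exp_lt_one_iff.2 (by linarith)
  linarith

variable {P : Measure Ω} [IsProbabilityMeasure P] {V G : Ω → F}

namespace IsGaussianPair

omit [IsProbabilityMeasure P] in
lemma memLp_right (h : IsGaussianPair P V G) : MemLp G 2 P :=
  memLp_of_map_stdGaussian h.measurable_right h.law_right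

omit [IsProbabilityMeasure P] in
lemma measurable_smul_left (h : IsGaussianPair P V G) (c : ℝ) : Measurable (fun ω => c • V ω) :=
  h.measurable_left.const_smul c

omit [IsProbabilityMeasure P] in
lemma indep_smul_left (h : IsGaussianPair P V G) (c : ℝ) : IndepFun (fun ω => c • V ω) G P :=
  h.indep.comp (measurable_const_smul c) measurable_id

omit [IsProbabilityMeasure P] in
lemma memLp_ouVec (h : IsGaussianPair P V G) (s : ℝ) : MemLp (ouVec V G s) 2 P :=
  (h.memLp_left.const_smul _).add (h.memLp_right.const_smul _)

omit [IsProbabilityMeasure P] in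
lemma measurable_ouVec (h : IsGaussianPair P V G) (s : ℝ) : Measurable (ouVec V G s) :=
  (h.measurable_left.const_smul _).add (h.measurable_right.const_smul _)

lemma continuous_ouScore (h : IsGaussianPair P V G) {s : ℝ} (hs : 0 < s) :
    Continuous (ouScore P V s) :=
  have : IsProbabilityMeasure (P.map (fun ω => Real.exp (-s) • V ω)) :=
    Measure.isProbabilityMeasure_map (h.measurable_smul_left _).aemeasurable
  continuous_heatScore _ (one_sub_exp_pos hs)

lemma memLp_ouScore (h : IsGaussianPair P V G) {s : ℝ} (hs : 0 < s) :
    MemLp (fun ω => ouScore P V s (ouVec V G s ω)) 2 P :=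
  memLp_heatScore (h.measurable_smul_left _) h.measurable_right h.law_right (h.indep_smul_left _)
    (one_sub_exp_pos hs)

lemma memLp_relScore (h : IsGaussianPair P V G) {s : ℝ} (hs : 0 < s) :
    MemLp (relScore P V G s) 2 P :=
  (h.memLp_ouScore hs).sub (h.memLp_ouVec s)

lemma integral_inner_ouScore (h : IsGaussianPair P V G) {s : ℝ} (hs : 0 < s)
    {ψ : F → F} (hψ : Measurable ψ) (hψ2 : MemLp (fun ω => ψ (ouVec V G s ω)) 2 P) :
    ∫ ω, ⟪ψ (ouVec V G s ω), ouScore P V s (ouVec V G s ω)⟫ ∂P =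
      (Real.sqrt (1 - Real.exp (-2 * s)))⁻¹ * ∫ ω, ⟪ψ (ouVec V G s ω), G ω⟫ ∂P := by
  have hτ : 0 < Real.sqrt (1 - Real.exp (-2 * s)) := Real.sqrt_pos.2 (one_sub_exp_pos hs)
  rw [eq_inv_mul_iff_mul_eq₀ hτ.ne']
  exact integral_inner_heatScore (h.measurable_smul_left _) h.measurable_right h.law_right
    (h.indep_smul_left _) (one_sub_exp_pos hs) hψ hψ2

lemma integral_inner_relScore (h : IsGaussianPair P V G) {s : ℝ} (hs : 0 < s)
    {ψ : F → F} (hψ : Measurable ψ) (hψ2 : MemLp (fun ω => ψ (ouVec V G s ω)) 2 P) :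
    ∫ ω, ⟪ψ (ouVec V G s ω), relScore P V G s ω⟫ ∂P =
      (Real.sqrt (1 - Real.exp (-2 * s)))⁻¹ * ∫ ω, ⟪ψ (ouVec V G s ω), G ω⟫ ∂P -
        ∫ ω, ⟪ψ (ouVec V G s ω), ouVec V G s ω⟫ ∂P := by
  simp only [relScore, inner_sub_right]
  rw [integral_sub (integrable_inner_of_memLp hψ2 (h.memLp_ouScore hs))
    (integrable_inner_of_memLp hψ2 (h.memLp_ouVec s)), h.integral_inner_ouScore hs hψ hψ2]

/-- The relative score of a linear image of the flow is a conditional expectation of the image of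
the relative score, hence is smaller in mean square. -/
theorem integral_norm_relScore_comp_le {F' : Type*} [NormedAddCommGroup F']
    [InnerProductSpace ℝ F'] [FiniteDimensional ℝ F'] [MeasurableSpace F'] [BorelSpace F']
    (h : IsGaussianPair P V G) (T : F →L[ℝ] F')
    (h' : IsGaussianPair P (fun ω => T (V ω)) (fun ω => T (G ω))) {s : ℝ} (hs : 0 < s) :
    ∫ ω, ‖relScore P (fun ω => T (V ω)) (fun ω => T (G ω)) s ω‖ ^ 2 ∂P ≤
      ∫ ω, ‖T (relScore P V G s ω)‖ ^ 2 ∂P := by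
  set V' := fun ω => T (V ω)
  set G' := fun ω => T (G ω)
  have hY : ∀ ω, ouVec V' G' s ω = T (ouVec V G s ω) := by
    intro ω; simp [ouVec, V', G']
  set ψ : F' → F' := fun y => ouScore P V' s y - y with hψdef
  have hψc : Continuous ψ := (h'.continuous_ouScore hs).sub continuous_id
  have hψr : ∀ ω, ψ (ouVec V' G' s ω) = relScore P V' G' s ω := fun ω => rfl
  have hr' := h'.memLp_relScore hs
  have hr := h.memLp_relScore hs
  have hTr : MemLp (fun ω => T (relScore P V G s ω)) 2 P := T.comp_memLp' hr
  set A := ContinuousLinearMap.adjoint T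
  have e1 := h'.integral_inner_relScore hs hψc.measurable
    (show MemLp (fun ω => ψ (ouVec V' G' s ω)) 2 P from hr')
  have hA : MemLp (fun ω => A (ψ (T (ouVec V G s ω)))) 2 P := by
    have : MemLp (fun ω => A (relScore P V' G' s ω)) 2 P := A.comp_memLp' hr'
    simpa only [← hψr, hY] using this
  have e2 := h.integral_inner_relScore hs (ψ := fun y => A (ψ (T y)))
    (A.continuous.comp (hψc.comp T.continuous)).measurable hA
  simp only [A, ContinuousLinearMap.adjoint_inner_left] at e2
  have e3 : ∫ ω, ⟪ψ (ouVec V' G' s ω), relScore P V' G' s ω⟫ ∂P =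
      ∫ ω, ⟪ψ (T (ouVec V G s ω)), T (relScore P V G s ω)⟫ ∂P := by
    rw [e1, e2]
    simp only [hY, G']
  simp only [← hY, hψr, real_inner_self_eq_norm_sq] at e3
  have e4 : ∫ ω, ⟪relScore P V' G' s ω, T (relScore P V G s ω)⟫ ∂P ≤
      ∫ ω, (1 / 2 * ‖relScore P V' G' s ω‖ ^ 2 + 1 / 2 * ‖T (relScore P V G s ω)‖ ^ 2) ∂P := by
    refine integral_mono (integrable_inner_of_memLp hr' hTr)
      (((hr'.integrable_norm_pow (by norm_num)).const_mul _).add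
        ((hTr.integrable_norm_pow (by norm_num)).const_mul _)) fun ω => ?_
    have := real_inner_le_norm (relScore P V' G' s ω) (T (relScore P V G s ω))
    nlinarith [sq_nonneg (‖relScore P V' G' s ω‖ - ‖T (relScore P V G s ω)‖)]
  rw [integral_add ((hr'.integrable_norm_pow (by norm_num)).const_mul _)
      ((hTr.integrable_norm_pow (by norm_num)).const_mul _), integral_const_mul,
    integral_const_mul, ← e3] at e4
  linarith

/-! ### Second-order moments along the Ornstein-Uhlenbeck flow -/

lemma integral_inner_clm_left_right (h : IsGaussianPair P V G) (L : F →L[ℝ] F) :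
    ∫ ω, ⟪L (V ω), G ω⟫ ∂P = 0 := by
  have hi : IndepFun V G P := h.indep
  have hV : Integrable V P := h.memLp_left.integrable (by norm_num)
  have hG : Integrable G P := h.memLp_right.integrable (by norm_num)
  have := hi.integral_bilin hV hG ((innerSL ℝ).comp L)
  have hG0 : ∫ ω, G ω ∂P = 0 := by
    have e := integral_map (μ := P) (φ := G) (f := fun x : F => x) h.measurable_right.aemeasurable
      (by fun_prop)
    rw [← e, h.law_right, integral_id_stdGaussian]
  rw [hG0] at this
  simpa using this

lemma integral_inner_clm_ouVec_right (h : IsGaussianPair P V G) (L : F →L[ℝ] F) (s : ℝ) :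
    ∫ ω, ⟪L (ouVec V G s ω), G ω⟫ ∂P =
      Real.sqrt (1 - Real.exp (-2 * s)) * ∫ ω, ⟪L (G ω), G ω⟫ ∂P := by
  have i1 : Integrable (fun ω => ⟪L (V ω), G ω⟫) P :=
    integrable_inner_of_memLp (L.comp_memLp' h.memLp_left) h.memLp_right
  have i2 : Integrable (fun ω => ⟪L (G ω), G ω⟫) P :=
    integrable_inner_of_memLp (L.comp_memLp' h.memLp_right) h.memLp_right
  simp only [ouVec, map_add, map_smul, inner_add_left, inner_smul_left, conj_trivial]
  rw [integral_add (i1.const_mul _) (i2.const_mul _), integral_const_mul, integral_const_mul,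
    h.integral_inner_clm_left_right L]
  ring

lemma integral_inner_clm_ouVec_ouVec (h : IsGaussianPair P V G) (L : F →L[ℝ] F) {s : ℝ}
    (hs : 0 < s) :
    ∫ ω, ⟪L (ouVec V G s ω), ouVec V G s ω⟫ ∂P =
      Real.exp (-2 * s) * ∫ ω, ⟪L (V ω), V ω⟫ ∂P +
        (1 - Real.exp (-2 * s)) * ∫ ω, ⟪L (G ω), G ω⟫ ∂P := by
  have i0 : Integrable (fun ω => ⟪L (V ω), V ω⟫) P :=
    integrable_inner_of_memLp (L.comp_memLp' h.memLp_left) h.memLp_left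
  have i1 : Integrable (fun ω => ⟪L (G ω), V ω⟫) P :=
    integrable_inner_of_memLp (L.comp_memLp' h.memLp_right) h.memLp_left
  have i2 : Integrable (fun ω => ⟪L (ouVec V G s ω), G ω⟫) P :=
    integrable_inner_of_memLp (L.comp_memLp' (h.memLp_ouVec s)) h.memLp_right
  have hcross : ∫ ω, ⟪L (G ω), V ω⟫ ∂P = 0 := by
    rw [← h.integral_inner_clm_left_right (ContinuousLinearMap.adjoint L)]
    congr 1; ext ω
    rw [ContinuousLinearMap.adjoint_inner_left, real_inner_comm]
  have e : ∀ ω, ⟪L (ouVec V G s ω), ouVec V G s ω⟫ =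
      Real.exp (-s) * Real.exp (-s) * ⟪L (V ω), V ω⟫ +
      Real.exp (-s) * Real.sqrt (1 - Real.exp (-2 * s)) * ⟪L (G ω), V ω⟫ +
      Real.sqrt (1 - Real.exp (-2 * s)) * ⟪L (ouVec V G s ω), G ω⟫ := by
    intro ω
    conv_lhs => rw [ouVec, inner_add_right]
    rw [inner_smul_right, inner_smul_right]
    conv_lhs => rw [← ouVec]
    conv_lhs => enter [1]; rw [ouVec, map_add, map_smul, map_smul, inner_add_left, inner_smul_left,
      inner_smul_left]
    simp only [conj_trivial]
    ring
  simp only [e]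
  have i01 : Integrable (fun ω => Real.exp (-s) * Real.exp (-s) * ⟪L (V ω), V ω⟫ +
      Real.exp (-s) * Real.sqrt (1 - Real.exp (-2 * s)) * ⟪L (G ω), V ω⟫) P :=
    (i0.const_mul _).add (i1.const_mul _)
  rw [integral_add i01 (i2.const_mul _), integral_add (i0.const_mul _) (i1.const_mul _),
    integral_const_mul, integral_const_mul, integral_const_mul, hcross,
    h.integral_inner_clm_ouVec_right, ← Real.exp_add, ← mul_assoc,
    Real.mul_self_sqrt (one_sub_exp_pos hs).le]
  ring_nf

lemma integral_inner_clm_ouVec_ouScore (h : IsGaussianPair P V G) (L : F →L[ℝ] F) {s : ℝ}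
    (hs : 0 < s) :
    ∫ ω, ⟪L (ouVec V G s ω), ouScore P V s (ouVec V G s ω)⟫ ∂P = ∫ ω, ⟪L (G ω), G ω⟫ ∂P := by
  have hτ : 0 < Real.sqrt (1 - Real.exp (-2 * s)) := Real.sqrt_pos.2 (one_sub_exp_pos hs)
  rw [h.integral_inner_ouScore hs L.continuous.measurable (L.comp_memLp' (h.memLp_ouVec s)),
    h.integral_inner_clm_ouVec_right, inv_mul_cancel_left₀ hτ.ne']

/-- Passing from the score to the relative score only changes the second-order moments by explicit
terms. -/
lemma integral_inner_clm_relScore (h : IsGaussianPair P V G) (L : F →L[ℝ] F) {s : ℝ}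
    (hs : 0 < s) :
    ∫ ω, ⟪L (relScore P V G s ω), relScore P V G s ω⟫ ∂P =
      ∫ ω, ⟪L (ouScore P V s (ouVec V G s ω)), ouScore P V s (ouVec V G s ω)⟫ ∂P -
        2 * ∫ ω, ⟪L (G ω), G ω⟫ ∂P + ∫ ω, ⟪L (ouVec V G s ω), ouVec V G s ω⟫ ∂P := by
  have hρ := h.memLp_ouScore hs
  have hY := h.memLp_ouVec s
  have i1 : Integrable (fun ω => ⟪L (ouScore P V s (ouVec V G s ω)),
    ouScore P V s (ouVec V G s ω)⟫) P := integrable_inner_of_memLp (L.comp_memLp' hρ) hρ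
  have i2 : Integrable (fun ω => ⟪ContinuousLinearMap.adjoint L (ouVec V G s ω),
    ouScore P V s (ouVec V G s ω)⟫) P :=
    integrable_inner_of_memLp ((ContinuousLinearMap.adjoint L).comp_memLp' hY) hρ
  have i3 : Integrable (fun ω => ⟪L (ouVec V G s ω), ouScore P V s (ouVec V G s ω)⟫) P :=
    integrable_inner_of_memLp (L.comp_memLp' hY) hρ
  have i4 : Integrable (fun ω => ⟪L (ouVec V G s ω), ouVec V G s ω⟫) P :=
    integrable_inner_of_memLp (L.comp_memLp' hY) hY
  have e : ∀ ω, ⟪L (relScore P V G s ω), relScore P V G s ω⟫ =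
      ⟪L (ouScore P V s (ouVec V G s ω)), ouScore P V s (ouVec V G s ω)⟫ -
      ⟪ContinuousLinearMap.adjoint L (ouVec V G s ω), ouScore P V s (ouVec V G s ω)⟫ -
      ⟪L (ouVec V G s ω), ouScore P V s (ouVec V G s ω)⟫ +
      ⟪L (ouVec V G s ω), ouVec V G s ω⟫ := by
    intro ω
    rw [relScore, map_sub, inner_sub_left, inner_sub_right, inner_sub_right,
      ContinuousLinearMap.adjoint_inner_left, real_inner_comm (L (ouScore P V s (ouVec V G s ω)))
        (ouVec V G s ω)]
    ring
  simp only [e]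
  have i12 : Integrable (fun ω => ⟪L (ouScore P V s (ouVec V G s ω)),
    ouScore P V s (ouVec V G s ω)⟫ - ⟪ContinuousLinearMap.adjoint L (ouVec V G s ω),
    ouScore P V s (ouVec V G s ω)⟫) P := i1.sub i2
  have i123 : Integrable (fun ω => ⟪L (ouScore P V s (ouVec V G s ω)),
    ouScore P V s (ouVec V G s ω)⟫ - ⟪ContinuousLinearMap.adjoint L (ouVec V G s ω),
    ouScore P V s (ouVec V G s ω)⟫ - ⟪L (ouVec V G s ω), ouScore P V s (ouVec V G s ω)⟫) P :=
    i12.sub i3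
  rw [integral_add i123 i4, integral_sub i12 i3, integral_sub i1 i2,
    h.integral_inner_clm_ouVec_ouScore _ hs, h.integral_inner_clm_ouVec_ouScore _ hs]
  have : ∫ ω, ⟪ContinuousLinearMap.adjoint L (G ω), G ω⟫ ∂P = ∫ ω, ⟪L (G ω), G ω⟫ ∂P := by
    congr 1; ext ω
    rw [ContinuousLinearMap.adjoint_inner_left, real_inner_comm]
  rw [this]; ring

omit [IsProbabilityMeasure P] in
lemma integral_norm_sq_right (h : IsGaussianPair P V G) :
    ∫ ω, ‖G ω‖ ^ 2 ∂P = finrank ℝ F := by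
  have e := integral_map (μ := P) (φ := G) (f := fun x : F => ‖x‖ ^ 2)
    h.measurable_right.aemeasurable (by fun_prop)
  rw [← e, h.law_right, stdGaussian_eq_withDensity,
    integral_withDensity_ofReal (continuous_gaussKernel 1).measurable (gaussKernel_nonneg one_pos)]
  simpa [mul_comm] using integral_sq_mul_gaussKernel (F := F) one_pos

lemma integral_norm_relScore_sq (h : IsGaussianPair P V G) {s : ℝ} (hs : 0 < s) :
    ∫ ω, ‖relScore P V G s ω‖ ^ 2 ∂P =
      ∫ ω, ‖ouScore P V s (ouVec V G s ω)‖ ^ 2 ∂P - 2 * finrank ℝ F +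
        (Real.exp (-2 * s) * ∫ ω, ‖V ω‖ ^ 2 ∂P + (1 - Real.exp (-2 * s)) * finrank ℝ F) := by
  have h1 := h.integral_inner_clm_relScore (ContinuousLinearMap.id ℝ F) hs
  have h2 := h.integral_inner_clm_ouVec_ouVec (ContinuousLinearMap.id ℝ F) hs
  simp only [ContinuousLinearMap.id_apply, real_inner_self_eq_norm_sq,
    h.integral_norm_sq_right] at h1 h2
  rw [h1, h2]

end IsGaussianPair

/-! ### The integrated form of de Bruijn's identity -/

omit [FiniteDimensional ℝ F] in
lemma heat_map_smul (ν : Measure F) {c t : ℝ} (hc : 0 < c) (ht : 0 < t) (y : F) :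
    heat (ν.map (fun x => c • x)) (c ^ 2 * t) (c • y) = (c ^ finrank ℝ F)⁻¹ * heat ν t y := by
  have hm : Measurable (fun x : F => c • x) := measurable_const_smul c
  have hc' : Continuous (fun x => gaussKernel (c ^ 2 * t) (c • y - x)) :=
    (continuous_gaussKernel _).comp (continuous_const.sub continuous_id)
  rw [heat, integral_map hm.aemeasurable hc'.aestronglyMeasurable, heat, ← integral_const_mul]
  simp only [← smul_sub, gaussKernel_smul hc ht]

lemma heatGrad_map_smul (ν : Measure F) {c t : ℝ} (hc : 0 < c) (ht : 0 < t) (y : F) :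
    heatGrad (ν.map (fun x => c • x)) (c ^ 2 * t) (c • y) =
      ((c ^ finrank ℝ F)⁻¹ * c⁻¹) • heatGrad ν t y := by
  have hm : Measurable (fun x : F => c • x) := measurable_const_smul c
  have hc' : Continuous (fun x => gaussKernelGrad (c ^ 2 * t) (c • y - x)) :=
    (continuous_gaussKernelGrad _).comp (continuous_const.sub continuous_id)
  rw [heatGrad, integral_map hm.aemeasurable hc'.aestronglyMeasurable, heatGrad, ← integral_smul]
  congr 1; ext x
  simp only [← smul_sub, gaussKernelGrad, gaussKernel_smul hc ht, smul_neg, smul_smul]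
  congr 2
  field_simp

lemma heatFisher_map_smul (ν : Measure F) [IsProbabilityMeasure ν] {c t : ℝ} (hc : 0 < c)
    (ht : 0 < t) :
    heatFisher (ν.map (fun x => c • x)) (c ^ 2 * t) = (c ^ 2)⁻¹ * heatFisher ν t := by
  have h := Measure.integral_comp_smul volume (fun y =>
    ‖heatGrad (ν.map (fun x => c • x)) (c ^ 2 * t) y‖ ^ 2 /
      heat (ν.map (fun x => c • x)) (c ^ 2 * t) y) c
  have hcN : 0 < c ^ finrank ℝ F := by positivity
  have e : ∀ y, ‖heatGrad (ν.map (fun x => c • x)) (c ^ 2 * t) (c • y)‖ ^ 2 /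
      heat (ν.map (fun x => c • x)) (c ^ 2 * t) (c • y) =
      ((c ^ finrank ℝ F)⁻¹ * (c ^ 2)⁻¹) * (‖heatGrad ν t y‖ ^ 2 / heat ν t y) := by
    intro y
    have := heat_pos ν ht y
    rw [heat_map_smul ν hc ht, heatGrad_map_smul ν hc ht, norm_smul,
      Real.norm_of_nonneg (by positivity)]
    field_simp
  simp only [e] at h
  rw [integral_const_mul, abs_of_pos (by positivity), smul_eq_mul, mul_assoc] at h
  exact (mul_left_cancel₀ (by positivity) h).symm

/-- Up to the dilation by `e^{-s}`, the Ornstein-Uhlenbeck flow at time `s` is the heat flow at time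
`e^{2s} - 1`. -/
lemma integral_norm_ouScore_sq (h : IsGaussianPair P V G) {s : ℝ} (hs : 0 < s) :
    ∫ ω, ‖ouScore P V s (ouVec V G s ω)‖ ^ 2 ∂P =
      Real.exp (2 * s) * heatFisher (P.map V) (Real.exp (2 * s) - 1) := by
  have : IsProbabilityMeasure (P.map V) :=
    Measure.isProbabilityMeasure_map h.measurable_left.aemeasurable
  have hmap : P.map (fun ω => Real.exp (-s) • V ω) =
      (P.map V).map (fun x => Real.exp (-s) • x) :=
    (Measure.map_map (measurable_const_smul _) h.measurable_left).symm
  have ht : 0 < Real.exp (2 * s) - 1 := by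
    have : 1 < Real.exp (2 * s) := Real.one_lt_exp_iff.2 (by linarith)
    linarith
  have hτ : 1 - Real.exp (-2 * s) = Real.exp (-s) ^ 2 * (Real.exp (2 * s) - 1) := by
    rw [mul_sub, ← Real.exp_nat_mul, ← Real.exp_add]
    simp
  have := integral_norm_heatScore_sq (h.measurable_smul_left (Real.exp (-s))) h.measurable_right
    h.law_right (h.indep_smul_left _) (one_sub_exp_pos hs)
  refine this.trans ?_
  rw [hmap, hτ, heatFisher_map_smul _ (Real.exp_pos _) ht, ← Real.exp_nat_mul, ← Real.exp_neg]
  congr 2; push_cast; ring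

/-- **Integrated de Bruijn identity**: the relative entropy is the integral along the
Ornstein-Uhlenbeck flow of the relative Fisher information. -/
theorem integral_relScore_eq_relEntropy (h : IsGaussianPair P V G) {f : F → ℝ}
    (hf : Measurable f) (hf0 : ∀ x, 0 ≤ f x)
    (hVf : P.map V = volume.withDensity (fun x => ENNReal.ofReal (f x)))
    (hfl : Integrable (fun x => Real.negMulLog (f x))) :
    IntegrableOn (fun s => ∫ ω, ‖relScore P V G s ω‖ ^ 2 ∂P) (Ioi 0) ∧
      ∫ s in Ioi (0 : ℝ), ∫ ω, ‖relScore P V G s ω‖ ^ 2 ∂P = relEntropy P V f := by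
  have hprob : IsProbabilityMeasure (P.map V) :=
    Measure.isProbabilityMeasure_map h.measurable_left.aemeasurable
  have hlint : ∫⁻ x, ENNReal.ofReal (f x) = 1 := by
    have := hprob.measure_univ
    rwa [hVf, withDensity_apply _ MeasurableSet.univ, setLIntegral_univ] at this
  have hfi : Integrable f := by
    refine ⟨hf.aestronglyMeasurable, ?_⟩
    rw [hasFiniteIntegral_iff_ofReal (Eventually.of_forall hf0), hlint]
    exact ENNReal.one_lt_top
  have hf1 : ∫ x, f x = 1 := by
    rw [integral_eq_lintegral_of_nonneg_ae (Eventually.of_forall hf0) hf.aestronglyMeasurable,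
      hlint, ENNReal.toReal_one]
  have hν : MemLp id 2 (P.map V) := by
    rw [memLp_map_measure_iff aestronglyMeasurable_id h.measurable_left.aemeasurable]
    exact h.memLp_left
  set ν := P.map V with hνdef
  set M := ∫ ω, ‖V ω‖ ^ 2 ∂P with hM
  set N : ℝ := (finrank ℝ F : ℝ) with hN
  have hν' := hν
  rw [hVf] at hν'
  have hzero := tendsto_heatEntropy_zero hf hf0 hfi hf1 hfl hν'
  rw [← hVf] at hzero
  have htpos : ∀ s : ℝ, 0 < s → 0 < Real.exp (2 * s) - 1 := by
    intro s hs
    have : 1 < Real.exp (2 * s) := Real.one_lt_exp_iff.2 (by linarith)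
    linarith
  -- `g s` is the opposite of the relative entropy of the flow at time `s`, expressed through the
  -- heat flow by the change of time `t = e^{2s} - 1`
  set g : ℝ → ℝ := fun s => heatEntropy ν (Real.exp (2 * s) - 1) - N * s -
    1 / 2 * (Real.exp (-2 * s) * M + (1 - Real.exp (-2 * s)) * N) -
      N / 2 * Real.log (2 * Real.pi) with hg
  have hderiv : ∀ s, 0 < s → HasDerivAt g (∫ ω, ‖relScore P V G s ω‖ ^ 2 ∂P) s := by
    intro s hs
    have h1 : HasDerivAt (fun s : ℝ => Real.exp (2 * s) - 1) (Real.exp (2 * s) * 2) s := by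
      have := (((hasDerivAt_id s).const_mul 2).exp).sub_const 1
      simpa using this
    have h2 : HasDerivAt (fun s : ℝ => Real.exp (-2 * s)) (Real.exp (-2 * s) * (-2)) s := by
      have := ((hasDerivAt_id s).const_mul (-2)).exp
      simpa using this
    have h3 := (hasDerivAt_heatEntropy hν (htpos s hs)).comp s h1
    have h4 := (((h3.sub ((hasDerivAt_id s).const_mul N)).sub
      (((h2.mul_const M).add (((hasDerivAt_const s (1 : ℝ)).sub h2).mul_const N)).const_mul
        (1 / 2))).sub_const (N / 2 * Real.log (2 * Real.pi)))
    refine HasDerivAt.congr_deriv (f := g) h4 ?_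
    rw [h.integral_norm_relScore_sq hs, integral_norm_ouScore_sq h hs]
    ring
  have hg0 : Tendsto g (𝓝[>] 0) (𝓝 (-relEntropy P V f)) := by
    have h1 : Tendsto (fun s : ℝ => Real.exp (2 * s) - 1) (𝓝[>] 0) (𝓝[>] 0) := by
      refine tendsto_nhdsWithin_iff.2 ⟨?_, ?_⟩
      · have : Continuous (fun s : ℝ => Real.exp (2 * s) - 1) := by fun_prop
        have h := this.tendsto 0
        simp only [mul_zero, Real.exp_zero, sub_self] at h
        exact h.mono_left nhdsWithin_le_nhds
      · filter_upwards [self_mem_nhdsWithin] with s hs using htpos s hs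
    have h2 : Tendsto (fun s : ℝ => N * s +
        1 / 2 * (Real.exp (-2 * s) * M + (1 - Real.exp (-2 * s)) * N) +
        N / 2 * Real.log (2 * Real.pi)) (𝓝[>] 0)
        (𝓝 (1 / 2 * M + N / 2 * Real.log (2 * Real.pi))) := by
      have : Continuous (fun s : ℝ => N * s +
        1 / 2 * (Real.exp (-2 * s) * M + (1 - Real.exp (-2 * s)) * N) +
        N / 2 * Real.log (2 * Real.pi)) := by fun_prop
      have h := this.tendsto 0
      simp only [mul_zero, Real.exp_zero, sub_self, zero_mul, add_zero, one_mul, zero_add] at h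
      exact h.mono_left nhdsWithin_le_nhds
    have h3 := (hzero.comp h1).sub h2
    have e : (∫ x, Real.negMulLog (f x)) - (1 / 2 * M + N / 2 * Real.log (2 * Real.pi)) =
        -relEntropy P V f := by
      rw [relEntropy, ← hM, ← hN]; ring
    rw [← e]
    refine h3.congr fun s => ?_
    simp only [hg, Function.comp_apply]; ring
  have hexp : Tendsto (fun s : ℝ => Real.exp (-2 * s)) atTop (𝓝 0) :=
    Real.tendsto_exp_atBot.comp (tendsto_id.const_mul_atTop_of_neg (by norm_num))
  -- at a large time `t`, the entropy of the heat flow is `N / 2 * log (2 π t) + N / 2 + o(1)`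
  have hginf : Tendsto g atTop (𝓝 0) := by
    have h1 : Tendsto (fun s : ℝ => Real.exp (2 * s) - 1) atTop atTop :=
      tendsto_atTop_add_const_right _ _
        (Real.tendsto_exp_atTop.comp (tendsto_id.const_mul_atTop zero_lt_two))
    have h2 := (tendsto_heatEntropy_atTop hν).comp h1
    have h3 : Tendsto (fun s : ℝ => N / 2 * Real.log (1 - Real.exp (-2 * s)) -
        1 / 2 * (Real.exp (-2 * s) * M + (1 - Real.exp (-2 * s)) * N)) atTop
        (𝓝 (N / 2 * Real.log (1 - 0) - 1 / 2 * (0 * M + (1 - 0) * N))) := by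
      have h4 := tendsto_const_nhds (x := (1 : ℝ)) (f := atTop (α := ℝ)) |>.sub hexp
      exact ((h4.log (by norm_num)).const_mul _).sub
        (((hexp.mul_const M).add (h4.mul_const N)).const_mul _)
    have h5 := h2.add h3
    have e : N / 2 + (N / 2 * Real.log (1 - 0) - 1 / 2 * (0 * M + (1 - 0) * N)) = 0 := by
      simp; ring
    rw [e] at h5
    refine h5.congr' ?_
    filter_upwards [eventually_gt_atTop 0] with s hs
    have hlog : Real.log (2 * Real.pi * (Real.exp (2 * s) - 1)) =
        Real.log (2 * Real.pi) + 2 * s + Real.log (1 - Real.exp (-2 * s)) := by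
      have e1 : Real.exp (2 * s) - 1 = Real.exp (2 * s) * (1 - Real.exp (-2 * s)) := by
        rw [mul_sub, ← Real.exp_add]; simp
      rw [Real.log_mul (by positivity) (htpos s hs).ne', e1,
        Real.log_mul (Real.exp_pos _).ne' (one_sub_exp_pos hs).ne', Real.log_exp]
      ring
    simp only [hg, Function.comp_apply, hlog]
    ring
  -- the fundamental theorem of calculus on `(0, ∞)`, after extending `g` by its limit at zero
  have hcont : ContinuousWithinAt (Function.update g 0 (-relEntropy P V f)) (Ici 0) 0 := by
    rw [continuousWithinAt_update_same, Ici_sdiff_left]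
    exact hg0
  have hderiv' : ∀ s ∈ Ioi (0 : ℝ), HasDerivAt (Function.update g 0 (-relEntropy P V f))
      (∫ ω, ‖relScore P V G s ω‖ ^ 2 ∂P) s := by
    intro s hs
    refine (hderiv s hs).congr_of_eventuallyEq ?_
    filter_upwards [Ioi_mem_nhds hs] with r hr
    exact Function.update_of_ne (ne_of_gt hr) _ _
  have hinf' : Tendsto (Function.update g 0 (-relEntropy P V f)) atTop (𝓝 0) := by
    refine hginf.congr' ?_
    filter_upwards [eventually_gt_atTop 0] with s hs
    exact (Function.update_of_ne (ne_of_gt hs) _ _).symm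
  have hpos : ∀ s ∈ Ioi (0 : ℝ), 0 ≤ ∫ ω, ‖relScore P V G s ω‖ ^ 2 ∂P := fun s _ =>
    integral_nonneg fun ω => by positivity
  refine ⟨integrableOn_Ioi_deriv_of_nonneg hcont hderiv' hpos hinf', ?_⟩
  rw [integral_Ioi_of_hasDerivAt_of_nonneg hcont hderiv' hpos hinf', Function.update_self]
  ring

end

section

/-! ### Densities and entropies under invertible linear maps -/

section Density

variable {Ω : Type*} [MeasurableSpace Ω] {A B : Type*} [MeasureSpace A] [MeasureSpace B]
  {P : Measure Ω}

/-- `f` is a measurable, everywhere nonnegative, real-valued density of `X`. -/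
structure IsDensity (P : Measure Ω) (X : Ω → A) (f : A → ℝ) : Prop where
  measurable : Measurable f
  nonneg : ∀ x, 0 ≤ f x
  map_eq : P.map X = volume.withDensity (fun x => ENNReal.ofReal (f x))

lemma exists_isDensity [IsFiniteMeasure P] {X : Ω → A} (h : HasPDF X P) :
    ∃ f, IsDensity P X f := by
  refine ⟨fun x => (pdf X P volume x).toReal, (measurable_pdf X P volume).ennreal_toReal,
    fun x => ENNReal.toReal_nonneg, ?_⟩
  rw [map_eq_withDensity_pdf X P volume]
  exact (withDensity_congr_ae pdf.ofReal_toReal_ae_eq).symm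

lemma IsDensity.negMulLog_ae_eq [SigmaFinite (volume : Measure A)] {X : Ω → A} {f : A → ℝ}
    (h : IsDensity P X f) :
    (fun x => Real.negMulLog (pdf X P volume x).toReal) =ᵐ[volume]
      fun x => Real.negMulLog (f x) := by
  have h1 : pdf X P volume =ᵐ[volume] fun x => ENNReal.ofReal (f x) := by
    rw [pdf_def, h.map_eq]
    exact Measure.rnDeriv_withDensity _ h.measurable.ennreal_ofReal
  filter_upwards [h1] with x hx
  rw [hx, ENNReal.toReal_ofReal (h.nonneg x)]

lemma IsDensity.hasFiniteEntropy_iff [SigmaFinite (volume : Measure A)] {X : Ω → A} {f : A → ℝ}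
    (h : IsDensity P X f) :
    HasFiniteEntropy P X ↔ Integrable (fun x => Real.negMulLog (f x)) :=
  integrable_congr h.negMulLog_ae_eq

lemma IsDensity.entropy_eq [SigmaFinite (volume : Measure A)] {X : Ω → A} {f : A → ℝ}
    (h : IsDensity P X f) : entropy P X = ∫ x, Real.negMulLog (f x) :=
  integral_congr_ae h.negMulLog_ae_eq

lemma IsDensity.integrable [IsFiniteMeasure P] {X : Ω → A} {f : A → ℝ} (h : IsDensity P X f) :
    Integrable f := by
  refine ⟨h.measurable.aestronglyMeasurable, ?_⟩
  rw [hasFiniteIntegral_iff_ofReal (ae_of_all _ h.nonneg), ← setLIntegral_univ,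
    ← withDensity_apply _ MeasurableSet.univ, ← h.map_eq]
  exact measure_lt_top _ _

lemma IsDensity.integral_eq_one [IsProbabilityMeasure P] {X : Ω → A} {f : A → ℝ}
    (h : IsDensity P X f) (hX : AEMeasurable X P) : ∫ x, f x = 1 := by
  rw [integral_eq_lintegral_of_nonneg_ae (ae_of_all _ h.nonneg)
    h.measurable.aestronglyMeasurable, ← setLIntegral_univ,
    ← withDensity_apply _ MeasurableSet.univ, ← h.map_eq,
    Measure.map_apply_of_aemeasurable hX MeasurableSet.univ]
  simp

/-- The density of `e ∘ X` when `e` multiplies volumes by the factor `c⁻¹`. -/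
lemma IsDensity.comp_measurableEquiv {X : Ω → A} {f : A → ℝ} (h : IsDensity P X f)
    (hX : Measurable X) (e : A ≃ᵐ B) {c : ℝ} (hc : 0 < c)
    (he : (volume : Measure A).map e = ENNReal.ofReal c • volume) :
    IsDensity P (fun ω => e (X ω)) (fun b => c * f (e.symm b)) := by
  have hm : Measurable (fun b => f (e.symm b)) := h.measurable.comp e.symm.measurable
  refine ⟨hm.const_mul c, fun b => mul_nonneg hc.le (h.nonneg _), ?_⟩
  have h1 : P.map (fun ω => e (X ω)) = (P.map X).map e :=
    (Measure.map_map e.measurable hX).symm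
  rw [h1, h.map_eq]
  ext S hS
  rw [Measure.map_apply e.measurable hS, withDensity_apply _ (e.measurable hS),
    withDensity_apply _ hS]
  have h2 : ∀ b, ENNReal.ofReal (c * f (e.symm b)) =
      ENNReal.ofReal c * ENNReal.ofReal (f (e.symm b)) := fun b => ENNReal.ofReal_mul hc.le
  simp only [h2]
  have h3 : ∫⁻ b in S, ENNReal.ofReal (f (e.symm b)) ∂((volume : Measure A).map e) =
      ∫⁻ a in e ⁻¹' S, ENNReal.ofReal (f a) := by
    rw [setLIntegral_map hS hm.ennreal_ofReal e.measurable]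
    simp
  rw [lintegral_const_mul _ hm.ennreal_ofReal, ← h3, he, Measure.restrict_smul,
    lintegral_smul_measure, smul_eq_mul]

/-- Multiplying volumes by the factor `c⁻¹` adds `-log c` to the entropy. -/
lemma IsDensity.integral_negMulLog_comp {X : Ω → A} {f : A → ℝ} [IsProbabilityMeasure P]
    (h : IsDensity P X f)
    (hX : Measurable X) (e : A ≃ᵐ B) {c : ℝ} (hc : 0 < c)
    (he : (volume : Measure A).map e = ENNReal.ofReal c • volume)
    (hf : Integrable (fun x => Real.negMulLog (f x))) :
    Integrable (fun b => Real.negMulLog (c * f (e.symm b))) ∧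
      ∫ b, Real.negMulLog (c * f (e.symm b)) =
        (∫ x, Real.negMulLog (f x)) - Real.log c := by
  have hc0 : ENNReal.ofReal c ≠ 0 := by simpa using hc
  have key : ∀ x, Real.negMulLog (c * f x) = c * (Real.negMulLog (f x) - f x * Real.log c) := by
    intro x
    rcases eq_or_ne (f x) 0 with h0 | h0
    · simp [h0]
    · simp only [Real.negMulLog, Real.log_mul hc.ne' h0]; ring
  have hg : Integrable (fun x => c * (Real.negMulLog (f x) - f x * Real.log c)) :=
    (hf.sub (h.integrable.mul_const _)).const_mul c
  have h1 : Integrable (fun b => Real.negMulLog (c * f (e.symm b)))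
      ((volume : Measure A).map e) := by
    rw [e.measurableEmbedding.integrable_map_iff]
    refine hg.congr (ae_of_all _ fun x => ?_)
    simp [key]
  have h2 : ∫ b, Real.negMulLog (c * f (e.symm b)) ∂((volume : Measure A).map e) =
      c * ((∫ x, Real.negMulLog (f x)) - Real.log c) := by
    rw [e.measurableEmbedding.integral_map]
    simp only [e.symm_apply_apply, key]
    rw [integral_const_mul, integral_sub hf (h.integrable.mul_const _), integral_mul_const,
      h.integral_eq_one hX.aemeasurable, one_mul]
  rw [he] at h1 h2
  rw [integral_smul_measure, ENNReal.toReal_ofReal hc.le, smul_eq_mul] at h2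
  exact ⟨(integrable_smul_measure hc0 ENNReal.ofReal_ne_top).1 h1, mul_left_cancel₀ hc.ne' h2⟩

end Density

end

section

/-! ### The Euclidean structure on blocks of vectors -/

/-- `(ℝ^d)^ι` with its Euclidean norm. -/
abbrev EPi (ι : Type*) [Fintype ι] (d : ℕ) : Type _ := PiLp 2 (fun _ : ι => E d)

section Blocks

variable {ι : Type*} [Fintype ι] {d : ℕ}

lemma finrank_ePi : finrank ℝ (EPi ι d) = Fintype.card ι * d := by
  rw [(PiLp.continuousLinearEquiv 2 ℝ (fun _ : ι => E d)).toLinearEquiv.finrank_eq,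
    finrank_pi_fintype]
  simp

lemma gaussKernel_toLp (x : ι → E d) :
    gaussKernel 1 (WithLp.toLp 2 x : EPi ι d) = ∏ i, gaussKernel 1 (x i) := by
  simp only [gaussKernel, finrank_ePi, finrank_euclideanSpace_fin, Finset.prod_mul_distrib,
    Finset.prod_const, Finset.card_univ, ← Real.exp_sum, PiLp.norm_sq_eq_of_L2]
  congr 1
  · rw [← Real.rpow_natCast, ← Real.rpow_mul (by positivity)]
    congr 1; push_cast; ring
  · rw [← Finset.sum_div, Finset.sum_neg_distrib]

/-- The product of the Lebesgue measures is the Lebesgue measure of the Euclidean structure. -/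
lemma volume_preserving_toLp :
    MeasurePreserving (WithLp.toLp 2 : (ι → E d) → EPi ι d) := by
  have hm : Measurable (WithLp.toLp 2 : (ι → E d) → EPi ι d) :=
    (MeasurableEquiv.toLp 2 (ι → E d)).measurable
  refine ⟨hm, ?_⟩
  set μ : Measure (EPi ι d) :=
    (volume : Measure (ι → E d)).map (WithLp.toLp 2 : (ι → E d) → EPi ι d) with hμ
  have : μ.IsAddHaarMeasure :=
    (PiLp.continuousLinearEquiv 2 ℝ (fun _ : ι => E d)).symm.isAddHaarMeasure_map volume
  have hc := Measure.isAddLeftInvariant_eq_smul μ (volume : Measure (EPi ι d))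
  set c := μ.addHaarScalarFactor (volume : Measure (EPi ι d))
  -- both sides give the Gaussian density total mass one
  have h1 : ∫ x, gaussKernel 1 x ∂μ = 1 := by
    rw [hμ, integral_map hm.aemeasurable (continuous_gaussKernel 1).aestronglyMeasurable]
    simp only [gaussKernel_toLp]
    rw [integral_fintype_prod_volume_eq_prod (fun _ : ι => gaussKernel (F := E d) 1)]
    simp [integral_gaussKernel one_pos]
  rw [hc, integral_smul_nnreal_measure, integral_gaussKernel one_pos] at h1
  have h2 : c = 1 := by
    have : (c : ℝ) = 1 := by simpa [NNReal.smul_def] using h1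
    exact_mod_cast this
  rw [hc, h2, one_smul]

lemma map_smul_pi {a : ι → ℝ} (ha : ∀ i, 0 < a i) :
    (volume : Measure (ι → E d)).map (fun x i => a i • x i) =
      ENNReal.ofReal (∏ i, (a i ^ d)⁻¹) • volume := by
  set L : (ι → E d) →ₗ[ℝ] (ι → E d) :=
    LinearMap.pi fun i => (a i • LinearMap.id) ∘ₗ LinearMap.proj i with hL
  have hdet : LinearMap.det L = ∏ i, a i ^ d := by
    rw [hL, LinearMap.det_pi]
    simp
  have hpos : 0 < ∏ i, a i ^ d := Finset.prod_pos fun i _ => pow_pos (ha i) d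
  have h := Measure.map_linearMap_addHaar_eq_smul_addHaar (volume : Measure (ι → E d))
    (f := L) (by rw [hdet]; exact hpos.ne')
  rw [hdet, abs_of_pos (inv_pos.2 hpos), ← Finset.prod_inv_distrib] at h
  exact h

variable {Ω : Type*} [MeasurableSpace Ω] {P : Measure Ω} [IsProbabilityMeasure P]

omit [Fintype ι] in
lemma measurable_vec {X : ι → Ω → E d} (hX : ∀ i, Measurable (X i)) : Measurable (vec X) :=
  measurable_pi_lambda _ hX

/-- The Euclidean version of a random vector with rescaled blocks has a density, and its entropy
is the entropy of the original vector plus the logarithm of the Jacobian. -/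
lemma exists_isDensity_toLp_smul {X : ι → Ω → E d} (hX : ∀ i, Measurable (X i))
    (hpdf : HasPDF (vec X) P) (hent : HasFiniteEntropy P (vec X)) {a : ι → ℝ}
    (ha : ∀ i, 0 < a i) :
    ∃ f, IsDensity P (fun ω => (WithLp.toLp 2 fun i => a i • X i ω : EPi ι d)) f ∧
      Integrable (fun x => Real.negMulLog (f x)) ∧
      ∫ x, Real.negMulLog (f x) = entropy P (vec X) + d * ∑ i, Real.log (a i) := by
  obtain ⟨f, hf⟩ := exists_isDensity hpdf
  set e : (ι → E d) ≃ᵐ EPi ι d :=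
    (MeasurableEquiv.piCongrRight fun i => MeasurableEquiv.smul₀ (a i) (ha i).ne').trans
      (MeasurableEquiv.toLp 2 (ι → E d)) with he
  set c : ℝ := ∏ i, (a i ^ d)⁻¹
  have hc : 0 < c := Finset.prod_pos fun i _ => inv_pos.2 (pow_pos (ha i) d)
  have hmap : (volume : Measure (ι → E d)).map e = ENNReal.ofReal c • volume := by
    have h1 : (volume : Measure (ι → E d)).map e =
        ((volume : Measure (ι → E d)).map (fun x i => a i • x i)).map
          (WithLp.toLp 2 : (ι → E d) → EPi ι d) := by
      have hsm : Measurable (fun (x : ι → E d) i => a i • x i) :=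
        measurable_pi_lambda _ fun i => (measurable_pi_apply i).const_smul (a i)
      rw [Measure.map_map volume_preserving_toLp.measurable hsm]
      rfl
    rw [h1, map_smul_pi ha, Measure.map_smul, volume_preserving_toLp.map_eq]
  have hvm := measurable_vec hX
  have hi := hf.hasFiniteEntropy_iff.1 hent
  obtain ⟨h1, h2⟩ := hf.integral_negMulLog_comp hvm e hc hmap hi
  refine ⟨_, hf.comp_measurableEquiv hvm e hc hmap, h1, ?_⟩
  rw [h2, hf.entropy_eq, Real.log_prod (fun i _ => (inv_pos.2 (pow_pos (ha i) d)).ne')]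
  simp only [Real.log_inv, Real.log_pow, Finset.sum_neg_distrib, Finset.mul_sum]
  ring

/-- A surjective linear map sends the Lebesgue measure to a (possibly infinite) multiple of the
Lebesgue measure, hence preserves absolute continuity. -/
lemma hasPDF_comp_of_surjective {A B : Type*} [NormedAddCommGroup A] [NormedSpace ℝ A]
    [FiniteDimensional ℝ A] [MeasureSpace A] [BorelSpace A]
    [(volume : Measure A).IsAddHaarMeasure] [NormedAddCommGroup B] [NormedSpace ℝ B]
    [FiniteDimensional ℝ B] [MeasureSpace B] [BorelSpace B]
    [(volume : Measure B).IsAddHaarMeasure]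
    {X : Ω → A} (hX : Measurable X) (hpdf : HasPDF X P) (L : A →ₗ[ℝ] B)
    (hL : Function.Surjective L) : HasPDF (fun ω => L (X ω)) P := by
  have hLm : Measurable L := (LinearMap.continuous_of_finiteDimensional L).measurable
  have hm : Measurable (fun ω => L (X ω)) := hLm.comp hX
  rw [hasPDF_iff_of_aemeasurable hm.aemeasurable]
  refine ⟨inferInstance, ?_⟩
  obtain ⟨c, -, hc⟩ := L.exists_map_addHaar_eq_smul_addHaar (volume : Measure A)
    (volume : Measure B) hL
  have h1 : P.map (fun ω => L (X ω)) = (P.map X).map L := (Measure.map_map hLm hX).symm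
  rw [h1]
  refine (hpdf.absolutelyContinuous.map hLm).trans ?_
  rw [hc]
  exact Measure.smul_absolutelyContinuous

end Blocks

section Others

variable {ι : Type*} [Fintype ι] [DecidableEq ι] {d : ℕ}
variable {Ω : Type*} [MeasurableSpace Ω] {P : Measure Ω} [IsProbabilityMeasure P]

lemma hasPDF_vec_others {X : ι → Ω → E d} (hX : ∀ i, Measurable (X i))
    (hpdf : HasPDF (vec X) P) (i : ι) : HasPDF (vec (others X i)) P := by
  refine hasPDF_comp_of_surjective (measurable_vec hX) hpdf
    (LinearMap.funLeft ℝ (E d) (Subtype.val : {j : ι // j ≠ i} → ι)) ?_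
  exact LinearMap.funLeft_surjective_of_injective _ _ _ Subtype.val_injective

lemma hasPDF_sum [Nonempty ι] {X : ι → Ω → E d} (hX : ∀ i, Measurable (X i))
    (hpdf : HasPDF (vec X) P) : HasPDF (fun ω => ∑ i, X i ω) P := by
  have h := hasPDF_comp_of_surjective (measurable_vec hX) hpdf
    (∑ i, (LinearMap.proj i : (ι → E d) →ₗ[ℝ] E d)) ?_
  · simpa [vec] using h
  · intro y
    obtain ⟨i⟩ := ‹Nonempty ι›
    exact ⟨Pi.single i y, by simp [LinearMap.sum_apply]⟩

lemma condEntropy_eq_sub {X : ι → Ω → E d} (hX : ∀ i, Measurable (X i))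
    (hpdf : HasPDF (vec X) P) (hent : HasFiniteEntropy P (vec X)) (i : ι) :
    condEntropy P (X i) (vec (others X i)) = entropy P (vec X) - entropy P (vec (others X i)) := by
  obtain ⟨f, hf⟩ := exists_isDensity hpdf
  set e : (ι → E d) ≃ᵐ E d × ({j : ι // j ≠ i} → E d) :=
    (MeasurableEquiv.piEquivPiSubtypeProd (fun _ : ι => E d) (fun j => j = i)).trans
      ((MeasurableEquiv.funUnique {j : ι // j = i} (E d)).prodCongr
        (MeasurableEquiv.refl ({j : ι // ¬ j = i} → E d))) with he
  -- the product measure is formed with a finiteness instance other than the one from uniqueness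
  have hfu : ∀ _ : Fintype {j : ι // j = i},
      MeasurePreserving (MeasurableEquiv.funUnique {j : ι // j = i} (E d))
        (Measure.pi fun _ => volume) volume := by
    intro inst
    obtain rfl : inst = Unique.fintype := Subsingleton.elim _ _
    exact measurePreserving_funUnique (volume : Measure (E d)) {j : ι // j = i}
  have h1 := (hfu (Subtype.fintype _)).prod
    (MeasurePreserving.id (Measure.pi fun _ : {j : ι // ¬ j = i} => (volume : Measure (E d))))
  have h2 := measurePreserving_piEquivPiSubtypeProd (fun _ : ι => (volume : Measure (E d)))
    (fun j => j = i)
  have hmp : MeasurePreserving e := h1.comp h2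
  have hmap : (volume : Measure (ι → E d)).map e = ENNReal.ofReal 1 • volume := by
    rw [hmp.map_eq]; simp
  have heq : (fun ω => (X i ω, vec (others X i) ω)) = fun ω => e (vec X ω) := by
    funext ω
    rfl
  have hvm := measurable_vec hX
  have h1 := hf.comp_measurableEquiv hvm e one_pos hmap
  have h2 := hf.integral_negMulLog_comp hvm e one_pos hmap (hf.hasFiniteEntropy_iff.1 hent)
  rw [condEntropy, heq, h1.entropy_eq, h2.2, hf.entropy_eq]
  simp

end Others

section GaussianVectors

variable {ι : Type*} [Fintype ι] {d : ℕ}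
variable {Ω : Type*} [MeasurableSpace Ω] {P : Measure Ω} [IsProbabilityMeasure P]

lemma map_toLp_vec_eq_stdGaussian {Z : ι → Ω → E d} (hZ : ∀ i, Measurable (Z i))
    (hZlaw : ∀ i, P.map (Z i) = stdGaussian (E d)) (hZindep : iIndepFun Z P) :
    P.map (fun ω => (WithLp.toLp 2 (vec Z ω) : EPi ι d)) = stdGaussian (EPi ι d) := by
  have hm := (volume_preserving_toLp (ι := ι) (d := d)).measurable
  have h1 : P.map (fun ω => (WithLp.toLp 2 (vec Z ω) : EPi ι d)) =
      (Measure.pi fun _ : ι => stdGaussian (E d)).map (WithLp.toLp 2) := by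
    have h2 := (iIndepFun_iff_map_fun_eq_pi_map fun i => (hZ i).aemeasurable).1 hZindep
    simp only [hZlaw] at h2
    rw [← h2, Measure.map_map hm (measurable_pi_lambda _ hZ)]
    rfl
  rw [h1]
  have : IsProbabilityMeasure ((Measure.pi fun _ : ι => stdGaussian (E d)).map
      (WithLp.toLp 2 : (ι → E d) → EPi ι d)) :=
    Measure.isProbabilityMeasure_map hm.aemeasurable
  refine Measure.ext_of_charFun (funext fun t => ?_)
  rw [charFun_pi, charFun_stdGaussian]
  simp only [charFun_stdGaussian]
  rw [← Complex.exp_sum]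
  congr 1
  rw [← Finset.sum_div, Finset.sum_neg_distrib]
  congr 2
  exact_mod_cast (PiLp.norm_sq_eq_of_L2 _ t).symm

lemma isGaussianPair_toLp {X Z : ι → Ω → E d} (hX : ∀ i, Measurable (X i))
    (hXmom : ∀ i, MemLp (X i) 2 P) (hZ : ∀ i, Measurable (Z i))
    (hZlaw : ∀ i, P.map (Z i) = stdGaussian (E d)) (hZindep : iIndepFun Z P)
    (hXZ : IndepFun (vec X) (vec Z) P) :
    IsGaussianPair P (fun ω => (WithLp.toLp 2 (vec X ω) : EPi ι d))
      (fun ω => (WithLp.toLp 2 (vec Z ω) : EPi ι d)) := by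
  have hm := (volume_preserving_toLp (ι := ι) (d := d)).measurable
  exact
    { measurable_left := hm.comp (measurable_vec hX)
      measurable_right := hm.comp (measurable_vec hZ)
      memLp_left := MemLp.of_eval_piLp hXmom
      law_right := map_toLp_vec_eq_stdGaussian hZ hZlaw hZindep
      indep := hXZ.comp hm hm }

omit [IsProbabilityMeasure P] in
/-- A linear image with isometric adjoint of a Gaussian pair is a Gaussian pair. -/
lemma IsGaussianPair.clm_comp {F F' : Type*} [NormedAddCommGroup F] [InnerProductSpace ℝ F]
    [FiniteDimensional ℝ F] [MeasurableSpace F] [BorelSpace F] [NormedAddCommGroup F']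
    [InnerProductSpace ℝ F'] [FiniteDimensional ℝ F'] [MeasurableSpace F'] [BorelSpace F']
    {V G : Ω → F} (h : IsGaussianPair P V G) (T : F →L[ℝ] F')
    (hT : ∀ y, ‖ContinuousLinearMap.adjoint T y‖ = ‖y‖) :
    IsGaussianPair P (fun ω => T (V ω)) (fun ω => T (G ω)) := by
  have hTm : Measurable T := T.continuous.measurable
  refine ⟨hTm.comp h.measurable_left, hTm.comp h.measurable_right, T.comp_memLp' h.memLp_left, ?_,
    h.indep.comp hTm hTm⟩
  have h1 : P.map (fun ω => T (G ω)) = (stdGaussian F).map T := by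
    rw [← h.law_right, Measure.map_map hTm h.measurable_right]; rfl
  rw [h1]
  have : IsProbabilityMeasure ((stdGaussian F).map T) :=
    Measure.isProbabilityMeasure_map hTm.aemeasurable
  refine Measure.ext_of_charFun (funext fun t => ?_)
  have h2 : charFun ((stdGaussian F).map T) t =
      charFun (stdGaussian F) (ContinuousLinearMap.adjoint T t) := by
    rw [charFun_apply, charFun_apply, integral_map hTm.aemeasurable (by fun_prop)]
    simp only [ContinuousLinearMap.adjoint_inner_right]
  rw [h2, charFun_stdGaussian, charFun_stdGaussian, hT]

end GaussianVectors

end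

section

/-! ### The Fisher information matrix of the flow in terms of the Euclidean score -/

section FisherTransfer

variable {ι : Type*} [Fintype ι] {d : ℕ}
variable {Ω : Type*} [MeasurableSpace Ω] {P : Measure Ω} [IsProbabilityMeasure P]
  {X Z : ι → Ω → E d}

/-- The random vector `(X_i)_i` as an element of the Euclidean space `(ℝ^d)^ι`. -/
def euc (X : ι → Ω → E d) (ω : Ω) : EPi ι d := WithLp.toLp 2 (vec X ω)

omit [MeasurableSpace Ω] in
lemma toLp_vec_ouFlow (s : ℝ) (ω : Ω) :
    (WithLp.toLp 2 (vec (ouFlow X Z s) ω) : EPi ι d) = ouVec (euc X) (euc Z) s ω := rfl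

/-- The density of the flow at time `s`, as a function on the product space. -/
def ouDensity (P : Measure Ω) (X : ι → Ω → E d) (s : ℝ) (x : ι → E d) : ℝ :=
  heat (P.map (fun ω => Real.exp (-s) • euc X ω)) (1 - Real.exp (-2 * s)) (WithLp.toLp 2 x)

/-- The gradient of the density of the flow at time `s`. -/
def ouGrad (P : Measure Ω) (X : ι → Ω → E d) (s : ℝ) (x : EPi ι d) : EPi ι d :=
  heatGrad (P.map (fun ω => Real.exp (-s) • euc X ω)) (1 - Real.exp (-2 * s)) x

lemma isProbabilityMeasure_map_smul (h : IsGaussianPair P (euc X) (euc Z)) (s : ℝ) :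
    IsProbabilityMeasure (P.map (fun ω => Real.exp (-s) • euc X ω)) :=
  Measure.isProbabilityMeasure_map (h.measurable_smul_left _).aemeasurable

lemma isC1Density_ouFlow (h : IsGaussianPair P (euc X) (euc Z)) {s : ℝ} (hs : 0 < s) :
    IsC1Density P (ouFlow X Z s) (ouDensity P X s) := by
  have := isProbabilityMeasure_map_smul h s
  have hτ := one_sub_exp_pos hs
  set ν := P.map (fun ω => Real.exp (-s) • euc X ω) with hν
  set τ := 1 - Real.exp (-2 * s)
  have hD : IsDensity P (ouVec (euc X) (euc Z) s) (heat ν τ) :=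
    ⟨(continuous_heat ν hτ).measurable, fun x => (heat_pos ν hτ x).le,
      map_gaussian_perturbation (h.measurable_smul_left _) h.measurable_right h.law_right
        (h.indep_smul_left _) hτ⟩
  have hmap : (volume : Measure (EPi ι d)).map (MeasurableEquiv.toLp 2 (ι → E d)).symm =
      ENNReal.ofReal 1 • volume := by
    have h1 := (volume_preserving_toLp (ι := ι) (d := d)).symm (MeasurableEquiv.toLp 2 (ι → E d))
    rw [h1.map_eq]; simp
  have h2 := (hD.comp_measurableEquiv (h.measurable_ouVec s)
    (MeasurableEquiv.toLp 2 (ι → E d)).symm one_pos hmap).map_eq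
  refine ⟨(contDiff_heat ν hτ).comp PiLp.contDiff_toLp, fun x => (heat_pos ν hτ _).le, ?_⟩
  simp only [one_mul] at h2
  exact h2

lemma c1Density_ouFlow (h : IsGaussianPair P (euc X) (euc Z)) {s : ℝ} (hs : 0 < s) :
    c1Density P (ouFlow X Z s) = ouDensity P X s := by
  have hex : ∃ p, IsC1Density P (ouFlow X Z s) p := ⟨_, isC1Density_ouFlow h hs⟩
  rw [c1Density, dif_pos hex]
  exact isC1Density_unique hex.choose_spec (isC1Density_ouFlow h hs)

variable [DecidableEq ι]

lemma partialGrad_ouDensity (h : IsGaussianPair P (euc X) (euc Z)) {s : ℝ} (hs : 0 < s)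
    (i : ι) (x : ι → E d) :
    partialGrad (ouDensity P X s) i x = ouGrad P X s (WithLp.toLp 2 x) i := by
  have := isProbabilityMeasure_map_smul h s
  have hτ := one_sub_exp_pos hs
  set ν := P.map (fun ω => Real.exp (-s) • euc X ω) with hν
  set τ := 1 - Real.exp (-2 * s) with hτd
  have h1 := hasFDerivAt_heat ν hτ (WithLp.toLp 2 (Function.update x i (x i)) : EPi ι d)
  have h2 := (PiLp.hasFDerivAt_toLp (𝕜 := ℝ) 2 (Function.update x i (x i))).comp (x i)
    (hasFDerivAt_update (𝕜 := ℝ) x (x i))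
  have h3 := h1.comp (x i) h2
  rw [partialGrad]
  refine HasGradientAt.gradient ?_
  rw [hasGradientAt_iff_hasFDerivAt]
  refine h3.congr_fderiv ?_
  ext v
  simp only [Function.update_eq_self]
  simp only [ContinuousLinearMap.comp_apply, InnerProductSpace.toDual_apply_apply,
    innerSL_apply_apply, PiLp.inner_apply]
  rw [Finset.sum_eq_single i]
  · simp [ouGrad, hν, hτd]
  · intro j _ hj
    simp [hj]
  · simp

lemma score_ouFlow (h : IsGaussianPair P (euc X) (euc Z)) {s : ℝ} (hs : 0 < s)
    (i : ι) (ω : Ω) :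
    score P (ouFlow X Z s) i (vec (ouFlow X Z s) ω) =
      ouScore P (euc X) s (ouVec (euc X) (euc Z) s ω) i := by
  rw [score, c1Density_ouFlow h hs, partialGrad_ouDensity h hs, toLp_vec_ouFlow]
  rfl

lemma fisherEntry_ouFlow (h : IsGaussianPair P (euc X) (euc Z)) {s : ℝ} (hs : 0 < s) (i j : ι) :
    fisherEntry P (ouFlow X Z s) i j =
      ∫ ω, ⟪ouScore P (euc X) s (ouVec (euc X) (euc Z) s ω) i,
        ouScore P (euc X) s (ouVec (euc X) (euc Z) s ω) j⟫ ∂P := by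
  simp only [fisherEntry, score_ouFlow h hs]

lemma fisherDensity_ouFlow (h : IsGaussianPair P (euc X) (euc Z)) {s : ℝ} (hs : 0 < s) :
    fisherDensity P (ouFlow X Z s) = fun x : ι → E d =>
      ‖ouGrad P X s (WithLp.toLp 2 x)‖ ^ 2 /
        heat (P.map (fun ω => Real.exp (-s) • euc X ω)) (1 - Real.exp (-2 * s))
          (WithLp.toLp 2 x) := by
  funext x
  simp only [fisherDensity, c1Density_ouFlow h hs, partialGrad_ouDensity h hs,
    PiLp.norm_sq_eq_of_L2]
  rfl

lemma hasFiniteFisherInfo_ouFlow (h : IsGaussianPair P (euc X) (euc Z)) {s : ℝ} (hs : 0 < s) :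
    HasFiniteFisherInfo P (ouFlow X Z s) := by
  have := isProbabilityMeasure_map_smul h s
  refine ⟨⟨_, isC1Density_ouFlow h hs⟩, ?_⟩
  rw [fisherDensity_ouFlow h hs]
  exact (volume_preserving_toLp.integrable_comp_emb
    (MeasurableEquiv.toLp 2 (ι → E d)).measurableEmbedding).2
    (integrable_heatGrad_sq_div_heat (P.map (fun ω => Real.exp (-s) • euc X ω))
      (one_sub_exp_pos hs))

lemma fisherInfo_ouFlow (h : IsGaussianPair P (euc X) (euc Z)) {s : ℝ} (hs : 0 < s) :
    fisherInfo P (ouFlow X Z s) =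
      ∫ ω, ‖ouScore P (euc X) s (ouVec (euc X) (euc Z) s ω)‖ ^ 2 ∂P := by
  have h1 : ∫ ω, ‖ouScore P (euc X) s (ouVec (euc X) (euc Z) s ω)‖ ^ 2 ∂P =
      heatFisher (P.map (fun ω => Real.exp (-s) • euc X ω)) (1 - Real.exp (-2 * s)) :=
    integral_norm_heatScore_sq (h.measurable_smul_left _) h.measurable_right h.law_right
      (h.indep_smul_left _) (one_sub_exp_pos hs)
  rw [h1, fisherInfo, fisherDensity_ouFlow h hs, heatFisher]
  exact volume_preserving_toLp.integral_comp
    (MeasurableEquiv.toLp 2 (ι → E d)).measurableEmbedding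
    (fun y => ‖heatGrad (P.map (fun ω => Real.exp (-s) • euc X ω)) (1 - Real.exp (-2 * s)) y‖ ^ 2 /
      heat (P.map (fun ω => Real.exp (-s) • euc X ω)) (1 - Real.exp (-2 * s)) y)

end FisherTransfer

end

section

variable {F : Type*} [NormedAddCommGroup F] [InnerProductSpace ℝ F] [FiniteDimensional ℝ F]
  [MeasurableSpace F] [BorelSpace F]
variable {Ω : Type*} [MeasurableSpace Ω] {P : Measure Ω} [IsProbabilityMeasure P] {V G : Ω → F}

/-! ### Linear images of the relative score -/

/-- Joint measurability of the score in time and space. The law convolved with the Gaussian kernel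
depends on the time, so the convolutions are written as integrals over the probability space. -/
lemma measurable_ouScore_uncurry (hV : Measurable V) :
    Measurable (fun p : ℝ × F => ouScore P V p.1 p.2) := by
  have hcV : ∀ s : ℝ, Measurable (fun ω => Real.exp (-s) • V ω) := fun s => hV.const_smul _
  have hK : Measurable (fun q : (ℝ × F) × Ω =>
      gaussKernel (1 - Real.exp (-2 * q.1.1)) (q.1.2 - Real.exp (-q.1.1) • V q.2)) :=
    measurable_gaussKernel_uncurry.comp
      (f := fun q : (ℝ × F) × Ω => (1 - Real.exp (-2 * q.1.1), q.1.2 - Real.exp (-q.1.1) • V q.2))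
      (by fun_prop)
  have hK' : Measurable (fun q : (ℝ × F) × Ω =>
      gaussKernelGrad (1 - Real.exp (-2 * q.1.1)) (q.1.2 - Real.exp (-q.1.1) • V q.2)) := by
    unfold gaussKernelGrad
    exact ((hK.div (by fun_prop)).smul (by fun_prop)).neg
  have h1 : (fun p : ℝ × F => heat (P.map (fun ω => Real.exp (-p.1) • V ω))
      (1 - Real.exp (-2 * p.1)) p.2) = fun p : ℝ × F =>
        ∫ ω, gaussKernel (1 - Real.exp (-2 * p.1)) (p.2 - Real.exp (-p.1) • V ω) ∂P := by
    funext p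
    rw [heat, integral_map (hcV _).aemeasurable]
    exact ((continuous_gaussKernel _).comp (by fun_prop)).aestronglyMeasurable
  have h2 : (fun p : ℝ × F => heatGrad (P.map (fun ω => Real.exp (-p.1) • V ω))
      (1 - Real.exp (-2 * p.1)) p.2) = fun p : ℝ × F =>
        ∫ ω, gaussKernelGrad (1 - Real.exp (-2 * p.1)) (p.2 - Real.exp (-p.1) • V ω) ∂P := by
    funext p
    rw [heatGrad, integral_map (hcV _).aemeasurable]
    exact ((continuous_gaussKernelGrad _).comp (by fun_prop)).aestronglyMeasurable
  have m1 := hK.stronglyMeasurable.integral_prod_right' (ν := P)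
  have m2 := hK'.stronglyMeasurable.integral_prod_right' (ν := P)
  rw [← h1] at m1
  rw [← h2] at m2
  exact (m1.measurable.inv.smul m2.measurable).neg

namespace IsGaussianPair

lemma stronglyMeasurable_integral_norm_clm_relScore (h : IsGaussianPair P V G) {F' : Type*}
    [NormedAddCommGroup F'] [InnerProductSpace ℝ F'] [FiniteDimensional ℝ F'] [MeasurableSpace F']
    [BorelSpace F'] (T : F →L[ℝ] F') :
    StronglyMeasurable (fun s => ∫ ω, ‖T (relScore P V G s ω)‖ ^ 2 ∂P) := by
  have hV := h.measurable_left
  have hG := h.measurable_right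
  have hY : Measurable (fun p : ℝ × Ω => ouVec V G p.1 p.2) := by
    unfold ouVec
    fun_prop
  have hρ : Measurable (fun p : ℝ × Ω => ouScore P V p.1 (ouVec V G p.1 p.2)) :=
    (measurable_ouScore_uncurry hV).comp (measurable_fst.prodMk hY)
  have hr : Measurable (fun p : ℝ × Ω => ‖T (relScore P V G p.1 p.2)‖ ^ 2) :=
    (T.continuous.measurable.comp (hρ.sub hY)).norm.pow_const 2
  exact hr.stronglyMeasurable.integral_prod_right'

lemma integrableOn_integral_norm_clm_relScore (h : IsGaussianPair P V G) {F' : Type*}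
    [NormedAddCommGroup F'] [InnerProductSpace ℝ F'] [FiniteDimensional ℝ F'] [MeasurableSpace F']
    [BorelSpace F'] (T : F →L[ℝ] F')
    (hr : IntegrableOn (fun s => ∫ ω, ‖relScore P V G s ω‖ ^ 2 ∂P) (Ioi 0)) :
    IntegrableOn (fun s => ∫ ω, ‖T (relScore P V G s ω)‖ ^ 2 ∂P) (Ioi 0) := by
  refine Integrable.mono' (hr.const_mul (‖T‖ ^ 2))
    (h.stronglyMeasurable_integral_norm_clm_relScore T).aestronglyMeasurable
    ((ae_restrict_mem measurableSet_Ioi).mono fun s hs => ?_)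
  rw [Real.norm_of_nonneg (integral_nonneg fun _ => by positivity), ← integral_const_mul]
  refine integral_mono (T.comp_memLp' (h.memLp_relScore hs)).integrable_norm_pow'
    ((h.memLp_relScore hs).integrable_norm_pow'.const_mul _) fun ω => ?_
  rw [← mul_pow]
  exact pow_le_pow_left₀ (norm_nonneg _) (T.le_opNorm _) 2

/-- The mean square of a linear image of the score, in terms of the relative score. -/
lemma integral_norm_clm_ouScore_sq (h : IsGaussianPair P V G) {F' : Type*}
    [NormedAddCommGroup F'] [InnerProductSpace ℝ F'] [FiniteDimensional ℝ F']
    (T : F →L[ℝ] F') {s : ℝ} (hs : 0 < s) :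
    ∫ ω, ‖T (ouScore P V s (ouVec V G s ω))‖ ^ 2 ∂P =
      ∫ ω, ‖T (relScore P V G s ω)‖ ^ 2 ∂P + ∫ ω, ‖T (G ω)‖ ^ 2 ∂P +
        Real.exp (-2 * s) * (∫ ω, ‖T (G ω)‖ ^ 2 ∂P - ∫ ω, ‖T (V ω)‖ ^ 2 ∂P) := by
  set L := (ContinuousLinearMap.adjoint T).comp T with hL
  have e : ∀ x, ⟪L x, x⟫ = ‖T x‖ ^ 2 := fun x => by
    rw [hL, ContinuousLinearMap.comp_apply, ContinuousLinearMap.adjoint_inner_left,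
      real_inner_self_eq_norm_sq]
  have h1 := h.integral_inner_clm_relScore L hs
  have h2 := h.integral_inner_clm_ouVec_ouVec L hs
  simp only [e] at h1 h2
  rw [h1, h2]; ring

/-- The score of a linear image with isometric adjoint of the flow is smaller in mean square than
the linear image of the score. -/
lemma integral_norm_ouScore_comp_le {F' : Type*} [NormedAddCommGroup F']
    [InnerProductSpace ℝ F'] [FiniteDimensional ℝ F'] [MeasurableSpace F'] [BorelSpace F']
    (h : IsGaussianPair P V G) (T : F →L[ℝ] F')
    (h' : IsGaussianPair P (fun ω => T (V ω)) (fun ω => T (G ω))) {s : ℝ} (hs : 0 < s) :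
    ∫ ω, ‖ouScore P (fun ω => T (V ω)) s (ouVec (fun ω => T (V ω)) (fun ω => T (G ω)) s ω)‖ ^ 2 ∂P
      ≤ ∫ ω, ‖T (ouScore P V s (ouVec V G s ω))‖ ^ 2 ∂P := by
  have h1 := h.integral_norm_clm_ouScore_sq T hs
  have h2 := h'.integral_norm_clm_ouScore_sq (ContinuousLinearMap.id ℝ F') hs
  simp only [ContinuousLinearMap.id_apply] at h2
  rw [h1, h2]
  linarith [h.integral_norm_relScore_comp_le T h' hs]

/-- The integrated form of `integral_norm_relScore_comp_le`: the left-hand side is the relative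
entropy of the image. -/
lemma integral_norm_relScore_comp_le_integral {F' : Type*} [NormedAddCommGroup F']
    [InnerProductSpace ℝ F'] [FiniteDimensional ℝ F'] [MeasurableSpace F'] [BorelSpace F']
    (h : IsGaussianPair P V G) (T : F →L[ℝ] F')
    (h' : IsGaussianPair P (fun ω => T (V ω)) (fun ω => T (G ω)))
    (hr : IntegrableOn (fun s => ∫ ω, ‖relScore P V G s ω‖ ^ 2 ∂P) (Ioi 0))
    (hr' : IntegrableOn (fun s => ∫ ω, ‖relScore P (fun ω => T (V ω)) (fun ω => T (G ω)) s ω‖ ^ 2 ∂P)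
      (Ioi 0)) :
    ∫ s in Ioi (0 : ℝ), ∫ ω, ‖relScore P (fun ω => T (V ω)) (fun ω => T (G ω)) s ω‖ ^ 2 ∂P ≤
      ∫ s in Ioi (0 : ℝ), ∫ ω, ‖T (relScore P V G s ω)‖ ^ 2 ∂P :=
  setIntegral_mono_on hr' (h.integrableOn_integral_norm_clm_relScore T hr) measurableSet_Ioi
    fun _ hs => h.integral_norm_relScore_comp_le T h' hs

end IsGaussianPair

end

section

/-! ### The Fisher information defect along the flow -/

section Projections

variable {ι : Type*} [Fintype ι] {d : ℕ}

/-- The weighted sum `x ↦ ∑ i, λ_i x_i` of the blocks. -/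
def weightedSum (lam : ι → ℝ) : EPi ι d →L[ℝ] E d :=
  ∑ i, lam i • PiLp.proj 2 (fun _ : ι => E d) i

lemma weightedSum_apply (lam : ι → ℝ) (x : EPi ι d) :
    weightedSum lam x = ∑ i, lam i • x i := by
  simp [weightedSum]

lemma norm_adjoint_weightedSum {lam : ι → ℝ} (hlam : ∑ i, lam i ^ 2 = 1) (y : E d) :
    ‖ContinuousLinearMap.adjoint (weightedSum lam : EPi ι d →L[ℝ] E d) y‖ = ‖y‖ := by
  have h1 : ContinuousLinearMap.adjoint (weightedSum lam : EPi ι d →L[ℝ] E d) y =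
      WithLp.toLp 2 fun i => lam i • y := by
    refine ext_inner_left ℝ fun x => ?_
    rw [ContinuousLinearMap.adjoint_inner_right, weightedSum_apply, sum_inner, PiLp.inner_apply]
    simp only [inner_smul_left, inner_smul_right, conj_trivial]
  rw [h1, ← sq_eq_sq₀ (norm_nonneg _) (norm_nonneg _), PiLp.norm_sq_eq_of_L2]
  simp only [norm_smul, mul_pow, Real.norm_eq_abs, sq_abs]
  rw [← Finset.sum_mul, hlam, one_mul]

lemma norm_weightedSum_sq (lam : ι → ℝ) (x : EPi ι d) :
    ‖weightedSum lam x‖ ^ 2 = ∑ i, ∑ j, lam i * lam j * ⟪x i, x j⟫ := by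
  rw [← real_inner_self_eq_norm_sq, weightedSum_apply, sum_inner]
  simp only [inner_sum, inner_smul_left, inner_smul_right, conj_trivial]
  exact Finset.sum_congr rfl fun i _ => Finset.sum_congr rfl fun j _ => by ring

variable [DecidableEq ι]

/-- The projection forgetting the `i`-th block. -/
def dropBlock (i : ι) : EPi ι d →L[ℝ] EPi {j : ι // j ≠ i} d :=
  ((PiLp.continuousLinearEquiv 2 ℝ (fun _ : {j : ι // j ≠ i} => E d)).symm :
    ({j : ι // j ≠ i} → E d) →L[ℝ] EPi {j : ι // j ≠ i} d).comp
    (ContinuousLinearMap.pi fun j => PiLp.proj 2 (fun _ : ι => E d) (j : ι))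

omit [DecidableEq ι] in
lemma sum_subtype_ne_eq_sub {i : ι} [Fintype {j : ι // j ≠ i}] (g : ι → ℝ) :
    ∑ j : {j : ι // j ≠ i}, g j = ∑ j, g j - g i := by
  classical
  have h1 : ∑ j : {j : ι // j ≠ i}, g j = ∑ j ∈ Finset.univ.erase i, g j :=
    (Finset.sum_subtype (Finset.univ.erase i) (by simp) g).symm
  rw [h1, ← Finset.add_sum_erase Finset.univ g (Finset.mem_univ i), add_sub_cancel_left]

lemma norm_dropBlock_sq (i : ι) (x : EPi ι d) :
    ‖dropBlock i x‖ ^ 2 = ∑ j, ‖x j‖ ^ 2 - ‖x i‖ ^ 2 := by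
  rw [PiLp.norm_sq_eq_of_L2, ← sum_subtype_ne_eq_sub (fun j => ‖x j‖ ^ 2)]
  rfl

lemma finrank_ePi_ne (i : ι) :
    (finrank ℝ (EPi {j : ι // j ≠ i} d) : ℝ) = (Fintype.card ι - 1) * d := by
  have h1 := sum_subtype_ne_eq_sub (i := i) (fun _ : ι => (1 : ℝ))
  rw [finrank_ePi, Nat.cast_mul]
  congr 1
  simpa only [Finset.sum_const, Finset.card_univ, nsmul_eq_mul, mul_one] using h1

end Projections

section Defect

variable {Ω : Type*} [MeasurableSpace Ω] {P : Measure Ω} [IsProbabilityMeasure P] {n d : ℕ}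
  {X Z : Fin n → Ω → E d}

lemma integrable_inner_ouScore (h : IsGaussianPair P (euc X) (euc Z)) {s : ℝ} (hs : 0 < s)
    (i j : Fin n) :
    Integrable (fun ω => ⟪ouScore P (euc X) s (ouVec (euc X) (euc Z) s ω) i,
      ouScore P (euc X) s (ouVec (euc X) (euc Z) s ω) j⟫) P := by
  have hρ := memLp_piLp_iff.1 (h.memLp_ouScore hs)
  exact integrable_inner_of_memLp (hρ i) (hρ j)

lemma sum_sum_fisherEntry (h : IsGaussianPair P (euc X) (euc Z)) {s : ℝ} (hs : 0 < s)
    (lam : Fin n → ℝ) :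
    ∑ i, ∑ j, lam i * lam j * fisherEntry P (ouFlow X Z s) i j =
      ∫ ω, ‖weightedSum lam (ouScore P (euc X) s (ouVec (euc X) (euc Z) s ω))‖ ^ 2 ∂P := by
  have hi := integrable_inner_ouScore h hs
  simp only [norm_weightedSum_sq, fisherEntry_ouFlow h hs]
  rw [integral_finsetSum _ fun i _ => integrable_finsetSum _ fun j _ => (hi i j).const_mul _]
  refine Finset.sum_congr rfl fun i _ => ?_
  rw [integral_finsetSum _ fun j _ => (hi i j).const_mul _]
  simp only [integral_const_mul]

lemma fisherEntry_self (h : IsGaussianPair P (euc X) (euc Z)) {s : ℝ} (hs : 0 < s) (i : Fin n) :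
    fisherEntry P (ouFlow X Z s) i i =
      ∫ ω, ‖ouScore P (euc X) s (ouVec (euc X) (euc Z) s ω) i‖ ^ 2 ∂P := by
  simp only [fisherEntry_ouFlow h hs, real_inner_self_eq_norm_sq]

lemma integrable_norm_sq_ouScore_apply (h : IsGaussianPair P (euc X) (euc Z)) {s : ℝ}
    (hs : 0 < s) (i : Fin n) :
    Integrable (fun ω => ‖ouScore P (euc X) s (ouVec (euc X) (euc Z) s ω) i‖ ^ 2) P := by
  simpa only [real_inner_self_eq_norm_sq] using integrable_inner_ouScore h hs i i

lemma sum_fisherEntry_self (h : IsGaussianPair P (euc X) (euc Z)) {s : ℝ} (hs : 0 < s) :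
    ∑ i, fisherEntry P (ouFlow X Z s) i i =
      ∫ ω, ‖ouScore P (euc X) s (ouVec (euc X) (euc Z) s ω)‖ ^ 2 ∂P := by
  have e : ∀ x : EPi (Fin n) d, ‖x‖ ^ 2 = ∑ i, ‖x i‖ ^ 2 := PiLp.norm_sq_eq_of_L2 _
  simp only [e, fisherEntry_self h hs]
  rw [integral_finsetSum _ fun i _ => integrable_norm_sq_ouScore_apply h hs i]

/-- The Fisher information defect is the corresponding combination of relative Fisher informations,
up to a term of known integral: the contributions of the Gaussian vectors cancel since the squares
of the weights sum to one. -/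
lemma fisherDefect_ouFlow (h : IsGaussianPair P (euc X) (euc Z))
    (h' : ∀ i, IsGaussianPair P (euc (others X i)) (euc (others Z i)))
    {lam : Fin n → ℝ} (hlam : ∑ i, lam i ^ 2 = 1) {s : ℝ} (hs : 0 < s) :
    fisherDefect P lam (ouFlow X Z s) =
      ∫ ω, ‖weightedSum lam (relScore P (euc X) (euc Z) s ω)‖ ^ 2 ∂P -
        ∫ ω, ‖relScore P (euc X) (euc Z) s ω‖ ^ 2 ∂P +
        ∑ i, lam i ^ 2 * ∫ ω, ‖relScore P (euc (others X i)) (euc (others Z i)) s ω‖ ^ 2 ∂P -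
        Real.exp (-2 * s) * (∫ ω, ‖weightedSum lam (euc X ω)‖ ^ 2 ∂P - ∫ ω, ‖euc X ω‖ ^ 2 ∂P +
          ∑ i, lam i ^ 2 * ∫ ω, ‖euc (others X i) ω‖ ^ 2 ∂P) := by
  have hS := h.clm_comp (weightedSum lam) (norm_adjoint_weightedSum hlam)
  have e1 := h.integral_norm_clm_ouScore_sq (weightedSum lam) hs
  have e2 := h.integral_norm_relScore_sq hs
  have e3 : ∀ i, fisherInfo P (others (ouFlow X Z s) i) =
      ∫ ω, ‖relScore P (euc (others X i)) (euc (others Z i)) s ω‖ ^ 2 ∂P + (n - 1) * d +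
        Real.exp (-2 * s) * ((n - 1) * d - ∫ ω, ‖euc (others X i) ω‖ ^ 2 ∂P) := by
    intro i
    have e4 : fisherInfo P (others (ouFlow X Z s) i) = _ := fisherInfo_ouFlow (h' i) hs
    have e5 := (h' i).integral_norm_relScore_sq hs
    rw [finrank_ePi_ne, Fintype.card_fin] at e5
    rw [e4, e5]; ring
  rw [hS.integral_norm_sq_right, finrank_euclideanSpace_fin] at e1
  rw [finrank_ePi, Fintype.card_fin, Nat.cast_mul] at e2
  rw [fisherDefect, sum_sum_fisherEntry h hs, sum_fisherEntry_self h hs, e1]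
  have e6 : ∀ (a b : Fin n → ℝ) (c ε : ℝ), ∑ i, lam i ^ 2 * (a i + c + ε * (c - b i)) =
      ∑ i, lam i ^ 2 * a i + c + ε * (c - ∑ i, lam i ^ 2 * b i) := by
    intro a b c ε
    calc ∑ i, lam i ^ 2 * (a i + c + ε * (c - b i))
        = ∑ i, (lam i ^ 2 * a i + lam i ^ 2 * (c + ε * c) - ε * (lam i ^ 2 * b i)) :=
          Finset.sum_congr rfl fun i _ => by ring
      _ = ∑ i, lam i ^ 2 * a i + c + ε * (c - ∑ i, lam i ^ 2 * b i) := by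
          rw [Finset.sum_sub_distrib, Finset.sum_add_distrib, ← Finset.sum_mul, hlam,
            ← Finset.mul_sum]
          ring
  simp only [e3]
  rw [e6]
  linear_combination e2

/-- With nonpositive off-diagonal Fisher information, the defect is nonpositive, since the Fisher
information of a subvector is at most the corresponding partial trace of the full matrix. -/
lemma fisherDefect_ouFlow_nonpos (h : IsGaussianPair P (euc X) (euc Z))
    (h' : ∀ i, IsGaussianPair P (euc (others X i)) (euc (others Z i)))
    {lam : Fin n → ℝ} (hpos : ∀ i, 0 < lam i) (hlam : ∑ i, lam i ^ 2 = 1) {s : ℝ} (hs : 0 < s)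
    (hoff : ∀ i j, i ≠ j → fisherEntry P (ouFlow X Z s) i j ≤ 0) :
    fisherDefect P lam (ouFlow X Z s) ≤ 0 := by
  set I := fisherEntry P (ouFlow X Z s) with hI
  have h1 : ∑ i, ∑ j, lam i * lam j * I i j ≤ ∑ i, lam i ^ 2 * I i i := by
    refine Finset.sum_le_sum fun i _ => ?_
    rw [← Finset.add_sum_erase Finset.univ _ (Finset.mem_univ i)]
    have : ∑ j ∈ Finset.univ.erase i, lam i * lam j * I i j ≤ 0 :=
      Finset.sum_nonpos fun j hj => mul_nonpos_of_nonneg_of_nonpos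
        (mul_nonneg (hpos i).le (hpos j).le) (hoff i j (Finset.ne_of_mem_erase hj).symm)
    nlinarith
  have h2 : ∀ i, fisherInfo P (others (ouFlow X Z s) i) ≤ ∑ j, I j j - I i i := by
    intro i
    have e4 : fisherInfo P (others (ouFlow X Z s) i) = _ := fisherInfo_ouFlow (h' i) hs
    rw [e4]
    refine (h.integral_norm_ouScore_comp_le (dropBlock i) (h' i) hs).trans_eq ?_
    simp only [norm_dropBlock_sq, hI, fisherEntry_self h hs]
    rw [integral_sub (integrable_finsetSum _ fun j _ => integrable_norm_sq_ouScore_apply h hs j)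
      (integrable_norm_sq_ouScore_apply h hs i),
      integral_finsetSum _ fun j _ => integrable_norm_sq_ouScore_apply h hs j]
  have h3 : ∑ i, lam i ^ 2 * fisherInfo P (others (ouFlow X Z s) i) ≤
      ∑ i, lam i ^ 2 * (∑ j, I j j - I i i) :=
    Finset.sum_le_sum fun i _ => mul_le_mul_of_nonneg_left (h2 i) (sq_nonneg _)
  simp only [mul_sub, Finset.sum_sub_distrib] at h3
  rw [← Finset.sum_mul, hlam, one_mul] at h3
  rw [fisherDefect]
  linarith

end Defect

end

section

/-! ### The entropy inequality for an arbitrary choice of weights -/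

section Weighted

variable {Ω : Type*} [MeasurableSpace Ω] {P : Measure Ω} [IsProbabilityMeasure P] {n d : ℕ}
  {X Z : Fin n → Ω → E d}

lemma isGaussianPair_others (hX : ∀ i, Measurable (X i)) (hXmom : ∀ i, MemLp (X i) 2 P)
    (hZ : ∀ i, Measurable (Z i)) (hZlaw : ∀ i, P.map (Z i) = stdGaussian (E d))
    (hZindep : iIndepFun Z P) (hXZ : IndepFun (vec X) (vec Z) P) (i : Fin n) :
    IsGaussianPair P (euc (others X i)) (euc (others Z i)) := by
  have hm : Measurable (fun (x : Fin n → E d) (j : {j : Fin n // j ≠ i}) => x j) :=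
    measurable_pi_lambda _ fun j => measurable_pi_apply _
  exact isGaussianPair_toLp (fun j => hX j) (fun j => hXmom j) (fun j => hZ j)
    (fun j => hZlaw j)
    (hZindep.precomp (g := (Subtype.val : {j : Fin n // j ≠ i} → Fin n)) Subtype.val_injective)
    (hXZ.comp hm hm)

/-- Integrating the Fisher information defect of the rescaled vectors `X_i / λ_i`: the relative
Fisher informations integrate to relative entropies, and the relative entropy of the sum is
controlled by data processing. -/
theorem le_integral_fisherDefect (hn : 1 ≤ n) (hX : ∀ i, Measurable (X i))
    (hXpdf : HasPDF (vec X) P)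
    (hXent : HasFiniteEntropy P (vec X))
    (hXent' : ∀ i, HasFiniteEntropy P (vec (others X i)))
    (hSent : HasFiniteEntropy P (fun ω => ∑ i, X i ω)) {lam : Fin n → ℝ}
    (hpos : ∀ i, 0 < lam i) (hlam : ∑ i, lam i ^ 2 = 1)
    (h : IsGaussianPair P (euc fun i ω => (lam i)⁻¹ • X i ω) (euc Z))
    (h' : ∀ i, IsGaussianPair P (euc (others (fun i ω => (lam i)⁻¹ • X i ω) i))
      (euc (others Z i))) :
    IntegrableOn (fun s => fisherDefect P lam (ouFlow (fun i ω => (lam i)⁻¹ • X i ω) Z s))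
        (Ioi 0) ∧
      -entropy P (fun ω => ∑ i, X i ω) +
          ∑ i, lam i ^ 2 * (condEntropy P (X i) (vec (others X i)) - d * Real.log (lam i)) ≤
        ∫ s in Ioi (0 : ℝ), fisherDefect P lam (ouFlow (fun i ω => (lam i)⁻¹ • X i ω) Z s) := by
  set Y : Fin n → Ω → E d := fun i ω => (lam i)⁻¹ • X i ω with hY
  have : Nonempty (Fin n) := ⟨⟨0, hn⟩⟩
  have hS := h.clm_comp (weightedSum lam) (norm_adjoint_weightedSum hlam)
  have hsum : ∀ ω, weightedSum lam (euc Y ω) = ∑ i, X i ω := by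
    intro ω
    rw [weightedSum_apply]
    refine Finset.sum_congr rfl fun i _ => ?_
    exact smul_inv_smul₀ (hpos i).ne' (X i ω)
  -- densities and relative entropies of the full vector, of the subvectors and of the sum
  obtain ⟨f, hf, hfi, hfe⟩ := exists_isDensity_toLp_smul hX hXpdf hXent
    fun i => inv_pos.2 (hpos i)
  obtain ⟨iV, eV⟩ := integral_relScore_eq_relEntropy h hf.measurable hf.nonneg hf.map_eq hfi
  have hoth := fun i => exists_isDensity_toLp_smul (X := others X i) (fun j => hX j)
    (hasPDF_vec_others hX hXpdf i) (hXent' i) (a := fun j => (lam j)⁻¹)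
    fun j => inv_pos.2 (hpos j)
  choose g hg hgi hge using hoth
  have hrel := fun i => integral_relScore_eq_relEntropy (h' i) (hg i).measurable (hg i).nonneg
    (hg i).map_eq (hgi i)
  obtain ⟨q, hq⟩ := exists_isDensity (hasPDF_sum hX hXpdf)
  have hqi := hq.hasFiniteEntropy_iff.1 hSent
  have hqmap : P.map (fun ω => weightedSum lam (euc Y ω)) =
      volume.withDensity fun x => ENNReal.ofReal (q x) := by
    simp only [hsum]; exact hq.map_eq
  obtain ⟨iS, eS⟩ := integral_relScore_eq_relEntropy hS hq.measurable hq.nonneg hqmap hqi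
  have iT := h.integrableOn_integral_norm_clm_relScore (weightedSum lam) iV
  have hdp := h.integral_norm_relScore_comp_le_integral (weightedSum lam) hS iV iS
  -- the integral of the defect
  set κ : ℝ := ∫ ω, ‖weightedSum lam (euc Y ω)‖ ^ 2 ∂P - ∫ ω, ‖euc Y ω‖ ^ 2 ∂P +
    ∑ i, lam i ^ 2 * ∫ ω, ‖euc (others Y i) ω‖ ^ 2 ∂P with hκ
  set R : ℝ → ℝ := fun s => ∑ i, lam i ^ 2 *
    ∫ ω, ‖relScore P (euc (others Y i)) (euc (others Z i)) s ω‖ ^ 2 ∂P with hR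
  have iR : IntegrableOn R (Ioi 0) :=
    integrable_finsetSum _ fun i _ => (hrel i).1.const_mul _
  have eR : ∫ s in Ioi (0 : ℝ), R s =
      ∑ i, lam i ^ 2 * relEntropy P (euc (others Y i)) (g i) := by
    rw [hR, integral_finsetSum _ fun i _ => (hrel i).1.const_mul _]
    refine Finset.sum_congr rfl fun i _ => ?_
    rw [integral_const_mul]
    exact congrArg _ (hrel i).2
  have iE : IntegrableOn (fun s : ℝ => Real.exp (-2 * s) * κ) (Ioi 0) :=
    (integrableOn_exp_mul_Ioi (by norm_num) 0).mul_const κ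
  have eE : ∫ s in Ioi (0 : ℝ), Real.exp (-2 * s) * κ = κ / 2 := by
    rw [integral_mul_const, integral_exp_mul_Ioi (by norm_num)]
    simp; ring
  have iD : IntegrableOn (fun s => ∫ ω, ‖weightedSum lam (relScore P (euc Y) (euc Z) s ω)‖ ^ 2 ∂P -
      ∫ ω, ‖relScore P (euc Y) (euc Z) s ω‖ ^ 2 ∂P + R s - Real.exp (-2 * s) * κ) (Ioi 0) :=
    ((iT.sub iV).add iR).sub iE
  have eD : ∀ s ∈ Ioi (0 : ℝ), ∫ ω, ‖weightedSum lam (relScore P (euc Y) (euc Z) s ω)‖ ^ 2 ∂P -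
      ∫ ω, ‖relScore P (euc Y) (euc Z) s ω‖ ^ 2 ∂P + R s - Real.exp (-2 * s) * κ =
        fisherDefect P lam (ouFlow Y Z s) :=
    fun s hs => (fisherDefect_ouFlow h h' hlam hs).symm
  refine ⟨iD.congr_fun eD measurableSet_Ioi, ?_⟩
  have i12 : IntegrableOn (fun s => ∫ ω, ‖weightedSum lam (relScore P (euc Y) (euc Z) s ω)‖ ^ 2 ∂P -
      ∫ ω, ‖relScore P (euc Y) (euc Z) s ω‖ ^ 2 ∂P) (Ioi 0) := iT.sub iV
  have i123 : IntegrableOn (fun s => ∫ ω, ‖weightedSum lam (relScore P (euc Y) (euc Z) s ω)‖ ^ 2 ∂P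
      - ∫ ω, ‖relScore P (euc Y) (euc Z) s ω‖ ^ 2 ∂P + R s) (Ioi 0) := i12.add iR
  rw [← setIntegral_congr_fun measurableSet_Ioi eD, integral_sub i123 iE, integral_add i12 iR,
    integral_sub iT iV, eE, eR]
  have eV' : ∫ s in Ioi (0 : ℝ), ∫ ω, ‖relScore P (euc Y) (euc Z) s ω‖ ^ 2 ∂P =
      relEntropy P (euc Y) f := eV
  rw [eS] at hdp
  rw [eV']
  -- in terms of differential entropies, second moments and Gaussian constants cancel
  set Λ : ℝ := ∑ i, Real.log (lam i)
  set c : ℝ := Real.log (2 * Real.pi)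
  have rS : relEntropy P (fun ω => weightedSum lam (euc Y ω)) q =
      -entropy P (fun ω => ∑ i, X i ω) + 1 / 2 * ∫ ω, ‖weightedSum lam (euc Y ω)‖ ^ 2 ∂P +
        d / 2 * c := by
    rw [relEntropy, hq.entropy_eq, finrank_euclideanSpace_fin]
  have rV : relEntropy P (euc Y) f =
      -(entropy P (vec X) - d * Λ) + 1 / 2 * ∫ ω, ‖euc Y ω‖ ^ 2 ∂P + n * d / 2 * c := by
    rw [relEntropy, hfe, finrank_ePi, Fintype.card_fin]
    simp only [Real.log_inv, Finset.sum_neg_distrib, Nat.cast_mul]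
    ring
  have rO : ∀ i, relEntropy P (euc (others Y i)) (g i) =
      -(entropy P (vec (others X i)) - d * (Λ - Real.log (lam i))) +
        1 / 2 * ∫ ω, ‖euc (others Y i) ω‖ ^ 2 ∂P + (n - 1) * d / 2 * c := by
    intro i
    rw [relEntropy, hge, finrank_ePi_ne, Fintype.card_fin,
      sum_subtype_ne_eq_sub (fun j => Real.log (lam j)⁻¹)]
    simp only [Real.log_inv, Finset.sum_neg_distrib]
    ring
  have e7 : ∑ i, lam i ^ 2 * relEntropy P (euc (others Y i)) (g i) =
      ∑ i, lam i ^ 2 * (condEntropy P (X i) (vec (others X i)) - d * Real.log (lam i)) +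
        1 / 2 * ∑ i, lam i ^ 2 * ∫ ω, ‖euc (others Y i) ω‖ ^ 2 ∂P +
        (-entropy P (vec X) + d * Λ + (n - 1) * d / 2 * c) := by
    have hK : ∀ K : ℝ, K = ∑ i, lam i ^ 2 * K := fun K => by
      rw [← Finset.sum_mul, hlam, one_mul]
    rw [hK (-entropy P (vec X) + d * Λ + (n - 1) * d / 2 * c), Finset.mul_sum, ← Finset.sum_add_distrib, ← Finset.sum_add_distrib]
    refine Finset.sum_congr rfl fun i _ => ?_
    rw [rO, condEntropy_eq_sub hX hXpdf hXent]
    ring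
  rw [e7, rV, hκ]
  linarith [hdp, rS]

end Weighted

/-! ### The weights given by the conditional entropy powers -/

section Weights

variable {Ω : Type*} [MeasurableSpace Ω] {P : Measure Ω} {n d : ℕ} {X : Fin n → Ω → E d}

lemma condEntropyPower_pos (i : Fin n) : 0 < condEntropyPower P X i := Real.exp_pos _

lemma sum_condEntropyPower_pos (hn : 1 ≤ n) : 0 < ∑ k, condEntropyPower P X k :=
  have : Nonempty (Fin n) := ⟨⟨0, hn⟩⟩
  Finset.sum_pos (fun i _ => condEntropyPower_pos i) Finset.univ_nonempty

lemma weight_sq (i : Fin n) :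
    weight P X i ^ 2 = condEntropyPower P X i / ∑ k, condEntropyPower P X k :=
  Real.sq_sqrt (div_nonneg (condEntropyPower_pos i).le
    (Finset.sum_nonneg fun k _ => (condEntropyPower_pos k).le))

lemma weight_pos (hn : 1 ≤ n) (i : Fin n) : 0 < weight P X i :=
  Real.sqrt_pos.2 (div_pos (condEntropyPower_pos i) (sum_condEntropyPower_pos hn))

lemma sum_weight_sq (hn : 1 ≤ n) : ∑ i, weight P X i ^ 2 = 1 := by
  simp only [weight_sq]
  rw [← Finset.sum_div, div_self (sum_condEntropyPower_pos hn).ne']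

/-- The weights equalize the entropies of the rescaled vectors. -/
lemma condEntropy_sub_log_weight (hn : 1 ≤ n) (hd : 1 ≤ d) (i : Fin n) :
    condEntropy P (X i) (vec (others X i)) - d * Real.log (weight P X i) =
      d / 2 * Real.log (∑ k, condEntropyPower P X k) := by
  have hd0 : (d : ℝ) ≠ 0 := by positivity
  rw [weight, Real.log_sqrt (div_nonneg (condEntropyPower_pos i).le
      (sum_condEntropyPower_pos hn).le),
    Real.log_div (condEntropyPower_pos i).ne' (sum_condEntropyPower_pos hn).ne',
    condEntropyPower, Real.log_exp]
  field_simp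
  ring

end Weights

end

end DepEPI

end

open DepEPI
theorem mainTheorem2 {Ω : Type*} [MeasurableSpace Ω] (P : Measure Ω) [IsProbabilityMeasure P]
    (n d : ℕ) (hn : 1 ≤ n) (hd : 1 ≤ d) (X Z : Fin n → Ω → E d)
    (hX : ∀ i, Measurable (X i)) (hXpdf : HasPDF (vec X) P)
    (hXmom : ∀ i, MemLp (X i) 2 P)
    (hXent : HasFiniteEntropy P (vec X))
    (hXent' : ∀ i, HasFiniteEntropy P (vec (others X i)))
    (hSent : HasFiniteEntropy P (fun ω => ∑ i, X i ω))
    (hZ : ∀ i, Measurable (Z i)) (hZlaw : ∀ i, P.map (Z i) = stdGaussian (E d))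
    (hZindep : iIndepFun Z P) (hXZ : IndepFun (vec X) (vec Z) P) :
    (∀ s : ℝ, 0 < s → HasFiniteFisherInfo P (ouFlow (rescaled P X) Z s) ∧
      ∀ i, HasFiniteFisherInfo P (others (ouFlow (rescaled P X) Z s) i)) ∧
    IntegrableOn (errorIntegrand P X Z) (Set.Ioi 0) ∧
    Real.exp (2 / d * entropy P (fun ω => ∑ i, X i ω)) ≥
      (∑ i, Real.exp (2 / d * condEntropy P (X i) (vec (others X i)))) *
        Real.exp (-errorTerm P X Z) ∧
    ((∀ s : ℝ, 0 < s → ∀ i j, i ≠ j → fisherEntry P (ouFlow (rescaled P X) Z s) i j ≤ 0) →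
      Real.exp (2 / d * entropy P (fun ω => ∑ i, X i ω)) ≥
        ∑ i, Real.exp (2 / d * condEntropy P (X i) (vec (others X i)))) := by
  set Y := rescaled P X with hYdef
  have hpos := weight_pos (P := P) (X := X) hn
  have hlam := sum_weight_sq (P := P) (X := X) hn
  have hY : ∀ i, Measurable (Y i) := fun i => (hX i).const_smul (weight P X i)⁻¹
  have hYmom : ∀ i, MemLp (Y i) 2 P := fun i => (hXmom i).const_smul (weight P X i)⁻¹
  have hYZ : IndepFun (vec Y) (vec Z) P := by
    have hm : Measurable (fun (x : Fin n → E d) i => (weight P X i)⁻¹ • x i) :=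
      measurable_pi_lambda _ fun i => (measurable_pi_apply i).const_smul (weight P X i)⁻¹
    exact hXZ.comp hm measurable_id
  have h : IsGaussianPair P (euc Y) (euc Z) := isGaussianPair_toLp hY hYmom hZ hZlaw hZindep hYZ
  have h' := isGaussianPair_others hY hYmom hZ hZlaw hZindep hYZ
  obtain ⟨hint, hle⟩ := le_integral_fisherDefect hn hX hXpdf hXent hXent' hSent hpos hlam h h'
  have hd0 : (0 : ℝ) < d := by exact_mod_cast hd
  have hNpos : 0 < ∑ i, condEntropyPower P X i := sum_condEntropyPower_pos hn
  -- the choice of the weights makes the lower bound for the error term explicit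
  have hlog : Real.log (∑ i, condEntropyPower P X i) - errorTerm P X Z ≤
      2 / d * entropy P (fun ω => ∑ i, X i ω) := by
    simp only [condEntropy_sub_log_weight hn hd] at hle
    rw [← Finset.sum_mul, hlam, one_mul] at hle
    have h2 := mul_le_mul_of_nonneg_left hle (show (0 : ℝ) ≤ 2 / d by positivity)
    have h3 : errorTerm P X Z = 2 / d * ∫ s in Set.Ioi (0 : ℝ),
      fisherDefect P (weight P X) (ouFlow (fun i ω => (weight P X i)⁻¹ • X i ω) Z s) := rfl
    rw [← h3, mul_add] at h2
    have h4 : (2 : ℝ) / d * (d / 2 * Real.log (∑ i, condEntropyPower P X i)) =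
        Real.log (∑ i, condEntropyPower P X i) := by field_simp
    rw [h4] at h2
    linarith
  have hmain : Real.exp (2 / d * entropy P (fun ω => ∑ i, X i ω)) ≥
      (∑ i, condEntropyPower P X i) * Real.exp (-errorTerm P X Z) := by
    have h5 := Real.exp_le_exp.2 hlog
    rwa [sub_eq_add_neg, Real.exp_add, Real.exp_log hNpos] at h5
  refine ⟨fun s hs => ⟨hasFiniteFisherInfo_ouFlow h hs,
    fun i => hasFiniteFisherInfo_ouFlow (h' i) hs⟩, hint, hmain, fun hoff => ?_⟩
  have herr : errorTerm P X Z ≤ 0 :=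
    mul_nonpos_of_nonneg_of_nonpos (by positivity)
      (setIntegral_nonpos measurableSet_Ioi fun s hs =>
        fisherDefect_ouFlow_nonpos h h' hpos hlam hs (hoff s hs))
  refine le_trans ?_ hmain
  exact le_mul_of_one_le_right hNpos.le (Real.one_le_exp (by linarith))
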